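/- For $\mathbf w\in\mathbb R^d$, $t\in\mathbb R$ let $h_{\mathbf w,t}(\mathbf x)=\mathrm{sign}(\mathbf w\cdot\mathbf x+t)\in\{\pm1\}$, with $\mathrm{sign}(0)=1$, and let $\mathcal C$ be the class of all these halfspaces on $\mathbb R^d$ ($\mathbf w=0$ allowed). For $\eta\in(0,1/2)$ and a target $f\in\mathcal C$, let $\mathcal D$ be the distribution of $(\mathbf x,y)\in\mathbb R^d\times\{\pm1\}$ in which $\mathbf x$ is standard Gaussian and, conditionally on $\mathbf x$, $y=f(\mathbf x)$ with probability $1-\eta$ and $y=-f(\mathbf x)$ with probability $\eta$ (random classification noise of rate $\eta$). Let $p=\min\{\Pr[f(\mathbf x)=1],\Pr[f(\mathbf x)=-1]\}$ be the bias of $f$, and let $\mathrm{err}(h)=\Pr_{(\mathbf x,y)\sim\mathcal D}[h(\mathbf x)\ne y]$. There are an algorithm (a single program for a real random access machine with unit-cost operations $+,-,\times,/,\sqrt{\cdot},\exp,\log$ and comparisons, which can draw independent labelled samples from $\mathcal D$, at a cost linear in $d$ per sample) and absolute constants $C>0$, $k\in\mathbb N$ such that the following holds for all $d\ge1$ and $\varepsilon,\delta\in(0,1/2)$.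 The algorithm is given $d,\varepsilon,\delta$ and access to samples, but not $\eta$, $f$ or $p$. It always halts and returns a halfspace $h\in\mathcal C$, after at most $C\,dN/\varepsilon^2$ steps, where $N$ is the number of samples it has drawn. For all $\eta\in(0,1/2)$ and $f\in\mathcal C$, with probability at least $1-\delta$ over the samples, both $$\mathrm{err}(h)\le\eta+\varepsilon\qquad\text{and}\qquad N\le C\,A\,(\log A)^k\log(1/\delta),\qquad A=\frac{d}{(1-2\eta)\varepsilon}+\frac{d}{\max(p(1-2\eta),\varepsilon)^2}.$$ -/

import Mathlib

open MeasureTheory ProbabilityTheory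

noncomputable section

/-! ### Halfspaces, random classification noise, bias -/

/-- The sign with values in `{1, -1}`; the sign of `0` is `1`. Labels live in `ℤˣ = {1, -1}`. -/
def sgn (u : ℝ) : ℤˣ := if 0 ≤ u then 1 else -1

/-- The halfspace `x ↦ sgn (w · x + t)`; `w = 0` is allowed. -/
def halfspace {d : ℕ} (w : EuclideanSpace ℝ (Fin d)) (t : ℝ) (x : EuclideanSpace ℝ (Fin d)) : ℤˣ :=
  sgn (inner ℝ w x + t)

/-- `D` is a distribution of labelled examples `(x, y)` whose `x`-marginal is the standard Gaussian
and in which, conditionally on `x`, the label `y` equals `f x` with probability `1 - η` (hence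
`-f x` with probability `η`). -/
structure IsRCN {d : ℕ} (D : Measure (EuclideanSpace ℝ (Fin d) × ℤˣ))
    (f : EuclideanSpace ℝ (Fin d) → ℤˣ) (η : ℝ) : Prop where
  marginal : D.map Prod.fst = stdGaussian (EuclideanSpace ℝ (Fin d))
  label : ∀ B : Set (EuclideanSpace ℝ (Fin d)), MeasurableSet B →
    D {z | z.1 ∈ B ∧ z.2 = f z.1} =
      ENNReal.ofReal (1 - η) * stdGaussian (EuclideanSpace ℝ (Fin d)) B

/-- The bias of a Boolean function under the standard Gaussian. -/
def bias {d : ℕ} (f : EuclideanSpace ℝ (Fin d) → ℤˣ) : ℝ :=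
  min ((stdGaussian (EuclideanSpace ℝ (Fin d))).real {x | f x = 1})
    ((stdGaussian (EuclideanSpace ℝ (Fin d))).real {x | f x = -1})

/-- The `0-1` error of a hypothesis `h` under `D`. -/
def zeroOneError {d : ℕ} (D : Measure (EuclideanSpace ℝ (Fin d) × ℤˣ))
    (h : EuclideanSpace ℝ (Fin d) → ℤˣ) : ℝ :=
  D.real {z | h z.1 ≠ z.2}

/-- The argument of the soft-O in the sample complexity. -/
def sampleScale (d : ℕ) (ε η p : ℝ) : ℝ :=
  d / ((1 - 2 * η) * ε) + d / (max (p * (1 - 2 * η)) ε) ^ 2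

/-! ### A real random access machine with sample access

Finite programs of a structured language over a memory of natural-number cells (counters and
addresses) and a memory of real cells, both with indirect addressing. Every operation on numbers,
every memory access and every test costs one step; drawing a `d`-dimensional labelled example costs
one step per number written. The only literals are natural numbers, and there is no rounding
operation that turns a real into a natural number. -/

namespace RealRAM

/-- Natural-number expressions. -/
inductive NExp where
  | lit (n : ℕ)
  | read (a : NExp)
  | add (a b : NExp)
  | sub (a b : NExp)
  | mul (a b : NExp)

/-- Real expressions. -/
inductive RExp where
  | cast (a : NExp)
  | read (a : NExp)
  | add (a b : RExp)
  | sub (a b : RExp)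
  | mul (a b : RExp)
  | div (a b : RExp)
  | sqrt (a : RExp)
  | exp (a : RExp)
  | log (a : RExp)

/-- Tests. -/
inductive BExp where
  | ltN (a b : NExp)
  | ltR (a b : RExp)
  | not (b : BExp)
  | and (b c : BExp)

/-- Programs. -/
inductive Prog where
  | skip
  | setN (a : NExp) (e : NExp)
  | setR (a : NExp) (e : RExp)
  | draw (a : NExp)
  | seq (c₁ c₂ : Prog)
  | ite (b : BExp) (c₁ c₂ : Prog)
  | while (b : BExp) (c : Prog)

/-- Machine states: the two memories and the number of examples drawn so far. -/
structure State where
  nmem : ℕ → ℕ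
  rmem : ℕ → ℝ
  drawn : ℕ

/-- Value of a natural-number expression; `sub` is truncated. -/
def NExp.eval (σ : State) : NExp → ℕ
  | .lit n => n
  | .read a => σ.nmem (a.eval σ)
  | .add a b => a.eval σ + b.eval σ
  | .sub a b => a.eval σ - b.eval σ
  | .mul a b => a.eval σ * b.eval σ

def NExp.cost : NExp → ℕ
  | .lit _ => 1
  | .read a => a.cost + 1
  | .add a b => a.cost + b.cost + 1
  | .sub a b => a.cost + b.cost + 1
  | .mul a b => a.cost + b.cost + 1

def RExp.eval (σ : State) : RExp → ℝ
  | .cast a => (a.eval σ : ℝ)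
  | .read a => σ.rmem (a.eval σ)
  | .add a b => a.eval σ + b.eval σ
  | .sub a b => a.eval σ - b.eval σ
  | .mul a b => a.eval σ * b.eval σ
  | .div a b => a.eval σ / b.eval σ
  | .sqrt a => Real.sqrt (a.eval σ)
  | .exp a => Real.exp (a.eval σ)
  | .log a => Real.log (a.eval σ)

def RExp.cost : RExp → ℕ
  | .cast a => a.cost + 1
  | .read a => a.cost + 1
  | .add a b => a.cost + b.cost + 1
  | .sub a b => a.cost + b.cost + 1
  | .mul a b => a.cost + b.cost + 1
  | .div a b => a.cost + b.cost + 1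
  | .sqrt a => a.cost + 1
  | .exp a => a.cost + 1
  | .log a => a.cost + 1

def BExp.holds (σ : State) : BExp → Prop
  | .ltN a b => a.eval σ < b.eval σ
  | .ltR a b => a.eval σ < b.eval σ
  | .not b => ¬ b.holds σ
  | .and b c => b.holds σ ∧ c.holds σ

def BExp.cost : BExp → ℕ
  | .ltN a b => a.cost + b.cost + 1
  | .ltR a b => a.cost + b.cost + 1
  | .not b => b.cost + 1
  | .and b c => b.cost + c.cost + 1

/-- The real memory after the example `(x, y)` has been written to the cells
`a, …, a + d - 1` (coordinates of `x`) and `a + d` (label `y`). -/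
def writeExample {d : ℕ} (r : ℕ → ℝ) (a : ℕ) (z : EuclideanSpace ℝ (Fin d) × ℤˣ) : ℕ → ℝ :=
  fun j =>
    if h : a ≤ j ∧ j < a + d then z.1 ⟨j - a, by omega⟩
    else if j = a + d then ((z.2 : ℤ) : ℝ)
    else r j

/-- `Exec s c σ σ' n`: started in state `σ`, with the sequence `s` of labelled examples as the
source of samples, the program `c` halts in state `σ'` after `n` steps. -/
inductive Exec {d : ℕ} (s : ℕ → EuclideanSpace ℝ (Fin d) × ℤˣ) :
    Prog → State → State → ℕ → Prop
  | skip (σ : State) : Exec s .skip σ σ 1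
  | setN (a e : NExp) (σ : State) :
      Exec s (.setN a e) σ { σ with nmem := Function.update σ.nmem (a.eval σ) (e.eval σ) }
        (a.cost + e.cost + 1)
  | setR (a : NExp) (e : RExp) (σ : State) :
      Exec s (.setR a e) σ { σ with rmem := Function.update σ.rmem (a.eval σ) (e.eval σ) }
        (a.cost + e.cost + 1)
  | draw (a : NExp) (σ : State) :
      Exec s (.draw a) σ
        { σ with rmem := writeExample σ.rmem (a.eval σ) (s σ.drawn), drawn := σ.drawn + 1 }
        (a.cost + d + 1)
  | seq {c₁ c₂ : Prog} {σ₀ σ₁ σ₂ : State} {m n : ℕ} (h₁ : Exec s c₁ σ₀ σ₁ m)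
      (h₂ : Exec s c₂ σ₁ σ₂ n) : Exec s (.seq c₁ c₂) σ₀ σ₂ (m + n)
  | iteTrue {b : BExp} {c₁ c₂ : Prog} {σ σ' : State} {n : ℕ} (hb : b.holds σ)
      (h : Exec s c₁ σ σ' n) : Exec s (.ite b c₁ c₂) σ σ' (b.cost + n)
  | iteFalse {b : BExp} {c₁ c₂ : Prog} {σ σ' : State} {n : ℕ} (hb : ¬ b.holds σ)
      (h : Exec s c₂ σ σ' n) : Exec s (.ite b c₁ c₂) σ σ' (b.cost + n)
  | whileTrue {b : BExp} {c : Prog} {σ₀ σ₁ σ₂ : State} {m n : ℕ} (hb : b.holds σ₀)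
      (h₁ : Exec s c σ₀ σ₁ m) (h₂ : Exec s (.while b c) σ₁ σ₂ n) :
      Exec s (.while b c) σ₀ σ₂ (b.cost + m + n)
  | whileFalse {b : BExp} {c : Prog} {σ : State} (hb : ¬ b.holds σ) :
      Exec s (.while b c) σ σ b.cost

/-- Execution is deterministic: the final state and the number of steps are unique. -/
theorem Exec.unique {d : ℕ} {s : ℕ → EuclideanSpace ℝ (Fin d) × ℤˣ} {c : Prog}
    {σ σ₁ σ₂ : State} {m n : ℕ} (h₁ : Exec s c σ σ₁ m) (h₂ : Exec s c σ σ₂ n) :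
    σ₁ = σ₂ ∧ m = n := by
  induction h₁ generalizing σ₂ n with
  | skip | setN | setR | draw => cases h₂; exact ⟨rfl, rfl⟩
  | seq _ _ ih₁ ih₂ =>
    cases h₂ with
    | seq k₁ k₂ =>
      obtain ⟨rfl, rfl⟩ := ih₁ k₁
      obtain ⟨rfl, rfl⟩ := ih₂ k₂
      exact ⟨rfl, rfl⟩
  | iteTrue hb _ ih =>
    cases h₂ with
    | iteTrue _ k => obtain ⟨rfl, rfl⟩ := ih k; exact ⟨rfl, rfl⟩
    | iteFalse hb' _ => exact absurd hb hb'
  | iteFalse hb _ ih =>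
    cases h₂ with
    | iteTrue hb' _ => exact absurd hb' hb
    | iteFalse _ k => obtain ⟨rfl, rfl⟩ := ih k; exact ⟨rfl, rfl⟩
  | whileTrue hb _ _ ih₁ ih₂ =>
    cases h₂ with
    | whileTrue _ k₁ k₂ =>
      obtain ⟨rfl, rfl⟩ := ih₁ k₁
      obtain ⟨rfl, rfl⟩ := ih₂ k₂
      exact ⟨rfl, rfl⟩
    | whileFalse hb' => exact absurd hb hb'
  | whileFalse hb =>
    cases h₂ with
    | whileTrue hb' _ _ => exact absurd hb' hb
    | whileFalse _ => exact ⟨rfl, rfl⟩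

/-- The initial state: the dimension is in the first natural-number cell, `ε` and `δ` are in the
first two real cells, all other cells are `0`, and no example has been drawn. -/
def init (d : ℕ) (ε δ : ℝ) : State where
  nmem := fun i => if i = 0 then d else 0
  rmem := fun i => if i = 0 then ε else if i = 1 then δ else 0
  drawn := 0

/-- The halfspace returned in a final state: its weight vector is in the real cells
`0, …, d - 1`, its threshold in the real cell `d`. -/
def State.output (σ : State) (d : ℕ) : EuclideanSpace ℝ (Fin d) → ℤˣ :=
  halfspace (WithLp.toLp 2 fun i : Fin d => σ.rmem i) (σ.rmem d)

end RealRAM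

end

/-! Normalize the target to `w` with norm 1 or 0. Noise multiplies every correlation with the label
by `1 - 2η` (`IsRCN.integral_label_mul`), and the excess error of a hypothesis is `1 - 2η` times its
Gaussian disagreement with the target (`IsRCN.zeroOneError_eq`).

Write φ for the Gaussian density and Λ for `Lam ε`, of order log(1/ε). For a unit `w`, the label's
first Chow vector has mean `2(1-2η)φ(t) w`, and its second Hermite coefficient along `v` has mean
`-2(1-2η) t φ(t) ⟪v,w⟫²`. So the empirical Chow vector gives a direction, its norm `m` estimates the
unknown scale `2(1-2η)φ(t)`, and minus the quotient of the second statistic by `m` estimates `t`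
(`initial_hypothesis`, `Good.rough`).

This rough hypothesis is improved in stages, each halving the error ρ. Given `(v,s)`, only examples
with `|⟪v,x⟫ + s| ≤ σ` count, with a weight that turns the Gaussian along `v` into a uniform law on
this band. If the target boundary is `⟪v,x⟫ + ⟪a,x⟫ + B = 0` with `a` orthogonal to `v`, integrating
along `v` leaves exactly the truncation of `⟪a,x⟫ + B - s` at level σ
(`integral_halfspace_mul_band`). Up to an error of third order (`abs_integral_clip_sub_le`) the
averages therefore read off `a` and `B - s`, multiplied by `2(1-2η)φ(s) ≈ m`. The statistics have
second moment of order σφ(s), not of order 1 (`integral_band_statistic_sq_le`); this is where the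
term `d/((1-2η)ε)` comes from instead of one quadratic in `1/ε`. Both the noise and the bias are a
small fraction of ρ/Λ (`Good.stage_step`), which suffices for `refine_step`. Disagreement is at most
a constant times ρφ(s) (`disagreement_le`), so the excess error is of order mρ, which is observable:
the stages stop once `120 m ρ ≤ ε`.

Neither `η` nor the bias is known, so block lengths double from round to round, and tests involving
only `m`, the estimated threshold, ε and the round decide when to refine (`Accept`). A round so long
that ε-sized signals would be visible, but still rejected, certifies that `(1-2η)` times the bias is
below `0.1 ε`, and a constant hypothesis suffices (`Long`, `Good.bias_le_of_long`). Conversely, a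
round that is neither accepted nor long has `2^i` bounded by the claimed scale up to powers of Λ
(`Good.two_pow_le`); as the lengths grow geometrically and there are at most Λ stages, this bounds
the sample number.

Probability enters once, through `Good`: all averages up to fixed numbers of rounds and stages are
near their means. Each statistic depends on earlier samples but is averaged over a fresh block, so
conditioning (`measure_adaptive_le`) and a Bernstein bound apply, followed by a union bound.
Finally, `learner` is shown to compute this model in `O(d)` steps per sample, and to halt on every
sample sequence, because `2^i` outgrows the long-round bound and ρ tends to 0
(`exists_exec_learner`). -/

noncomputable section

open scoped RealInnerProductSpace

/-! ### Gaussian integrals -/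

section Gaussian

variable {E : Type*} [NormedAddCommGroup E] [InnerProductSpace ℝ E] [FiniteDimensional ℝ E]
  [MeasurableSpace E] [BorelSpace E]

/-- Replacing the component of a standard Gaussian along a unit vector by an independent standard
Gaussian does not change the law. -/
theorem stdGaussian_resample {v : E} (hv : ‖v‖ = 1) :
    ((stdGaussian E).prod (gaussianReal 0 1)).map (fun z => z.1 - ⟪v, z.1⟫ • v + z.2 • v) =
      stdGaussian E := by
  have hm : Measurable (fun z : E × ℝ => z.1 - ⟪v, z.1⟫ • v + z.2 • v) := by fun_prop
  have : IsProbabilityMeasure (((stdGaussian E).prod (gaussianReal 0 1)).map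
      (fun z => z.1 - ⟪v, z.1⟫ • v + z.2 • v)) :=
    Measure.isProbabilityMeasure_map hm.aemeasurable
  apply Measure.ext_of_charFun
  ext ξ
  rw [charFun_apply, integral_map hm.aemeasurable
    (Measurable.aestronglyMeasurable (by fun_prop)), charFun_stdGaussian]
  have h1 : ∀ z : E × ℝ, Complex.exp (⟪z.1 - ⟪v, z.1⟫ • v + z.2 • v, ξ⟫ * Complex.I) =
      Complex.exp (⟪z.1, ξ - ⟪v, ξ⟫ • v⟫ * Complex.I) *
        Complex.exp (⟪z.2, ⟪v, ξ⟫⟫ * Complex.I) := by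
    intro z
    rw [← Complex.exp_add]
    congr 1
    have : ⟪z.1 - ⟪v, z.1⟫ • v + z.2 • v, ξ⟫ = ⟪z.1, ξ - ⟪v, ξ⟫ • v⟫ + ⟪z.2, ⟪v, ξ⟫⟫ := by
      simp only [inner_add_left, inner_sub_left, inner_sub_right, real_inner_smul_left,
        real_inner_smul_right, real_inner_comm v]
      simp [mul_comm]
    rw [this]; push_cast; ring
  simp_rw [h1]
  rw [integral_prod_mul (fun x : E => Complex.exp (⟪x, ξ - ⟪v, ξ⟫ • v⟫ * Complex.I))
    (fun r : ℝ => Complex.exp (⟪r, ⟪v, ξ⟫⟫ * Complex.I)), ← charFun_apply, ← charFun_apply,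
    charFun_stdGaussian, charFun_gaussianReal, ← Complex.exp_add]
  congr 1
  have h2 : ‖ξ - ⟪v, ξ⟫ • v‖ ^ 2 + ⟪v, ξ⟫ ^ 2 = ‖ξ‖ ^ 2 := by
    rw [norm_sub_sq_real, norm_smul, real_inner_smul_right, hv, real_inner_comm]
    simp; ring
  have h3 : ((‖ξ‖ : ℝ) : ℂ) ^ 2 = (‖ξ - ⟪v, ξ⟫ • v‖ : ℂ) ^ 2 + (⟪v, ξ⟫ : ℂ) ^ 2 := by
    rw [← Complex.ofReal_pow, ← h2]; push_cast; rfl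
  rw [h3]
  simp
  ring

theorem integrable_resample {v : E} (hv : ‖v‖ = 1) {F : E → ℝ}
    (hF : Integrable F (stdGaussian E)) :
    Integrable (fun z : E × ℝ => F (z.1 - ⟪v, z.1⟫ • v + z.2 • v))
      ((stdGaussian E).prod (gaussianReal 0 1)) := by
  have hm : Measurable (fun z : E × ℝ => z.1 - ⟪v, z.1⟫ • v + z.2 • v) := by fun_prop
  rw [← stdGaussian_resample hv] at hF
  exact (integrable_map_measure hF.aestronglyMeasurable hm.aemeasurable).1 hF

/-- Fubini for the resampling identity: the inner integral runs along `v` with the orthogonal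
component frozen. This reduces the halfspace and band integrals to one-dimensional ones. -/
theorem integral_resample {v : E} (hv : ‖v‖ = 1) {F : E → ℝ}
    (hF : Integrable F (stdGaussian E)) :
    ∫ x, F x ∂(stdGaussian E) =
      ∫ x, ∫ r, F (x - ⟪v, x⟫ • v + r • v) ∂(gaussianReal 0 1) ∂(stdGaussian E) := by
  have hm : Measurable (fun z : E × ℝ => z.1 - ⟪v, z.1⟫ • v + z.2 • v) := by fun_prop
  conv_lhs => rw [← stdGaussian_resample hv]
  rw [integral_map hm.aemeasurable (by rw [stdGaussian_resample hv]; exact hF.1),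
    integral_prod _ (integrable_resample hv hF)]

theorem stdGaussian_map_inner (e : E) :
    (stdGaussian E).map (fun x => ⟪e, x⟫) = gaussianReal 0 (‖e‖₊ ^ 2) := by
  have : IsProbabilityMeasure ((stdGaussian E).map (fun x => ⟪e, x⟫)) :=
    Measure.isProbabilityMeasure_map (by fun_prop)
  apply Measure.ext_of_charFun
  ext ξ
  rw [charFun_apply, integral_map (by fun_prop) (Measurable.aestronglyMeasurable (by fun_prop)),
    charFun_gaussianReal]
  have : ∀ x : E, ⟪⟪e, x⟫, ξ⟫ = ⟪x, ξ • e⟫ := by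
    intro x; rw [real_inner_smul_right, real_inner_comm]; simp [mul_comm, real_inner_comm]
  simp_rw [this]
  rw [← charFun_apply, charFun_stdGaussian, norm_smul]
  congr 1
  have h3 : (((‖ξ‖ : ℝ) : ℂ)) ^ 2 = (ξ : ℂ) ^ 2 := by
    rw [← Complex.ofReal_pow, Real.norm_eq_abs, sq_abs]; simp
  push_cast
  rw [mul_pow, h3]
  simp
  ring

theorem integrable_exp_inner (e : E) (a : ℝ) :
    Integrable (fun x => Real.exp (a * ⟪e, x⟫)) (stdGaussian E) := by
  have h := integrable_exp_mul_gaussianReal (μ := 0) (v := ‖e‖₊ ^ 2) a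
  rw [← stdGaussian_map_inner e] at h
  exact (integrable_map_measure h.1 (by fun_prop)).1 h

theorem integral_exp_inner (e : E) (a : ℝ) :
    ∫ x, Real.exp (a * ⟪e, x⟫) ∂(stdGaussian E) = Real.exp (a ^ 2 * ‖e‖ ^ 2 / 2) := by
  have h := mgf_gaussianReal (stdGaussian_map_inner e) a
  rw [mgf] at h
  rw [h]; congr 1; push_cast; ring

theorem integrable_exp_abs_inner (e : E) (a : ℝ) :
    Integrable (fun x => Real.exp (a * |⟪e, x⟫|)) (stdGaussian E) := by
  refine ((integrable_exp_inner e a).add (integrable_exp_inner e (-a))).mono'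
    (Measurable.aestronglyMeasurable (by fun_prop)) (ae_of_all _ fun x => ?_)
  rw [Real.norm_eq_abs, abs_of_pos (Real.exp_pos _)]
  simp only [Pi.add_apply]
  rcases abs_cases ⟪e, x⟫ with ⟨h, _⟩ | ⟨h, _⟩ <;> rw [h]
  · linarith [Real.exp_pos (-a * ⟪e, x⟫)]
  · rw [mul_neg, ← neg_mul]; linarith [Real.exp_pos (a * ⟪e, x⟫)]

theorem integral_exp_abs_inner_le (e : E) (a : ℝ) :
    ∫ x, Real.exp (a * |⟪e, x⟫|) ∂(stdGaussian E) ≤ 2 * Real.exp (a ^ 2 * ‖e‖ ^ 2 / 2) := by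
  calc _ ≤ ∫ x, (Real.exp (a * ⟪e, x⟫) + Real.exp (-a * ⟪e, x⟫)) ∂(stdGaussian E) := by
        refine integral_mono (integrable_exp_abs_inner e a)
          ((integrable_exp_inner e a).add (integrable_exp_inner e (-a))) fun x => ?_
        rcases abs_cases ⟪e, x⟫ with ⟨h, _⟩ | ⟨h, _⟩ <;> simp only [h]
        · linarith [Real.exp_pos (-a * ⟪e, x⟫)]
        · rw [mul_neg, ← neg_mul]; linarith [Real.exp_pos (a * ⟪e, x⟫)]
    _ = _ := by
        rw [integral_add (integrable_exp_inner e a) (integrable_exp_inner e (-a)),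
          integral_exp_inner, integral_exp_inner]
        ring_nf

theorem memLp_inner (e : E) (p : ENNReal) (hp : p ≠ ⊤) :
    MemLp (fun x => ⟪e, x⟫) p (stdGaussian E) :=
  (IsGaussian.memLp_id (stdGaussian E) p hp).const_inner e

theorem integral_inner_stdGaussian (e : E) : ∫ x, ⟪e, x⟫ ∂(stdGaussian E) = 0 := by
  have := integral_strongDual_stdGaussian (E := E) (innerSL ℝ e)
  simpa using this

theorem integral_inner_mul_inner (a e : E) :
    ∫ x, ⟪a, x⟫ * ⟪e, x⟫ ∂(stdGaussian E) = ⟪a, e⟫ := by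
  have h : covarianceBilin (stdGaussian E) a e = innerSL ℝ a e := by
    rw [covarianceBilin_stdGaussian]
  rw [covarianceBilin_apply (IsGaussian.memLp_id _ 2 (by simp))] at h
  simpa [integral_id_stdGaussian] using h

end Gaussian

/-! ### The sign function and one-dimensional Gaussian integrals against it. -/

/-- The sign as a real number. -/
def rsgn (u : ℝ) : ℝ := if 0 ≤ u then 1 else -1

theorem sgn_cast (u : ℝ) : (((sgn u : ℤˣ) : ℤ) : ℝ) = rsgn u := by
  unfold sgn rsgn; split_ifs <;> simp

theorem measurable_rsgn : Measurable rsgn :=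
  Measurable.ite measurableSet_Ici measurable_const measurable_const

theorem abs_rsgn (u : ℝ) : |rsgn u| = 1 := by unfold rsgn; split_ifs <;> simp

theorem sgn_eq_one_iff (u : ℝ) : sgn u = 1 ↔ 0 ≤ u := by
  unfold sgn; split_ifs with h <;> simp [h]

theorem sgn_eq_neg_one_iff (u : ℝ) : sgn u = -1 ↔ u < 0 := by
  unfold sgn; split_ifs with h
  · simp [h]
  · simp at h; simp [h]

theorem measurable_sgn : Measurable sgn :=
  Measurable.ite measurableSet_Ici measurable_const measurable_const

/-- The standard Gaussian density. -/
def gdens (t : ℝ) : ℝ := Real.exp (-t ^ 2 / 2) / Real.sqrt (2 * Real.pi)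

theorem gaussianPDFReal_zero_one (x : ℝ) : gaussianPDFReal 0 1 x = gdens x := by
  rw [gaussianPDFReal, gdens]; simp; ring

theorem gdens_pos (t : ℝ) : 0 < gdens t := by unfold gdens; positivity

theorem hasDerivAt_gdens (t : ℝ) : HasDerivAt gdens (-t * gdens t) t := by
  have h : HasDerivAt (fun t : ℝ => -t ^ 2 / 2) (-t) t := by
    have := ((hasDerivAt_pow 2 t).fun_neg).div_const 2
    exact this.congr_deriv (by simp; ring)
  have := h.exp.div_const (Real.sqrt (2 * Real.pi))
  unfold gdens
  exact this.congr_deriv (by ring)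

theorem integrable_gdens : Integrable gdens := by
  have := integrable_gaussianPDFReal 0 1
  simpa only [funext gaussianPDFReal_zero_one] using this

theorem integral_gaussian_eq (f : ℝ → ℝ) :
    ∫ x, f x ∂(gaussianReal 0 1) = ∫ x, gdens x * f x := by
  rw [integral_gaussianReal_eq_integral_smul one_ne_zero]
  simp [gaussianPDFReal_zero_one]

theorem integrable_gaussian_iff (f : ℝ → ℝ) :
    Integrable f (gaussianReal 0 1) ↔ Integrable (fun x => gdens x * f x) := by
  rw [gaussianReal_of_var_ne_zero _ one_ne_zero, integrable_withDensity_iff_integrable_smul'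
    (measurable_gaussianPDF 0 1) (ae_of_all _ fun x => gaussianPDF_lt_top)]
  simp [toReal_gaussianPDF, gaussianPDFReal_zero_one]

theorem integrable_pow_gaussian (n : ℕ) : Integrable (fun x : ℝ => x ^ n) (gaussianReal 0 1) := by
  have := (memLp_id_gaussianReal (μ := 0) (v := 1) n).integrable_norm_pow'
  refine this.mono' (by fun_prop) (ae_of_all _ fun x => ?_)
  simp

theorem integral_sq_gaussian : ∫ x : ℝ, x ^ 2 ∂(gaussianReal 0 1) = 1 := by
  have := variance_id_gaussianReal (μ := 0) (v := 1)
  rw [variance_eq_sub (memLp_id_gaussianReal (μ := 0) (v := 1) 2)] at this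
  simpa using this

/-- As `g` has mean zero, the sign may be replaced by twice the indicator of `[-t, ∞)`. The
fundamental theorem of calculus then leaves `-G(-t)`; the boundary term at infinity vanishes because
`G` and its derivative are both integrable. -/
theorem integral_rsgn_mul {g G : ℝ → ℝ} (t : ℝ) (hg : Integrable g (gaussianReal 0 1))
    (hg0 : ∫ x, g x ∂(gaussianReal 0 1) = 0)
    (hG : ∀ x, HasDerivAt G (gdens x * g x) x) (hGi : Integrable G) :
    ∫ x, rsgn (x + t) * g x ∂(gaussianReal 0 1) = -2 * G (-t) := by
  have h1 : ∀ x, rsgn (x + t) * g x = 2 * (Set.Ici (-t)).indicator g x - g x := by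
    intro x
    unfold rsgn
    by_cases h : 0 ≤ x + t
    · rw [if_pos h, Set.indicator_of_mem (by simp; linarith)]; ring
    · rw [if_neg h, Set.indicator_of_notMem (by simp; linarith)]; ring
  simp_rw [h1]
  rw [integral_sub ((hg.indicator measurableSet_Ici).const_mul 2) hg, hg0, sub_zero,
    integral_const_mul, integral_gaussian_eq]
  have h2 : ∀ x, gdens x * (Set.Ici (-t)).indicator g x =
      (Set.Ici (-t)).indicator (fun x => gdens x * g x) x := by
    intro x; by_cases h : x ∈ Set.Ici (-t) <;> simp [Set.indicator, h]
  simp_rw [h2]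
  rw [integral_indicator measurableSet_Ici, integral_Ici_eq_integral_Ioi]
  have hi := ((integrable_gaussian_iff g).1 hg)
  rw [integral_Ioi_of_hasDerivAt_of_tendsto' (m := 0) (fun x _ => hG x) hi.integrableOn]
  · ring
  · exact tendsto_zero_of_hasDerivAt_of_integrableOn_Ioi (a := 0) (fun x _ => hG x)
      hi.integrableOn hGi.integrableOn

theorem integral_rsgn_mul_id (t : ℝ) :
    ∫ x, rsgn (x + t) * x ∂(gaussianReal 0 1) = 2 * gdens t := by
  rw [integral_rsgn_mul (G := fun x => - gdens x) t (by simpa using integrable_pow_gaussian 1)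
    integral_id_gaussianReal]
  · simp [gdens]
  · intro x; exact (hasDerivAt_gdens x).neg.congr_deriv (by ring)
  · exact integrable_gdens.neg

theorem integral_rsgn_mul_sq (t : ℝ) :
    ∫ x, rsgn (x + t) * (x ^ 2 - 1) ∂(gaussianReal 0 1) = -2 * t * gdens t := by
  rw [integral_rsgn_mul (g := fun x => x ^ 2 - 1) (G := fun x => - (gdens x * x)) t
    ((integrable_pow_gaussian 2).sub (integrable_const 1))]
  · simp [gdens]; ring
  · rw [integral_sub (integrable_pow_gaussian 2) (integrable_const 1), integral_sq_gaussian]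
    simp
  · intro x
    exact ((hasDerivAt_gdens x).mul (hasDerivAt_id x)).neg.congr_deriv (by simp; ring)
  · exact ((integrable_gaussian_iff _).1 (by simpa using integrable_pow_gaussian 1)).neg

/-! ### Truncation, the reweighted band, and Gaussian mass near a threshold. -/

/-- Truncation to the interval `[-σ, σ]`. -/
def clip (σ y : ℝ) : ℝ := max (-σ) (min σ y)

theorem measurable_clip (σ : ℝ) : Measurable (clip σ) := by unfold clip; fun_prop

theorem abs_clip_le {σ : ℝ} (hσ : 0 ≤ σ) (y : ℝ) : |clip σ y| ≤ σ := by
  unfold clip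
  rw [abs_le]
  exact ⟨le_max_left _ _, max_le (by linarith) (min_le_left _ _)⟩

/-- The difference vanishes for `|y| ≤ σ`, and for larger `|y|` it is at most `|y| ≤ |y|³/σ²`. The
cubic form is what makes the bias of a stage small relative to ρ when σ is a large multiple of ρ. -/
theorem abs_clip_sub_le {σ : ℝ} (hσ : 0 < σ) (y : ℝ) : |clip σ y - y| ≤ |y| ^ 3 / σ ^ 2 := by
  have key : σ < |y| → |y| ≤ |y| ^ 3 / σ ^ 2 := by
    intro h
    rw [le_div_iff₀ (by positivity)]
    have : σ ^ 2 ≤ |y| ^ 2 := by gcongr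
    nlinarith [abs_nonneg y]
  unfold clip
  rcases le_or_gt y (-σ) with h | h
  · rw [min_eq_right (by linarith), max_eq_left h]
    rcases eq_or_lt_of_le h with h' | h'
    · rw [h']; simp; positivity
    · refine le_trans ?_ (key (by rw [abs_of_neg (by linarith)]; linarith))
      rw [abs_of_nonneg (by linarith), abs_of_neg (by linarith)]; linarith
  · rcases le_or_gt y σ with h2 | h2
    · rw [min_eq_right h2, max_eq_right h.le]; simp; positivity
    · refine le_trans ?_ (key (by rw [abs_of_pos (by linarith)]; linarith))
      rw [min_eq_left h2.le, max_eq_right (by linarith), abs_of_nonpos (by linarith),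
        abs_of_pos (by linarith)]; linarith

/-- The weight that makes a standard Gaussian uniform on the band `|r + s| ≤ σ`. -/
def band (s σ r : ℝ) : ℝ := if |r + s| ≤ σ then Real.exp ((r ^ 2 - s ^ 2) / 2) else 0

theorem band_nonneg (s σ r : ℝ) : 0 ≤ band s σ r := by
  unfold band; split_ifs <;> positivity

theorem measurable_band : Measurable (fun z : ℝ × ℝ × ℝ => band z.1 z.2.1 z.2.2) := by
  unfold band
  refine Measurable.ite ?_ (by fun_prop) measurable_const
  exact measurableSet_le (by fun_prop) (by fun_prop)

/-- On the band, `r² - s² = (r+s)(r-s) ≤ σ(σ + 2|s|) ≤ 2`, so the weight is at most `e`. The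
hypothesis says that the density is essentially constant across the band. -/
theorem band_le {s σ : ℝ} (h : σ * (|s| + σ) ≤ 1) (r : ℝ) : band s σ r ≤ 3 := by
  unfold band
  split_ifs with hr
  · have hσ : 0 ≤ σ := (abs_nonneg _).trans hr
    have h1 : |r - s| ≤ σ + 2 * |s| := by
      have : r - s = (r + s) - 2 * s := by ring
      rw [this]
      refine (abs_sub _ _).trans ?_
      rw [abs_mul, abs_two]; linarith
    have h2 : (r ^ 2 - s ^ 2) / 2 ≤ 1 := by
      have : r ^ 2 - s ^ 2 = (r + s) * (r - s) := by ring
      rw [this]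
      have h3 : (r + s) * (r - s) ≤ |r + s| * |r - s| := by rw [← abs_mul]; exact le_abs_self _
      have h4 : |r + s| * |r - s| ≤ σ * (σ + 2 * |s|) := by gcongr
      nlinarith [abs_nonneg s, sq_nonneg σ]
    calc Real.exp ((r ^ 2 - s ^ 2) / 2) ≤ Real.exp 1 := by gcongr
      _ ≤ 3 := by linarith [Real.exp_one_lt_d9]
  · norm_num

theorem gdens_mul_exp (s r : ℝ) : gdens r * Real.exp ((r ^ 2 - s ^ 2) / 2) = gdens s := by
  unfold gdens
  rw [div_mul_eq_mul_div, ← Real.exp_add]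
  ring_nf

/-- The exponential factor cancels the variation of the density, so weight times density is flat on
an interval centred at `-s`. This makes the later means exact rather than approximate. -/
theorem gdens_mul_band (s σ r : ℝ) :
    gdens r * band s σ r = (Set.Icc (-s - σ) (-s + σ)).indicator (fun _ => gdens s) r := by
  unfold band
  by_cases h : |r + s| ≤ σ
  · rw [if_pos h, gdens_mul_exp, Set.indicator_of_mem]
    rw [abs_le] at h; constructor <;> linarith [h.1, h.2]
  · rw [if_neg h, Set.indicator_of_notMem, mul_zero]
    intro h'; apply h; rw [abs_le]; constructor <;> linarith [h'.1, h'.2]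

/-- The sign changes at `-q`, which lies `q - s` away from the centre of the interval. The two parts
differ in length by twice this displacement until it leaves the interval, where the integral
saturates at `±2σ`. -/
theorem integral_rsgn_interval {σ : ℝ} (hσ : 0 ≤ σ) (s q : ℝ) :
    ∫ r in Set.Icc (-s - σ) (-s + σ), rsgn (r + q) = 2 * clip σ (q - s) := by
  have h1 : ∀ r, rsgn (r + q) = 2 * (Set.Ici (-q)).indicator (fun _ => (1 : ℝ)) r - 1 := by
    intro r
    unfold rsgn
    by_cases h : 0 ≤ r + q
    · rw [if_pos h, Set.indicator_of_mem (by simp; linarith)]; ring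
    · rw [if_neg h, Set.indicator_of_notMem (by simp; linarith)]; ring
  simp_rw [h1]
  rw [integral_sub, integral_const_mul, setIntegral_indicator measurableSet_Ici,
    ← Set.Ici_inter_Iic, Set.inter_right_comm, Set.Ici_inter_Ici, Set.Ici_inter_Iic]
  · simp only [integral_const, smul_eq_mul, mul_one, measureReal_restrict_apply_univ,
      Real.volume_real_Icc, Set.Ici_inter_Iic]
    unfold clip
    rcases le_total (q - s) (-σ) with h | h
    · rw [max_eq_right (by linarith : -s - σ ≤ -q), max_eq_right (by linarith : -s + σ - -q ≤ 0),
        max_eq_left (by linarith : 0 ≤ -s + σ - (-s - σ)),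
        min_eq_right (by linarith), max_eq_left h]; ring
    · rcases le_total (q - s) σ with h2 | h2
      · rw [min_eq_right h2, max_eq_right h, max_eq_right (by linarith : -s - σ ≤ -q),
          max_eq_left (by linarith), max_eq_left (by linarith)]; ring
      · rw [min_eq_left h2, max_eq_right (by linarith : -σ ≤ σ), max_eq_left (by linarith : -q ≤ -s - σ),
          max_eq_left (by linarith)]; ring
  · exact ((integrableOn_const (C := (1 : ℝ)) (by simp)).indicator measurableSet_Ici :
      IntegrableOn _ (Set.Icc (-s - σ) (-s + σ)) _).const_mul 2
  · exact integrableOn_const (by simp)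

theorem integral_band_rsgn {σ : ℝ} (hσ : 0 ≤ σ) (s q : ℝ) :
    ∫ r, band s σ r * rsgn (r + q) ∂(gaussianReal 0 1) = gdens s * (2 * clip σ (q - s)) := by
  rw [integral_gaussian_eq]
  have : ∀ r, gdens r * (band s σ r * rsgn (r + q)) =
      (Set.Icc (-s - σ) (-s + σ)).indicator (fun r => gdens s * rsgn (r + q)) r := by
    intro r
    rw [← mul_assoc, gdens_mul_band]
    by_cases h : r ∈ Set.Icc (-s - σ) (-s + σ)
    · rw [Set.indicator_of_mem h, Set.indicator_of_mem h]
    · rw [Set.indicator_of_notMem h, Set.indicator_of_notMem h, zero_mul]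
  simp_rw [this]
  rw [integral_indicator measurableSet_Icc, integral_const_mul, integral_rsgn_interval hσ]

theorem integral_band {σ : ℝ} (hσ : 0 ≤ σ) (s : ℝ) :
    ∫ r, band s σ r ∂(gaussianReal 0 1) = gdens s * (2 * σ) := by
  rw [integral_gaussian_eq]
  simp_rw [gdens_mul_band]
  rw [integral_indicator measurableSet_Icc]
  simp only [integral_const, smul_eq_mul, measureReal_restrict_apply_univ, Real.volume_real_Icc]
  rw [max_eq_left (by linarith)]; ring

theorem gaussian_tail {t : ℝ} (ht : 0 ≤ t) :
    (gaussianReal 0 1).real {r | r + t < 0} ≤ Real.exp (-t ^ 2 / 2) := by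
  have h := measure_le_le_exp_mul_mgf (μ := gaussianReal 0 1) (X := id) (t := -t) (-t)
    (by linarith) (by simpa using integrable_exp_mul_gaussianReal (μ := 0) (v := 1) (-t))
  rw [mgf_id_gaussianReal] at h
  refine (measureReal_mono ?_).trans (h.trans ?_)
  · intro r hr; simp only [Set.mem_ofPred_eq, id] at hr ⊢; linarith
  · simp only [← Real.exp_add]; gcongr; simp; ring_nf; rfl

/-- Complete the square at `-s`: the exponent of `r` exceeds that of `s` by `s(r+s) - (r+s)²/2`, and
the negative square is dropped. -/
theorem gdens_le_of_abs_le {s q r : ℝ} (h : |r + s| ≤ |q|) :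
    gdens r ≤ gdens s * Real.exp (|s| * |q|) := by
  unfold gdens
  rw [div_mul_eq_mul_div, ← Real.exp_add]
  gcongr
  have h1 : -r ^ 2 / 2 = -s ^ 2 / 2 + s * (r + s) - (r + s) ^ 2 / 2 := by ring
  have h2 : s * (r + s) ≤ |s| * |q| := by
    calc s * (r + s) ≤ |s * (r + s)| := le_abs_self _
      _ = |s| * |r + s| := abs_mul _ _
      _ ≤ _ := by gcongr
  nlinarith [sq_nonneg (r + s)]

/-- The signs can differ only between `-s` and `-s-q`, an interval of length `|q|`; the density
there is controlled by `gdens_le_of_abs_le`. -/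
theorem gaussian_disagree (s q : ℝ) :
    (gaussianReal 0 1).real {r | sgn (r + s) ≠ sgn (r + s + q)} ≤
      gdens s * (|q| * Real.exp (|s| * |q|)) := by
  have hsub : {r | sgn (r + s) ≠ sgn (r + s + q)} ⊆ Set.uIcc (-s) (-s - q) := by
    intro r hr
    simp only [Set.mem_ofPred_eq, sgn] at hr
    rw [Set.mem_uIcc]
    by_contra hcon
    push Not at hcon
    apply hr
    split_ifs with h1 h2 h2
    · rfl
    · exfalso; push Not at h2; linarith [hcon.1 (by linarith)]
    · exfalso; push Not at h1; linarith [hcon.2 (by linarith)]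
    · rfl
  refine (measureReal_mono hsub).trans ?_
  have h1 : (gaussianReal 0 1).real (Set.uIcc (-s) (-s - q)) =
      ∫ r in Set.uIcc (-s) (-s - q), gdens r := by
    rw [measureReal_def, gaussianReal_apply_eq_integral _ one_ne_zero, ENNReal.toReal_ofReal]
    · simp only [gaussianPDFReal_zero_one]
    · exact setIntegral_nonneg measurableSet_uIcc fun x _ => gaussianPDFReal_nonneg _ _ _
  rw [h1]
  have h2 : ∫ r in Set.uIcc (-s) (-s - q), gdens r ≤
      ∫ r in Set.uIcc (-s) (-s - q), gdens s * Real.exp (|s| * |q|) := by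
    refine setIntegral_mono_on integrable_gdens.integrableOn
      (integrableOn_const (by simp [Set.uIcc])) measurableSet_uIcc
      fun r hr => gdens_le_of_abs_le ?_
    have := Set.abs_sub_left_of_mem_uIcc hr
    rw [show r + s = r - -s by ring]
    refine this.trans (le_of_eq ?_)
    rw [show -s - q - -s = -q by ring, abs_neg]
  refine h2.trans (le_of_eq ?_)
  rw [setIntegral_const, smul_eq_mul, Set.uIcc, Real.volume_real_Icc_of_le inf_le_sup,
    max_sub_min_eq_abs']
  rw [show -s - (-s - q) = q by ring]
  ring

/-! ### Random classification noise as a mixture -/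

section RCN

variable {d : ℕ}

instance : MeasurableSingletonClass ℤˣ :=
  ⟨fun y => ⟨{(y : ℤ)}, measurableSet_singleton _, by ext z; simp [Units.ext_iff]⟩⟩

theorem measurable_label : Measurable (fun y : ℤˣ => ((y : ℤ) : ℝ)) := measurable_of_countable _

theorem measurable_halfspace (w : EuclideanSpace ℝ (Fin d)) (t : ℝ) :
    Measurable (halfspace w t) :=
  measurable_sgn.comp (by fun_prop)

/-- The label condition fixes `D` on the graph of `f`; subtracting it from the marginal fixes `D`
off the graph, where the label must be `-f x` because there are only two labels. Hence `D` is
completely determined. -/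
theorem IsRCN.eq_mixture {D : Measure (EuclideanSpace ℝ (Fin d) × ℤˣ)} [IsProbabilityMeasure D]
    {f : EuclideanSpace ℝ (Fin d) → ℤˣ} {η : ℝ} (hf : Measurable f) (h0 : 0 < η) (h1 : η < 1)
    (h : IsRCN D f η) :
    D = ENNReal.ofReal (1 - η) • (stdGaussian _).map (fun x => (x, f x)) +
      ENNReal.ofReal η • (stdGaussian _).map (fun x => (x, -f x)) := by
  have hm1 : Measurable (fun x => (x, f x)) := by fun_prop
  have hm2 : Measurable (fun x => (x, -f x)) :=
    measurable_id.prodMk ((measurable_of_countable (fun y : ℤˣ => -y)).comp hf)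
  have hneg : ∀ B, MeasurableSet B → D {z | z.1 ∈ B ∧ z.2 ≠ f z.1} =
      ENNReal.ofReal η * stdGaussian (EuclideanSpace ℝ (Fin d)) B := by
    intro B hB
    have hmeas : MeasurableSet {z : EuclideanSpace ℝ (Fin d) × ℤˣ | z.1 ∈ B ∧ z.2 = f z.1} :=
      (measurable_fst hB).inter (measurableSet_eq_fun measurable_snd (hf.comp measurable_fst))
    have hsum : D {z | z.1 ∈ B ∧ z.2 = f z.1} + D {z | z.1 ∈ B ∧ z.2 ≠ f z.1} =
        stdGaussian (EuclideanSpace ℝ (Fin d)) B := by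
      rw [← h.marginal, Measure.map_apply measurable_fst hB,
        ← measure_inter_add_sdiff (μ := D) (Prod.fst ⁻¹' B) hmeas]
      congr 2 <;> ext z <;> simp +contextual
    rw [h.label B hB] at hsum
    have hsplit : stdGaussian (EuclideanSpace ℝ (Fin d)) B =
        ENNReal.ofReal (1 - η) * stdGaussian (EuclideanSpace ℝ (Fin d)) B +
          ENNReal.ofReal η * stdGaussian (EuclideanSpace ℝ (Fin d)) B := by
      rw [← add_mul, ← ENNReal.ofReal_add (by linarith) h0.le]; simp
    exact (ENNReal.add_right_inj (by finiteness)).1 (hsum.trans hsplit)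
  ext S hS
  have hB1 : MeasurableSet {x | (x, f x) ∈ S} := hm1 hS
  have hB2 : MeasurableSet {x | (x, -f x) ∈ S} := hm2 hS
  have hS1 : MeasurableSet {z : EuclideanSpace ℝ (Fin d) × ℤˣ | z.2 = f z.1} :=
    measurableSet_eq_fun measurable_snd (hf.comp measurable_fst)
  rw [← measure_inter_add_sdiff S hS1]
  simp only [Measure.coe_add, Measure.coe_smul, Pi.add_apply, Pi.smul_apply, smul_eq_mul]
  rw [Measure.map_apply hm1 hS, Measure.map_apply hm2 hS]
  congr 1
  · refine Eq.trans ?_ (h.label _ hB1)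
    congr 1; ext ⟨x, y⟩; simp only [Set.mem_inter_iff, Set.mem_ofPred_eq]
    constructor
    · rintro ⟨h, rfl⟩; exact ⟨h, rfl⟩
    · rintro ⟨h, rfl⟩; exact ⟨h, rfl⟩
  · refine Eq.trans ?_ (hneg _ hB2)
    congr 1; ext ⟨x, y⟩; simp only [Set.mem_sdiff, Set.mem_ofPred_eq]
    constructor
    · rintro ⟨h, h2⟩; rw [← ne_eq, Int.units_ne_iff_eq_neg] at h2; subst h2; exact ⟨h, by simp⟩
    · rintro ⟨h, h2⟩
      refine ⟨?_, h2⟩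
      rw [Int.units_ne_iff_eq_neg] at h2; subst h2; exact h

theorem IsRCN.integrable_comp_fst {D : Measure (EuclideanSpace ℝ (Fin d) × ℤˣ)}
    {f : EuclideanSpace ℝ (Fin d) → ℤˣ} {η : ℝ} (h : IsRCN D f η)
    {G : EuclideanSpace ℝ (Fin d) → ℝ} (hG : Integrable G (stdGaussian _)) :
    Integrable (fun z => G z.1) D := by
  rw [← h.marginal] at hG
  exact (integrable_map_measure hG.1 measurable_fst.aemeasurable).1 hG

theorem IsRCN.integral_comp_fst {D : Measure (EuclideanSpace ℝ (Fin d) × ℤˣ)}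
    {f : EuclideanSpace ℝ (Fin d) → ℤˣ} {η : ℝ} (h : IsRCN D f η)
    {G : EuclideanSpace ℝ (Fin d) → ℝ} (hG : Integrable G (stdGaussian _)) :
    ∫ z, G z.1 ∂D = ∫ x, G x ∂(stdGaussian _) := by
  rw [← h.marginal] at hG ⊢
  rw [integral_map measurable_fst.aemeasurable hG.1]

theorem IsRCN.integrable_label_mul {D : Measure (EuclideanSpace ℝ (Fin d) × ℤˣ)}
    {f : EuclideanSpace ℝ (Fin d) → ℤˣ} {η : ℝ} (h : IsRCN D f η)
    {G : EuclideanSpace ℝ (Fin d) → ℝ} (hG : Integrable G (stdGaussian _)) :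
    Integrable (fun z => ((z.2 : ℤ) : ℝ) * G z.1) D := by
  refine (h.integrable_comp_fst hG).bdd_mul (c := 1)
    (measurable_label.comp measurable_snd).aestronglyMeasurable (ae_of_all _ fun z => ?_)
  rcases Int.units_eq_one_or z.2 with h | h <;> simp [h]

/-- The two components of the mixture carry opposite labels, with weights `1-η` and `η`; the
difference of the weights is the factor `1-2η`. -/
theorem IsRCN.integral_label_mul {D : Measure (EuclideanSpace ℝ (Fin d) × ℤˣ)}
    [IsProbabilityMeasure D] {f : EuclideanSpace ℝ (Fin d) → ℤˣ} {η : ℝ} (hf : Measurable f)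
    (h0 : 0 < η) (h1 : η < 1) (h : IsRCN D f η)
    {G : EuclideanSpace ℝ (Fin d) → ℝ} (hG : Integrable G (stdGaussian _)) :
    ∫ z, ((z.2 : ℤ) : ℝ) * G z.1 ∂D =
      (1 - 2 * η) * ∫ x, ((f x : ℤ) : ℝ) * G x ∂(stdGaussian _) := by
  have hm1 : Measurable (fun x => (x, f x)) := by fun_prop
  have hm2 : Measurable (fun x => (x, -f x)) :=
    measurable_id.prodMk ((measurable_of_countable (fun y : ℤˣ => -y)).comp hf)
  have hD := h.eq_mixture hf h0 h1
  have hint := h.integrable_label_mul hG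
  rw [hD] at hint ⊢
  rw [integral_add_measure hint.left_of_add_measure hint.right_of_add_measure,
    integral_smul_measure, integral_smul_measure]
  have e1 := hint.left_of_add_measure
  have e2 := hint.right_of_add_measure
  rw [integrable_smul_measure (by simp; linarith) (by simp)] at e1 e2
  rw [integral_map hm1.aemeasurable e1.1, integral_map hm2.aemeasurable e2.1,
    ENNReal.toReal_ofReal (by linarith), ENNReal.toReal_ofReal h0.le]
  simp only [Units.val_neg, Int.cast_neg, neg_mul, integral_neg, smul_eq_mul]
  ring

/-- On the flipped component, `h` errs exactly where it agrees with `f`. Adding the weighted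
probabilities of a set and its complement separates the unavoidable `η` from the excess. -/
theorem IsRCN.zeroOneError_eq {D : Measure (EuclideanSpace ℝ (Fin d) × ℤˣ)}
    [IsProbabilityMeasure D] {f h : EuclideanSpace ℝ (Fin d) → ℤˣ} {η : ℝ} (hf : Measurable f)
    (hh : Measurable h) (h0 : 0 < η) (h1 : η < 1) (hD : IsRCN D f η) :
    zeroOneError D h = η + (1 - 2 * η) * (stdGaussian _).real {x | h x ≠ f x} := by
  have hm1 : Measurable (fun x => (x, f x)) := by fun_prop
  have hm2 : Measurable (fun x => (x, -f x)) :=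
    measurable_id.prodMk ((measurable_of_countable (fun y : ℤˣ => -y)).comp hf)
  have hS : MeasurableSet {z : EuclideanSpace ℝ (Fin d) × ℤˣ | h z.1 ≠ z.2} :=
    (measurableSet_eq_fun (hh.comp measurable_fst) measurable_snd).compl
  have hB : MeasurableSet {x | h x ≠ f x} := (measurableSet_eq_fun hh hf).compl
  unfold zeroOneError
  rw [hD.eq_mixture hf h0 h1, measureReal_def, Measure.add_apply, Measure.smul_apply,
    Measure.smul_apply, Measure.map_apply hm1 hS, Measure.map_apply hm2 hS,
    smul_eq_mul, smul_eq_mul,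
    ENNReal.toReal_add (by finiteness) (by finiteness)]
  have hc : (fun x => (x, -f x)) ⁻¹' {z : EuclideanSpace ℝ (Fin d) × ℤˣ | h z.1 ≠ z.2} =
      {x | h x ≠ f x}ᶜ := by
    ext x
    simp only [Set.mem_preimage, Set.mem_ofPred_eq, Set.mem_compl_iff, not_not]
    rw [Int.units_ne_iff_eq_neg, neg_neg]
  rw [hc]
  simp only [ENNReal.toReal_mul]
  rw [ENNReal.toReal_ofReal (by linarith), ENNReal.toReal_ofReal h0.le, ← measureReal_def,
    ← measureReal_def, probReal_compl_eq_one_sub hB]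
  simp only [Set.preimage_ofPred_eq]
  ring

end RCN

/-! ### Concentration of block averages of i.i.d. samples -/

/-- Second-order Taylor expansion with the exponential kept in the remainder. It suits unbounded
variables, for which `E[Y² exp(a|Y|)]` takes the role of the variance. -/
theorem exp_le_one_add_add_sq (u : ℝ) : Real.exp u ≤ 1 + u + u ^ 2 * Real.exp |u| := by
  have h := Complex.norm_exp_sub_sum_le_norm_mul_exp (u : ℂ) 2
  simp only [Finset.sum_range_succ, Finset.sum_range_zero, pow_zero, Nat.factorial, Nat.cast_one,
    pow_one] at h
  have h2 : Complex.exp (u : ℂ) - (0 + 1 / 1 + (u : ℂ) / ((1 * 1 : ℕ) : ℂ)) =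
      ((Real.exp u - (1 + u) : ℝ) : ℂ) := by push_cast; simp
  rw [show ((0 + 1) * 1 : ℕ) = 1 * 1 from rfl, h2, Complex.norm_real, Complex.norm_real,
    Real.norm_eq_abs, Real.norm_eq_abs, sq_abs] at h
  linarith [le_abs_self (Real.exp u - (1 + u))]

section Bernstein

variable {Z : Type*} [MeasurableSpace Z] {D : Measure Z} [IsProbabilityMeasure D]
  {Y : Z → ℝ} {a V : ℝ}

theorem integrable_exp_of_sq_mul_exp (hY : Measurable Y) (ha : 0 ≤ a)
    (hV : Integrable (fun z => Y z ^ 2 * Real.exp (a * |Y z|)) D) {c : ℝ} (hc : |c| ≤ a) :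
    Integrable (fun z => Real.exp (c * Y z)) D := by
  refine ((integrable_const (Real.exp a)).add hV).mono'
    (by fun_prop) (ae_of_all _ fun z => ?_)
  rw [Real.norm_eq_abs, abs_of_pos (Real.exp_pos _)]
  simp only [Pi.add_apply]
  have h1 : c * Y z ≤ a * |Y z| := by
    calc c * Y z ≤ |c * Y z| := le_abs_self _
      _ = |c| * |Y z| := abs_mul _ _
      _ ≤ _ := by gcongr
  rcases le_total |Y z| 1 with h | h
  · have : Real.exp (c * Y z) ≤ Real.exp a := Real.exp_le_exp.2 (h1.trans (by nlinarith))
    have : 0 ≤ Y z ^ 2 * Real.exp (a * |Y z|) := by positivity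
    linarith
  · have h2 : Real.exp (c * Y z) ≤ Real.exp (a * |Y z|) := Real.exp_le_exp.2 h1
    have h3 : 1 ≤ Y z ^ 2 := by rw [← sq_abs]; nlinarith
    nlinarith [Real.exp_pos a, Real.exp_pos (a * |Y z|)]

theorem integrable_of_sq_mul_exp (hY : Measurable Y) (ha : 0 ≤ a)
    (hV : Integrable (fun z => Y z ^ 2 * Real.exp (a * |Y z|)) D) : Integrable Y D := by
  refine ((integrable_const 1).add hV).mono' hY.aestronglyMeasurable (ae_of_all _ fun z => ?_)
  rw [Real.norm_eq_abs]
  simp only [Pi.add_apply]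
  have h1 : 1 ≤ Real.exp (a * |Y z|) := Real.one_le_exp (by positivity)
  have h2 : |Y z| ≤ 1 + Y z ^ 2 := by rw [← sq_abs]; nlinarith [sq_nonneg (|Y z| - 1)]
  nlinarith [sq_nonneg (Y z)]

/-- Integrate the Taylor bound at `u = cY`; for `|c| ≤ a` the remainder is covered by the
exponential second moment `V`. The linear and quadratic terms are then put back into the exponent by
`1 + x ≤ exp x`. -/
theorem mgf_sub_integral_le (hY : Measurable Y) (ha : 0 ≤ a)
    (hV : Integrable (fun z => Y z ^ 2 * Real.exp (a * |Y z|)) D)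
    (hVle : ∫ z, Y z ^ 2 * Real.exp (a * |Y z|) ∂D ≤ V) {c : ℝ} (hc : |c| ≤ a) :
    mgf Y D c ≤ Real.exp (c * ∫ z, Y z ∂D + c ^ 2 * V) := by
  have hYi := integrable_of_sq_mul_exp hY ha hV
  calc mgf Y D c ≤ ∫ z, (1 + c * Y z + c ^ 2 * (Y z ^ 2 * Real.exp (a * |Y z|))) ∂D := by
        refine integral_mono (integrable_exp_of_sq_mul_exp hY ha hV hc)
          (((integrable_const 1).add (hYi.const_mul c)).add (hV.const_mul _)) fun z => ?_
        refine (exp_le_one_add_add_sq (c * Y z)).trans ?_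
        have : Real.exp |c * Y z| ≤ Real.exp (a * |Y z|) := by
          rw [abs_mul]; gcongr
        rw [mul_pow, mul_assoc (c ^ 2)]
        gcongr
    _ = 1 + c * ∫ z, Y z ∂D + c ^ 2 * ∫ z, Y z ^ 2 * Real.exp (a * |Y z|) ∂D := by
        have e1 : Integrable (fun z => 1 + c * Y z) D := (integrable_const 1).add (hYi.const_mul c)
        rw [integral_add e1 (hV.const_mul _),
          integral_add (integrable_const 1) (hYi.const_mul c), integral_const_mul,
          integral_const_mul]
        simp
    _ ≤ 1 + (c * ∫ z, Y z ∂D + c ^ 2 * V) := by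
        have := mul_le_mul_of_nonneg_left hVle (sq_nonneg c); linarith
    _ ≤ _ := by rw [add_comm]; exact Real.add_one_le_exp _

/-- One-sided Bernstein inequality for the average over a block of i.i.d. samples. -/
theorem block_average_upper_tail (hY : Measurable Y) (ha : 0 ≤ a)
    (hV : Integrable (fun z => Y z ^ 2 * Real.exp (a * |Y z|)) D)
    (hVle : ∫ z, Y z ^ 2 * Real.exp (a * |Y z|) ∂D ≤ V) (hVpos : 0 < V) (o : ℕ) {n : ℕ}
    {r : ℝ} (hr : 0 ≤ r) (hra : r ≤ 2 * a * V) :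
    (Measure.infinitePi (fun _ : ℕ => D)).real
      {s | n * (∫ z, Y z ∂D + r) ≤ ∑ i ∈ Finset.range n, Y (s (o + i))} ≤
        Real.exp (-(n * (r ^ 2 / (4 * V)))) := by
  set μ := Measure.infinitePi (fun _ : ℕ => D) with hμ
  -- The minimizer of the Chernoff exponent `c²V - cr`; the hypothesis `r ≤ 2aV` is exactly what
  -- keeps it within the admissible range `c ≤ a`.
  set c := r / (2 * V) with hcdef
  have hc0 : 0 ≤ c := by positivity
  have hca : |c| ≤ a := by
    rw [abs_of_nonneg hc0, hcdef, div_le_iff₀ (by positivity)]; linarith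
  have hind : iIndepFun (fun (i : ℕ) (s : ℕ → Z) => Y (s (o + i))) μ := by
    have := iIndepFun_infinitePi (P := fun _ : ℕ => D) (X := fun _ => Y) (fun _ => hY)
    exact this.precomp (g := fun i => o + i) (add_right_injective o)
  have hmeas : ∀ i : ℕ, Measurable (fun s : ℕ → Z => Y (s (o + i))) := fun i => by fun_prop
  have hmgf : ∀ i : ℕ, mgf (fun s : ℕ → Z => Y (s (o + i))) μ c = mgf Y D c := by
    intro i
    have := (measurePreserving_eval_infinitePi (fun _ : ℕ => D) (o + i)).map_eq
    have h := mgf_map (μ := μ) (Y := Function.eval (o + i)) (X := Y) (t := c)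
      (measurable_pi_apply _).aemeasurable (by fun_prop)
    rw [this] at h
    exact h.symm
  have hint : ∀ i : ℕ, Integrable (fun s : ℕ → Z => Real.exp (c * Y (s (o + i)))) μ := by
    intro i
    have := (measurePreserving_eval_infinitePi (fun _ : ℕ => D) (o + i))
    exact this.integrable_comp_of_integrable (integrable_exp_of_sq_mul_exp hY ha hV hca)
  have hintS : Integrable (fun s => Real.exp
      (c * (∑ i ∈ Finset.range n, fun s : ℕ → Z => Y (s (o + i))) s)) μ :=
    hind.integrable_exp_mul_sum hmeas (fun i _ => hint i)
  have h := measure_ge_le_exp_mul_mgf (μ := μ)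
    (X := ∑ i ∈ Finset.range n, fun s : ℕ → Z => Y (s (o + i)))
    (n * (∫ z, Y z ∂D + r)) hc0 hintS
  rw [hind.mgf_sum hmeas] at h
  simp only [hmgf, Finset.prod_const, Finset.card_range, Finset.sum_apply] at h
  refine h.trans ?_
  have h2 := mgf_sub_integral_le hY ha hV hVle hca
  calc _ ≤ Real.exp (-c * (n * (∫ z, Y z ∂D + r))) *
        Real.exp (c * ∫ z, Y z ∂D + c ^ 2 * V) ^ n := by gcongr; exact mgf_nonneg
    _ = _ := by
        rw [← Real.exp_nat_mul, ← Real.exp_add]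
        congr 1
        rw [hcdef]; field_simp; ring

theorem block_average_tail (hY : Measurable Y) (ha : 0 ≤ a)
    (hV : Integrable (fun z => Y z ^ 2 * Real.exp (a * |Y z|)) D)
    (hVle : ∫ z, Y z ^ 2 * Real.exp (a * |Y z|) ∂D ≤ V) (hVpos : 0 < V) (o : ℕ) {n : ℕ}
    (hn : 0 < n) {r : ℝ} (hr : 0 ≤ r) (hra : r ≤ 2 * a * V) :
    (Measure.infinitePi (fun _ : ℕ => D)).real
      {s | r ≤ |(∑ i ∈ Finset.range n, Y (s (o + i))) / n - ∫ z, Y z ∂D|} ≤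
        2 * Real.exp (-(n * (r ^ 2 / (4 * V)))) := by
  have h1 := block_average_upper_tail hY ha hV hVle hVpos o (n := n) hr hra
  have h2 := block_average_upper_tail (Y := fun z => -Y z) (D := D) hY.neg ha
    (by simpa using hV) (by simpa using hVle) hVpos o (n := n) hr hra
  refine le_trans ?_ ((measureReal_union_le _ _).trans ((add_le_add h1 h2).trans_eq (by ring)))
  refine measureReal_mono ?_
  intro s hs
  have hn' : (0 : ℝ) < n := by exact_mod_cast hn
  simp only [Set.mem_ofPred_eq, le_abs, Set.mem_union, integral_neg, Finset.sum_neg_distrib] at hs ⊢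
  rcases hs with hs | hs
  · left
    rw [le_sub_iff_add_le, le_div_iff₀ hn'] at hs; linarith
  · right
    rw [neg_sub, le_sub_iff_add_le, ← le_sub_iff_add_le', div_le_iff₀ hn'] at hs; linarith

end Bernstein

section Adaptive

variable {Z : Type*} [MeasurableSpace Z] {D : Measure Z} [IsProbabilityMeasure D]

/-- The block of `n` samples that starts at position `o`. -/
def block (o n : ℕ) (s : ℕ → Z) : Fin n → Z := fun i => s (o + i)

theorem measurable_block (o n : ℕ) : Measurable (block (Z := Z) o n) := by
  unfold block; fun_prop

/-- The function `g` of a sequence depends on its first `o` terms only. -/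
def DependsBefore {Z X : Type*} (o : ℕ) (g : (ℕ → Z) → X) : Prop :=
  ∀ s s' : ℕ → Z, (∀ i < o, s i = s' i) → g s = g s'

/-- A function of the first `o` terms factors through those coordinates, and the block uses disjoint
coordinates of the product measure. -/
theorem indepFun_block {X : Type*} [MeasurableSpace X] {o : ℕ} (n : ℕ) {g : (ℕ → Z) → X}
    (hg : Measurable g) (hdep : DependsBefore o g) :
    IndepFun g (block o n) (Measure.infinitePi (fun _ : ℕ => D)) := by
  have : Nonempty Z := D.nonempty_of_neZero
  obtain ⟨z₀⟩ := this
  have hind : iIndepFun (fun (i : ℕ) (s : ℕ → Z) => s i) (Measure.infinitePi (fun _ : ℕ => D)) :=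
    iIndepFun_infinitePi (P := fun _ : ℕ => D) (X := fun _ => id) (fun _ => measurable_id)
  have h := hind.indepFun_finset (Finset.range o) (Finset.Ico o (o + n))
    (by rw [Finset.disjoint_left]; intro a; simp; omega) (fun i => measurable_pi_apply i)
  -- Fill the later positions with an arbitrary point; by `DependsBefore` the value of `g` does not
  -- notice, and this gives a measurable factorization.
  let ext : (Finset.range o → Z) → (ℕ → Z) := fun u i =>
    if hi : i ∈ Finset.range o then u ⟨i, hi⟩ else z₀
  have hext : Measurable ext := by
    refine measurable_pi_lambda _ fun i => ?_
    by_cases hi : i ∈ Finset.range o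
    · simp only [ext, hi, dif_pos]; exact measurable_pi_apply _
    · simp only [ext, hi, dif_neg, not_false_eq_true]; exact measurable_const
  let rd : (Finset.Ico o (o + n) → Z) → (Fin n → Z) := fun u i => u ⟨o + i, by simp⟩
  have hrd : Measurable rd := measurable_pi_lambda _ fun i => measurable_pi_apply _
  have h2 := h.comp (hg.comp hext) hrd
  convert h2 using 1
  · ext s
    apply hdep
    intro i hi
    simp [ext, hi]
  · rfl

/-- By independence the joint law of parameter and block is a product, so a bound that is uniform
over fixed parameters survives the insertion of a parameter chosen from earlier samples. -/
theorem measure_adaptive_le {X : Type*} [MeasurableSpace X] {o n : ℕ} {g : (ℕ → Z) → X}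
    (hg : Measurable g) (hdep : DependsBefore o g) {B : Set (X × (Fin n → Z))}
    (hB : MeasurableSet B) {q : ENNReal}
    (hq : ∀ x, Measure.infinitePi (fun _ : ℕ => D) {s | (x, block o n s) ∈ B} ≤ q) :
    Measure.infinitePi (fun _ : ℕ => D) {s | (g s, block o n s) ∈ B} ≤ q := by
  set μ := Measure.infinitePi (fun _ : ℕ => D)
  have hb := measurable_block (Z := Z) o n
  have hmap := (indepFun_iff_map_prod_eq_prod_map_map hg.aemeasurable hb.aemeasurable).1
    (indepFun_block (D := D) n hg hdep)
  have hpm : IsProbabilityMeasure (μ.map g) := Measure.isProbabilityMeasure_map hg.aemeasurable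
  have hpm2 : IsProbabilityMeasure (μ.map (block o n)) :=
    Measure.isProbabilityMeasure_map hb.aemeasurable
  have h1 : μ {s | (g s, block o n s) ∈ B} = (μ.map (fun s => (g s, block o n s))) B :=
    (Measure.map_apply (hg.prodMk hb) hB).symm
  rw [h1, hmap, Measure.prod_apply hB]
  calc _ ≤ ∫⁻ _, q ∂(μ.map g) := by
        refine lintegral_mono fun x => ?_
        rw [Measure.map_apply hb (measurable_prodMk_left hB)]
        exact hq x
    _ = q := by simp

end Adaptive

/-! ### Means and exponential second moments of the statistics -/


section Statistics

variable {E : Type*} [NormedAddCommGroup E] [InnerProductSpace ℝ E]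

/-- The component of `x` orthogonal to the unit vector `v`. -/
def perp (v x : E) : E := x - ⟪v, x⟫ • v

theorem inner_resample {v : E} (hv : ‖v‖ = 1) (x : E) (r : ℝ) :
    ⟪v, x - ⟪v, x⟫ • v + r • v⟫ = r := by
  simp [inner_add_right, inner_sub_right, real_inner_smul_right, hv]

theorem perp_resample {v : E} (hv : ‖v‖ = 1) (x : E) (r : ℝ) :
    perp v (x - ⟪v, x⟫ • v + r • v) = perp v x := by
  rw [perp, inner_resample hv, perp]; simp

theorem inner_resample_of_orthogonal {v a : E} (ha : ⟪v, a⟫ = 0) (x : E) (r : ℝ) :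
    ⟪a, x - ⟪v, x⟫ • v + r • v⟫ = ⟪a, x⟫ := by
  simp [inner_add_right, inner_sub_right, real_inner_smul_right, real_inner_comm, ha]

theorem inner_perp {v : E} (e x : E) : ⟪e, perp v x⟫ = ⟪perp v e, x⟫ := by
  simp [perp, inner_sub_right, inner_sub_left, real_inner_smul_right, real_inner_comm,
    mul_comm]

theorem norm_perp_le {v : E} (hv : ‖v‖ ≤ 1) (x : E) : ‖perp v x‖ ≤ ‖x‖ := by
  have h : ‖perp v x‖ ^ 2 ≤ ‖x‖ ^ 2 := by
    rw [perp, norm_sub_sq_real, norm_smul, real_inner_smul_right, real_inner_comm, mul_pow,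
      Real.norm_eq_abs, sq_abs]
    have : ‖v‖ ^ 2 ≤ 1 := by nlinarith [norm_nonneg v]
    nlinarith [sq_nonneg ⟪x, v⟫]
  exact le_of_sq_le_sq h (norm_nonneg _)

variable [FiniteDimensional ℝ E] [MeasurableSpace E] [BorelSpace E]

theorem measurable_inner_right (e : E) : Measurable (fun x : E => ⟪e, x⟫) := by fun_prop

theorem integrable_of_le_exp_inner {F : E → ℝ} (hF : Measurable F) (e : E) (C a : ℝ)
    (h : ∀ x, |F x| ≤ C * Real.exp (a * |⟪e, x⟫|)) : Integrable F (stdGaussian E) :=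
  ((integrable_exp_abs_inner e a).const_mul C).mono' hF.aestronglyMeasurable
    (ae_of_all _ fun x => h x)

theorem integral_le_of_le_exp_inner {F : E → ℝ} (hF : Measurable F) {e : E} {C a : ℝ} (hC : 0 ≤ C)
    (he : ‖e‖ ≤ 1) (h : ∀ x, |F x| ≤ C * Real.exp (a * |⟪e, x⟫|)) :
    ∫ x, F x ∂(stdGaussian E) ≤ C * (2 * Real.exp (a ^ 2 / 2)) := by
  calc _ ≤ ∫ x, C * Real.exp (a * |⟪e, x⟫|) ∂(stdGaussian E) :=
        integral_mono (integrable_of_le_exp_inner hF e C a h)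
          ((integrable_exp_abs_inner e a).const_mul C) fun x => (le_abs_self _).trans (h x)
    _ ≤ _ := by
        rw [integral_const_mul]
        refine mul_le_mul_of_nonneg_left ((integral_exp_abs_inner_le e a).trans ?_) hC
        have : ‖e‖ ^ 2 ≤ 1 := by nlinarith [norm_nonneg e]
        gcongr
        nlinarith [sq_nonneg a]

theorem integrable_inner_mul (e a : E) : Integrable (fun x => ⟪a, x⟫ * ⟪e, x⟫) (stdGaussian E) :=
  (memLp_inner a 2 (by simp)).integrable_mul (memLp_inner e 2 (by simp))

theorem integrable_inner (e : E) : Integrable (fun x => ⟪e, x⟫) (stdGaussian E) :=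
  (memLp_inner e 1 (by simp)).integrable le_rfl

theorem Integrable.rsgn_mul {F g : E → ℝ} (hF : Integrable F (stdGaussian E)) (hg : Measurable g) :
    Integrable (fun x => rsgn (g x) * F x) (stdGaussian E) :=
  hF.bdd_mul (c := 1) (measurable_rsgn.comp hg).aestronglyMeasurable
    (ae_of_all _ fun _ => (abs_rsgn _).le)

/-- First Chow parameters of a halfspace. -/
theorem integral_halfspace_mul_inner {w : E} (hw : ‖w‖ = 1) (t : ℝ) (e : E) :
    ∫ x, rsgn (⟪w, x⟫ + t) * ⟪e, x⟫ ∂(stdGaussian E) = 2 * gdens t * ⟪e, w⟫ := by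
  rw [integral_resample hw (Integrable.rsgn_mul (integrable_inner e) (by fun_prop))]
  have h : ∀ x : E, ∫ r, rsgn (⟪w, x - ⟪w, x⟫ • w + r • w⟫ + t) *
      ⟪e, x - ⟪w, x⟫ • w + r • w⟫ ∂(gaussianReal 0 1) =
      ⟪e, perp w x⟫ * ∫ r, rsgn (r + t) ∂(gaussianReal 0 1) + 2 * gdens t * ⟪e, w⟫ := by
    intro x
    rw [← integral_rsgn_mul_id, ← integral_const_mul, ← integral_mul_const, ← integral_add]
    · refine integral_congr_ae (ae_of_all _ fun r => ?_)
      simp only [inner_resample hw]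
      rw [inner_add_right, real_inner_smul_right, perp]; ring
    · refine Integrable.const_mul ?_ _
      refine (integrable_const (1 : ℝ)).mono' ?_ (ae_of_all _ fun _ => (abs_rsgn _).le)
      exact (measurable_rsgn.comp (by fun_prop)).aestronglyMeasurable
    · refine Integrable.mul_const ?_ _
      have : Integrable (fun r : ℝ => r) (gaussianReal 0 1) := by
        simpa using integrable_pow_gaussian 1
      exact this.bdd_mul (c := 1) (measurable_rsgn.comp (by fun_prop)).aestronglyMeasurable
        (ae_of_all _ fun _ => (abs_rsgn _).le)
  simp_rw [h, inner_perp]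
  rw [integral_add ((integrable_inner _).mul_const _) (integrable_const _), integral_mul_const,
    integral_inner_stdGaussian]
  simp

/-- Second-degree Hermite coefficient of a halfspace. -/
theorem integral_halfspace_mul_sq {w v : E} (hw : ‖w‖ = 1) (hv : ‖v‖ = 1) (t : ℝ) :
    ∫ x, rsgn (⟪w, x⟫ + t) * (⟪v, x⟫ ^ 2 - 1) ∂(stdGaussian E) =
      -2 * t * gdens t * ⟪v, w⟫ ^ 2 := by
  have hi : Integrable (fun x => ⟪v, x⟫ ^ 2 - 1) (stdGaussian E) := by
    simp_rw [sq]
    exact (integrable_inner_mul v v).sub (integrable_const 1)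
  rw [integral_resample hw (Integrable.rsgn_mul hi (by fun_prop))]
  set c := ⟪v, w⟫ with hc
  have hs1 : Integrable (fun r : ℝ => rsgn (r + t)) (gaussianReal 0 1) := by
    refine (integrable_const (1 : ℝ)).mono' ?_ (ae_of_all _ fun _ => (abs_rsgn _).le)
    exact (measurable_rsgn.comp (by fun_prop)).aestronglyMeasurable
  have hs : ∀ g : ℝ → ℝ, Integrable g (gaussianReal 0 1) →
      Integrable (fun r : ℝ => rsgn (r + t) * g r) (gaussianReal 0 1) := fun g hg =>
    hg.bdd_mul (c := 1) (measurable_rsgn.comp (by fun_prop)).aestronglyMeasurable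
        (ae_of_all _ fun _ => (abs_rsgn _).le)
  have h : ∀ x : E, ∫ r, rsgn (⟪w, x - ⟪w, x⟫ • w + r • w⟫ + t) *
      (⟪v, x - ⟪w, x⟫ • w + r • w⟫ ^ 2 - 1) ∂(gaussianReal 0 1) =
      (⟪v, perp w x⟫ ^ 2 - (1 - c ^ 2)) * (∫ r, rsgn (r + t) ∂(gaussianReal 0 1)) +
        ⟪v, perp w x⟫ * (2 * c * (2 * gdens t)) + c ^ 2 * (-2 * t * gdens t) := by
    intro x
    rw [← integral_rsgn_mul_id, ← integral_rsgn_mul_sq, ← integral_const_mul, ← integral_const_mul,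
      ← integral_const_mul, ← integral_const_mul, ← integral_add, ← integral_add]
    · refine integral_congr_ae (ae_of_all _ fun r => ?_)
      simp only [inner_resample hw]
      rw [inner_add_right, real_inner_smul_right, ← perp, ← hc]; ring
    · refine (hs1.const_mul _).add (((hs _ ?_).const_mul _).const_mul _)
      simpa using integrable_pow_gaussian 1
    · exact (hs _ ((integrable_pow_gaussian 2).sub (integrable_const 1))).const_mul _
    · exact hs1.const_mul _
    · refine (((hs _ ?_).const_mul _).const_mul _)
      simpa using integrable_pow_gaussian 1
  simp_rw [h, inner_perp]
  have hsq : Integrable (fun x => ⟪perp w v, x⟫ ^ 2) (stdGaussian E) := by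
    simpa only [← sq] using integrable_inner_mul (perp w v) (perp w v)
  have e1 : Integrable (fun x => (⟪perp w v, x⟫ ^ 2 - (1 - c ^ 2)) *
      ∫ r, rsgn (r + t) ∂(gaussianReal 0 1)) (stdGaussian E) :=
    (hsq.sub (integrable_const _)).mul_const _
  have e2 : Integrable (fun x => ⟪perp w v, x⟫ * (2 * c * (2 * gdens t))) (stdGaussian E) :=
    (integrable_inner _).mul_const _
  have e3 : Integrable (fun x => (⟪perp w v, x⟫ ^ 2 - (1 - c ^ 2)) *
      ∫ r, rsgn (r + t) ∂(gaussianReal 0 1) + ⟪perp w v, x⟫ * (2 * c * (2 * gdens t)))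
      (stdGaussian E) := e1.add e2
  rw [integral_add e3 (integrable_const _), integral_add e1 e2, integral_mul_const,
    integral_mul_const, integral_inner_stdGaussian, integral_sub hsq (integrable_const _)]
  have h3 : ∫ x, ⟪perp w v, x⟫ ^ 2 ∂(stdGaussian E) = 1 - c ^ 2 := by
    simp_rw [sq ⟪perp w v, _⟫]
    rw [integral_inner_mul_inner]
    simp only [perp, inner_sub_left, inner_sub_right, real_inner_smul_left, real_inner_smul_right,
      real_inner_comm v w]
    rw [real_inner_self_eq_norm_sq, real_inner_self_eq_norm_sq, hw, hv, hc]; ring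
  rw [h3]
  simp; ring

theorem integral_comp_inner {v : E} (hv : ‖v‖ = 1) (g : ℝ → ℝ) (hg : Measurable g) :
    ∫ x, g ⟪v, x⟫ ∂(stdGaussian E) = ∫ r, g r ∂(gaussianReal 0 1) := by
  have h := stdGaussian_map_inner v
  have h1 : ‖v‖₊ ^ 2 = 1 := by ext; simp [hv]
  rw [h1] at h
  rw [← h, integral_map (by fun_prop) (by rw [h]; exact hg.aestronglyMeasurable)]

theorem integrable_comp_inner {v : E} (hv : ‖v‖ = 1) (g : ℝ → ℝ)
    (hgi : Integrable g (gaussianReal 0 1)) :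
    Integrable (fun x => g ⟪v, x⟫) (stdGaussian E) := by
  have h := stdGaussian_map_inner v
  have h1 : ‖v‖₊ ^ 2 = 1 := by ext; simp [hv]
  rw [h1] at h
  rw [← h] at hgi
  exact (integrable_map_measure hgi.1 (by fun_prop)).1 hgi

/-! #### Moments of affine functions -/

theorem abs_affine_le {R b : ℝ} {a x : E} (hb : |b| ≤ R) :
    |⟪a, x⟫ + b| ≤ R + |⟪a, x⟫| := by
  calc _ ≤ |⟪a, x⟫| + |b| := abs_add_le _ _
    _ ≤ _ := by linarith

theorem sq_le_two_mul_exp {u : ℝ} (hu : 0 ≤ u) : u ^ 2 ≤ 2 * Real.exp u := by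
  have := Real.quadratic_le_exp_of_nonneg hu; nlinarith

theorem exp_two_lt : Real.exp 2 < 7.3891 := by
  have h := Real.exp_one_lt_d9
  have : Real.exp 2 = Real.exp 1 ^ 2 := by rw [← Real.exp_nat_mul]; norm_num
  rw [this]
  have h0 := Real.exp_pos 1
  nlinarith

theorem affine_sq_mul_exp_le (e : E) {c : ℝ} (hc : |c| ≤ 1) (x : E) :
    (⟪e, x⟫ + c) ^ 2 * Real.exp |⟪e, x⟫ + c| ≤ 2 * Real.exp 2 * Real.exp (2 * |⟪e, x⟫|) := by
  have h := abs_affine_le (a := e) (x := x) hc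
  have h1 := sq_le_two_mul_exp (abs_nonneg (⟪e, x⟫ + c))
  rw [sq_abs] at h1
  calc _ ≤ 2 * Real.exp |⟪e, x⟫ + c| * Real.exp |⟪e, x⟫ + c| := by gcongr
    _ = 2 * Real.exp (2 * |⟪e, x⟫ + c|) := by rw [mul_assoc, ← Real.exp_add]; ring_nf
    _ ≤ 2 * Real.exp (2 + 2 * |⟪e, x⟫|) := by gcongr; linarith
    _ = _ := by rw [Real.exp_add]; ring

/-- The pointwise bound `2e² exp(2|⟪e,x⟫|)` integrates to at most `(2e²)²`, which is just below 220.
-/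
theorem integral_affine_sq_mul_exp_le {e : E} (he : ‖e‖ ≤ 1) {c : ℝ} (hc : |c| ≤ 1) :
    Integrable (fun x => (⟪e, x⟫ + c) ^ 2 * Real.exp |⟪e, x⟫ + c|) (stdGaussian E) ∧
    ∫ x, (⟪e, x⟫ + c) ^ 2 * Real.exp |⟪e, x⟫ + c| ∂(stdGaussian E) ≤ 220 := by
  have hm : Measurable (fun x => (⟪e, x⟫ + c) ^ 2 * Real.exp |⟪e, x⟫ + c|) := by fun_prop
  have hb : ∀ x, |(⟪e, x⟫ + c) ^ 2 * Real.exp (|⟪e, x⟫ + c|)| ≤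
      2 * Real.exp 2 * Real.exp (2 * |⟪e, x⟫|) := fun x => by
    rw [abs_of_nonneg (by positivity)]; exact affine_sq_mul_exp_le e hc x
  refine ⟨integrable_of_le_exp_inner hm e _ _ hb,
    (integral_le_of_le_exp_inner hm (by positivity) he hb).trans ?_⟩
  rw [show (2 : ℝ) ^ 2 / 2 = 2 by norm_num]
  nlinarith [exp_two_lt, Real.exp_pos 2]

theorem exp_sq_div_four :
    Integrable (fun r : ℝ => Real.exp (r ^ 2 / 4)) (gaussianReal 0 1) ∧
    ∫ r, Real.exp (r ^ 2 / 4) ∂(gaussianReal 0 1) = Real.sqrt 2 := by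
  have h : ∀ r, gdens r * Real.exp (r ^ 2 / 4) =
      (Real.sqrt (2 * Real.pi))⁻¹ * Real.exp (-(1 / 4) * r ^ 2) := by
    intro r
    rw [gdens, div_mul_eq_mul_div, ← Real.exp_add, div_eq_inv_mul]; ring_nf
  constructor
  · rw [integrable_gaussian_iff]
    simp_rw [h]
    exact (integrable_exp_neg_mul_sq (by norm_num)).const_mul _
  · rw [integral_gaussian_eq]
    simp_rw [h]
    rw [integral_const_mul, integral_gaussian, ← Real.sqrt_inv, ← Real.sqrt_mul (by positivity)]
    congr 1
    have := Real.pi_ne_zero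
    field_simp; norm_num

/-- The statistic is quadratic in a Gaussian, so only small exponential rates are integrable. The
rate `1/8`, plus another `1/8` spent on the polynomial factor, gives `exp(r²/4)`, whose Gaussian
integral is `√2`. -/
theorem integral_sq_sub_one_sq_mul_exp_le {v : E} (hv : ‖v‖ = 1) :
    Integrable (fun x => (⟪v, x⟫ ^ 2 - 1) ^ 2 * Real.exp (1 / 8 * |⟪v, x⟫ ^ 2 - 1|))
      (stdGaussian E) ∧
    ∫ x, (⟪v, x⟫ ^ 2 - 1) ^ 2 * Real.exp (1 / 8 * |⟪v, x⟫ ^ 2 - 1|) ∂(stdGaussian E) ≤ 240 := by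
  have hb : ∀ r : ℝ, (r ^ 2 - 1) ^ 2 * Real.exp (1 / 8 * |r ^ 2 - 1|) ≤
      128 * Real.exp (1 / 4) * Real.exp (r ^ 2 / 4) := by
    intro r
    have h0 : |r ^ 2 - 1| ≤ 1 + r ^ 2 := by
      rw [abs_le]; constructor <;> nlinarith [sq_nonneg r]
    have h1 : (r ^ 2 - 1) ^ 2 ≤ 128 * Real.exp ((1 + r ^ 2) / 8) := by
      have := sq_le_two_mul_exp (u := (1 + r ^ 2) / 8) (by positivity)
      nlinarith [sq_nonneg r]
    calc _ ≤ 128 * Real.exp ((1 + r ^ 2) / 8) * Real.exp (1 / 8 * (1 + r ^ 2)) := by gcongr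
      _ = _ := by rw [mul_assoc, ← Real.exp_add, mul_assoc, ← Real.exp_add]; ring_nf
  have hi : Integrable (fun r : ℝ => (r ^ 2 - 1) ^ 2 * Real.exp (1 / 8 * |r ^ 2 - 1|))
      (gaussianReal 0 1) := by
    refine (exp_sq_div_four.1.const_mul (128 * Real.exp (1 / 4))).mono'
      (Measurable.aestronglyMeasurable (by fun_prop)) (ae_of_all _ fun r => ?_)
    rw [Real.norm_eq_abs, abs_of_nonneg (by positivity)]; exact hb r
  refine ⟨integrable_comp_inner hv
    (fun r => (r ^ 2 - 1) ^ 2 * Real.exp (1 / 8 * |r ^ 2 - 1|)) hi, ?_⟩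
  rw [integral_comp_inner hv (fun r => (r ^ 2 - 1) ^ 2 * Real.exp (1 / 8 * |r ^ 2 - 1|))
    (by fun_prop)]
  refine (integral_mono hi (exp_sq_div_four.1.const_mul (128 * Real.exp (1 / 4))) hb).trans ?_
  rw [integral_const_mul, exp_sq_div_four.2]
  have h4 : Real.exp (1 / 4) ≤ 1.3 := by
    by_contra h
    push Not at h
    have h1 : Real.exp 1 = Real.exp (1 / 4) ^ 4 := by rw [← Real.exp_nat_mul]; norm_num
    have h2 : (1.3 : ℝ) ^ 4 ≤ Real.exp (1 / 4) ^ 4 := by gcongr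
    linarith [Real.exp_one_lt_d9, h1 ▸ h2, show (2.8 : ℝ) < 1.3 ^ 4 by norm_num]
  have h5 : Real.sqrt 2 ≤ 1.4143 := by
    rw [Real.sqrt_le_left (by norm_num)]; norm_num
  have h6 := Real.sqrt_nonneg 2
  nlinarith [Real.exp_pos (1 / 4)]

theorem integrable_affine_perp {v e : E} (c : ℝ) :
    Integrable (fun x => ⟪e, perp v x⟫ + c) (stdGaussian E) := by
  simp_rw [inner_perp]
  exact (integrable_inner _).add (integrable_const _)

theorem measurable_band_right (s σ : ℝ) : Measurable (band s σ) :=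
  measurable_band.comp (by fun_prop : Measurable fun r : ℝ => (s, σ, r))

theorem measurable_perp (v : E) : Measurable (perp v) := by unfold perp; fun_prop

/-- One of the two weight factors is bounded by 3, and the rate `1/3` cancels the weight in the
exponent. The remaining factor integrates along `v` to `2σφ(s)`, independently of the orthogonal
part, so the second moment is proportional to the band's mass: `1320 = 3 · 2 · 220`. -/
theorem integral_band_statistic_sq_le {v e : E} (hv : ‖v‖ = 1) (he : ‖e‖ ≤ 1) {c s σ : ℝ}
    (hc : |c| ≤ 1) (hσ : 0 ≤ σ) (hsσ : σ * (|s| + σ) ≤ 1) :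
    Integrable (fun x => (band s σ ⟪v, x⟫ * (⟪e, perp v x⟫ + c)) ^ 2 *
      Real.exp (1 / 3 * |band s σ ⟪v, x⟫ * (⟪e, perp v x⟫ + c)|)) (stdGaussian E) ∧
    ∫ x, (band s σ ⟪v, x⟫ * (⟪e, perp v x⟫ + c)) ^ 2 *
      Real.exp (1 / 3 * |band s σ ⟪v, x⟫ * (⟪e, perp v x⟫ + c)|) ∂(stdGaussian E) ≤
      1320 * (σ * gdens s) := by
  have hmb := (measurable_band_right s σ).comp (measurable_inner_right v)
  have hmq : Measurable (fun x => ⟪e, perp v x⟫ + c) := by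
    have := measurable_perp v; fun_prop
  have hpe : ‖perp v e‖ ≤ 1 := (norm_perp_le hv.le e).trans he
  obtain ⟨hqi, hq⟩ := integral_affine_sq_mul_exp_le hpe hc
  simp_rw [← inner_perp] at hqi hq
  set Q : E → ℝ := fun x => (⟪e, perp v x⟫ + c) ^ 2 * Real.exp |⟪e, perp v x⟫ + c| with hQ
  have hb : ∀ x, (band s σ ⟪v, x⟫ * (⟪e, perp v x⟫ + c)) ^ 2 *
      Real.exp (1 / 3 * |band s σ ⟪v, x⟫ * (⟪e, perp v x⟫ + c)|) ≤
      3 * (band s σ ⟪v, x⟫ * Q x) := by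
    intro x
    have h1 := band_le hsσ ⟪v, x⟫
    have h2 := band_nonneg s σ ⟪v, x⟫
    rw [abs_mul, abs_of_nonneg h2, mul_pow]
    calc band s σ ⟪v, x⟫ ^ 2 * (⟪e, perp v x⟫ + c) ^ 2 *
          Real.exp (1 / 3 * (band s σ ⟪v, x⟫ * |⟪e, perp v x⟫ + c|)) ≤
          (3 * band s σ ⟪v, x⟫) * (⟪e, perp v x⟫ + c) ^ 2 *
          Real.exp |⟪e, perp v x⟫ + c| := by
          gcongr
          · nlinarith
          · nlinarith [abs_nonneg (⟪e, perp v x⟫ + c)]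
      _ = _ := by rw [hQ]; ring
  have hQ0 : ∀ x, 0 ≤ Q x := fun x => by rw [hQ]; positivity
  have hFi : Integrable (fun x => band s σ ⟪v, x⟫ * Q x) (stdGaussian E) :=
    hqi.bdd_mul (c := 3) hmb.aestronglyMeasurable (ae_of_all _ fun x => by
      rw [Real.norm_eq_abs]
      exact (abs_of_nonneg (band_nonneg s σ ⟪v, x⟫)).le.trans (band_le hsσ _))
  have hI : Integrable (fun x => (band s σ ⟪v, x⟫ * (⟪e, perp v x⟫ + c)) ^ 2 *
      Real.exp (1 / 3 * |band s σ ⟪v, x⟫ * (⟪e, perp v x⟫ + c)|)) (stdGaussian E) := by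
    have hmm : Measurable (fun x => band s σ ⟪v, x⟫ * (⟪e, perp v x⟫ + c)) := hmb.mul hmq
    refine (hFi.const_mul 3).mono' (Measurable.aestronglyMeasurable (by fun_prop))
      (ae_of_all _ fun x => ?_)
    rw [Real.norm_eq_abs, abs_of_nonneg (by positivity)]; exact hb x
  refine ⟨hI, (integral_mono hI (hFi.const_mul 3) hb).trans ?_⟩
  rw [integral_const_mul, integral_resample hv hFi]
  simp only [inner_resample hv, hQ, perp_resample hv]
  simp_rw [integral_mul_const, integral_band hσ, integral_const_mul]
  have := gdens_pos s
  calc 3 * (gdens s * (2 * σ) * ∫ x, (⟪e, perp v x⟫ + c) ^ 2 *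
        Real.exp |⟪e, perp v x⟫ + c| ∂stdGaussian E) ≤ 3 * (gdens s * (2 * σ) * 220) := by
        gcongr
    _ = _ := by ring

/-! ### Means of band statistics. -/

theorem integrable_band_mul {v : E} {s σ : ℝ} (hsσ : σ * (|s| + σ) ≤ 1) {F : E → ℝ}
    (hF : Integrable F (stdGaussian E)) :
    Integrable (fun x => band s σ ⟪v, x⟫ * F x) (stdGaussian E) :=
  hF.bdd_mul (c := 3) ((measurable_band_right s σ).comp
    (measurable_inner_right v)).aestronglyMeasurable (ae_of_all _ fun x => by
      rw [Real.norm_eq_abs]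
      exact (abs_of_nonneg (band_nonneg s σ ⟪v, x⟫)).le.trans (band_le hsσ _))

/-- The mean of a band statistic is exactly linear up to truncation. -/
theorem integral_halfspace_mul_band {v a : E} (hv : ‖v‖ = 1) (ha : ⟪v, a⟫ = 0) {s σ : ℝ}
    (hσ : 0 ≤ σ) (hsσ : σ * (|s| + σ) ≤ 1) (B : ℝ) (e : E) (c : ℝ) :
    ∫ x, rsgn (⟪v, x⟫ + ⟪a, x⟫ + B) * (band s σ ⟪v, x⟫ * (⟪e, perp v x⟫ + c)) ∂(stdGaussian E) =
      2 * gdens s * ∫ x, clip σ (⟪a, x⟫ + (B - s)) * (⟪e, perp v x⟫ + c) ∂(stdGaussian E) := by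
  rw [integral_resample hv (Integrable.rsgn_mul
    (integrable_band_mul hsσ (integrable_affine_perp c)) (by fun_prop)), ← integral_const_mul]
  refine integral_congr_ae (ae_of_all _ fun x => ?_)
  simp only [inner_resample hv, inner_resample_of_orthogonal ha, perp_resample hv]
  have : ∀ r, rsgn (r + ⟪a, x⟫ + B) * (band s σ r * (⟪e, perp v x⟫ + c)) =
      band s σ r * rsgn (r + (⟪a, x⟫ + B)) * (⟪e, perp v x⟫ + c) := by
    intro r; rw [add_assoc]; ring
  simp_rw [this]
  rw [integral_mul_const, integral_band_rsgn hσ]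
  ring_nf

theorem integrable_clip_mul {σ : ℝ} (hσ : 0 ≤ σ) {g F : E → ℝ} (hg : Measurable g)
    (hF : Integrable F (stdGaussian E)) :
    Integrable (fun x => clip σ (g x) * F x) (stdGaussian E) :=
  hF.bdd_mul (c := σ) ((measurable_clip σ).comp hg).aestronglyMeasurable
    (ae_of_all _ fun _ => abs_clip_le hσ _)

theorem pow_four_le_exp {u : ℝ} (hu : 0 ≤ u) : u ^ 4 ≤ 24 * Real.exp u := by
  have := Real.pow_div_factorial_le_exp u hu 4
  rw [div_le_iff₀ (by positivity)] at this
  simpa [Nat.factorial, mul_comm] using this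

/-- Truncation changes the mean of the statistic by a term of third order. -/
theorem abs_integral_clip_sub_le {v a e : E} (hv : ‖v‖ = 1) (ha : ⟪v, a⟫ = 0) {R σ b c : ℝ}
    (hR : 0 < R) (haR : ‖a‖ ≤ R) (hb : |b| ≤ R) (he : ‖e‖ ≤ 1) (hc : |c| ≤ 1) (hσ : 0 < σ) :
    |∫ x, clip σ (⟪a, x⟫ + b) * (⟪e, perp v x⟫ + c) ∂(stdGaussian E) - (⟪a, e⟫ + b * c)| ≤
      220 * R ^ 3 / σ ^ 2 := by
  have hq := integrable_affine_perp (E := E) (v := v) (e := e) c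
  have hlin : ∫ x, (⟪a, x⟫ + b) * (⟪e, perp v x⟫ + c) ∂(stdGaussian E) = ⟪a, e⟫ + b * c := by
    have h1 : ∀ x, (⟪a, x⟫ + b) * (⟪e, perp v x⟫ + c) =
        ⟪a, x⟫ * ⟪perp v e, x⟫ + c * ⟪a, x⟫ + b * ⟪perp v e, x⟫ + b * c := by
      intro x; rw [inner_perp]; ring
    simp_rw [h1]
    rw [integral_add, integral_add, integral_add, integral_const_mul, integral_const_mul,
      integral_inner_stdGaussian, integral_inner_stdGaussian, integral_inner_mul_inner]
    · simp [perp, inner_sub_right, real_inner_smul_right, real_inner_comm v a, ha]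
    · exact integrable_inner_mul _ _
    · exact (integrable_inner _).const_mul _
    · exact (integrable_inner_mul _ _).add ((integrable_inner _).const_mul _)
    · exact (integrable_inner _).const_mul _
    · exact ((integrable_inner_mul _ _).add ((integrable_inner _).const_mul _)).add
        ((integrable_inner _).const_mul _)
    · exact integrable_const _
  have hlini : Integrable (fun x => (⟪a, x⟫ + b) * (⟪e, perp v x⟫ + c)) (stdGaussian E) := by
    simp_rw [inner_perp]
    exact ((memLp_inner a 2 (by simp)).add (memLp_const b)).integrable_mul
      ((memLp_inner (perp v e) 2 (by simp)).add (memLp_const c))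
  have hci := integrable_clip_mul hσ.le (g := fun x => ⟪a, x⟫ + b) (by fun_prop) hq
  rw [← hlin, ← integral_sub hci hlini]
  refine (abs_integral_le_integral_abs).trans ?_
  have hpe : ‖perp v e‖ ≤ 1 := (norm_perp_le hv.le e).trans he
  have hR1 : ‖R⁻¹ • a‖ ≤ 1 := by
    rw [norm_smul, norm_inv, Real.norm_eq_abs, abs_of_pos hR, inv_mul_le_iff₀ hR]; linarith
  set K := 24 * Real.exp 1
  have hbound : ∀ x, |clip σ (⟪a, x⟫ + b) * (⟪e, perp v x⟫ + c) -
      (⟪a, x⟫ + b) * (⟪e, perp v x⟫ + c)| ≤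
      R ^ 3 / σ ^ 2 * (3 / 4 * (K * Real.exp (1 * |⟪R⁻¹ • a, x⟫|)) +
        1 / 4 * (K * Real.exp (1 * |⟪perp v e, x⟫|))) := by
    intro x
    rw [← sub_mul, abs_mul]
    have h1 := abs_clip_sub_le hσ (⟪a, x⟫ + b)
    have h2 : |⟪a, x⟫ + b| ≤ R * (1 + |⟪R⁻¹ • a, x⟫|) := by
      rw [real_inner_smul_left, abs_mul, abs_of_pos (inv_pos.2 hR), mul_add, ← mul_assoc,
        mul_inv_cancel₀ hR.ne']
      have := abs_affine_le (a := a) (x := x) hb; linarith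
    have h3 : |⟪e, perp v x⟫ + c| ≤ 1 + |⟪perp v e, x⟫| := by
      rw [inner_perp]; exact abs_affine_le hc
    set U := |⟪R⁻¹ • a, x⟫|
    set W := |⟪perp v e, x⟫|
    have hU : 0 ≤ U := abs_nonneg _
    have hW : 0 ≤ W := abs_nonneg _
    -- Weighted AM-GM separates the two, possibly correlated, directions, so that only
    -- one-dimensional exponential moments are needed.
    have h4 : (1 + U) ^ 3 * (1 + W) ≤ 3 / 4 * (1 + U) ^ 4 + 1 / 4 * (1 + W) ^ 4 := by
      nlinarith [sq_nonneg ((1 + U) ^ 2 - (1 + W) ^ 2), sq_nonneg ((1 + U) ^ 2 - (1 + U) * (1 + W)),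
        sq_nonneg (1 + U), sq_nonneg (1 + W)]
    have h5 : (1 + U) ^ 4 ≤ K * Real.exp (1 * U) := by
      have := pow_four_le_exp (u := 1 + U) (by positivity)
      rw [Real.exp_add] at this; rw [one_mul]; linarith
    have h6 : (1 + W) ^ 4 ≤ K * Real.exp (1 * W) := by
      have := pow_four_le_exp (u := 1 + W) (by positivity)
      rw [Real.exp_add] at this; rw [one_mul]; linarith
    calc |clip σ (⟪a, x⟫ + b) - (⟪a, x⟫ + b)| * |⟪e, perp v x⟫ + c|
        ≤ ((R * (1 + U)) ^ 3 / σ ^ 2) * (1 + W) := by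
          gcongr
          exact h1.trans (by gcongr)
      _ = R ^ 3 / σ ^ 2 * ((1 + U) ^ 3 * (1 + W)) := by ring
      _ ≤ _ := by gcongr; linarith
  have hbi : Integrable (fun x => 3 / 4 * (K * Real.exp (1 * |⟪R⁻¹ • a, x⟫|)) +
        1 / 4 * (K * Real.exp (1 * |⟪perp v e, x⟫|))) (stdGaussian E) :=
    (((integrable_exp_abs_inner _ _).const_mul _).const_mul _).add
      (((integrable_exp_abs_inner _ _).const_mul _).const_mul _)
  refine (integral_mono (hci.sub hlini).abs (hbi.const_mul _) hbound).trans ?_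
  rw [integral_const_mul, integral_add, integral_const_mul, integral_const_mul, integral_const_mul,
    integral_const_mul]
  · have hexp : ∀ u : E, ‖u‖ ≤ 1 →
        ∫ x, Real.exp (1 * |⟪u, x⟫|) ∂(stdGaussian E) ≤ 2 * Real.exp (1 / 2) := by
      intro u hu
      refine (integral_exp_abs_inner_le u 1).trans ?_
      gcongr; nlinarith [norm_nonneg u]
    have h1 := hexp _ hR1
    have h2 := hexp _ hpe
    have hK : K * (2 * Real.exp (1 / 2)) ≤ 220 := by
      have h7 : Real.exp (1 / 2) ≤ 1.65 := by
        by_contra h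
        push Not at h
        have h1 : Real.exp 1 = Real.exp (1 / 2) ^ 2 := by rw [← Real.exp_nat_mul]; norm_num
        have h2 : (1.65 : ℝ) ^ 2 ≤ Real.exp (1 / 2) ^ 2 := by gcongr
        linarith [Real.exp_one_lt_d9, h1 ▸ h2, show (2.72 : ℝ) < 1.65 ^ 2 by norm_num]
      have h8 : K ≤ 24 * 2.7182818286 := by
        simp only [K]; linarith [Real.exp_one_lt_d9]
      calc K * (2 * Real.exp (1 / 2)) ≤ (24 * 2.7182818286) * (2 * 1.65) := by gcongr
        _ ≤ 220 := by norm_num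
    have hK0 : 0 < K := by positivity
    calc _ ≤ R ^ 3 / σ ^ 2 * (3 / 4 * (K * (2 * Real.exp (1 / 2))) +
          1 / 4 * (K * (2 * Real.exp (1 / 2)))) := by gcongr
      _ ≤ R ^ 3 / σ ^ 2 * 220 := by gcongr; linarith
      _ = _ := by ring
  · exact ((integrable_exp_abs_inner _ _).const_mul _).const_mul _
  · exact ((integrable_exp_abs_inner _ _).const_mul _).const_mul _

/-! ### Disagreement of nearby halfspaces, and the mass of the smaller side. -/

/-- Halfspaces with nearby boundaries disagree with small probability. -/
theorem disagreement_le {v a : E} (hv : ‖v‖ = 1) (ha : ⟪v, a⟫ = 0) {R s B : ℝ}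
    (hR : 0 < R) (haR : ‖a‖ ≤ R) (hb : |B - s| ≤ R) (hsR : |s| * R ≤ 1) :
    (stdGaussian E).real {x | sgn (⟪v, x⟫ + s) ≠ sgn (⟪v, x⟫ + ⟪a, x⟫ + B)} ≤
      110 * (R * gdens s) := by
  set S := {x : E | sgn (⟪v, x⟫ + s) ≠ sgn (⟪v, x⟫ + ⟪a, x⟫ + B)} with hS
  have hSm : MeasurableSet S :=
    (measurableSet_eq_fun (measurable_sgn.comp (by fun_prop))
      (measurable_sgn.comp (by fun_prop))).compl
  have hFi : Integrable (S.indicator (fun _ => (1 : ℝ))) (stdGaussian E) :=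
    (integrable_const 1).indicator hSm
  have h0 : (stdGaussian E).real S = ∫ x, S.indicator (fun _ => (1 : ℝ)) x ∂(stdGaussian E) := by
    rw [integral_indicator hSm]; simp
  rw [h0, integral_resample hv hFi]
  have hR1 : ‖R⁻¹ • a‖ ≤ 1 := by
    rw [norm_smul, norm_inv, Real.norm_eq_abs, abs_of_pos hR, inv_mul_le_iff₀ hR]; linarith
  have hin : ∀ x, ∫ r, S.indicator (fun _ => (1 : ℝ)) (x - ⟪v, x⟫ • v + r • v)
      ∂(gaussianReal 0 1) ≤ gdens s * (R * Real.exp 2 * Real.exp (2 * |⟪R⁻¹ • a, x⟫|)) := by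
    intro x
    set q := ⟪a, x⟫ + (B - s) with hq
    have h1 : ∀ r, S.indicator (fun _ => (1 : ℝ)) (x - ⟪v, x⟫ • v + r • v) =
        {r | sgn (r + s) ≠ sgn (r + s + q)}.indicator (fun _ => (1 : ℝ)) r := by
      intro r
      simp only [Set.indicator_apply, hS, Set.mem_ofPred_eq, inner_resample hv,
        inner_resample_of_orthogonal ha]
      have hrq : r + s + q = r + ⟪a, x⟫ + B := by rw [hq]; ring
      simp only [hrq]
    simp_rw [h1]
    rw [integral_indicator]
    · simp only [integral_const, smul_eq_mul, mul_one, measureReal_restrict_apply_univ]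
      refine (gaussian_disagree s q).trans ?_
      have hg := gdens_pos s
      have h2 : |q| ≤ R * (1 + |⟪R⁻¹ • a, x⟫|) := by
        rw [real_inner_smul_left, abs_mul, abs_of_pos (inv_pos.2 hR), mul_add, ← mul_assoc,
          mul_inv_cancel₀ hR.ne']
        have := abs_affine_le (a := a) (x := x) hb; linarith
      set U := |⟪R⁻¹ • a, x⟫|
      have hU : 0 ≤ U := abs_nonneg _
      refine mul_le_mul_of_nonneg_left ?_ hg.le
      calc |q| * Real.exp (|s| * |q|) ≤ (R * Real.exp (1 + U)) * Real.exp (1 + U) := by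
            gcongr
            · refine h2.trans ?_
              gcongr
              linarith [Real.add_one_le_exp (1 + U)]
            · calc |s| * |q| ≤ |s| * (R * (1 + U)) := by gcongr
                _ = |s| * R * (1 + U) := by ring
                _ ≤ 1 * (1 + U) := by gcongr
                _ = _ := one_mul _
        _ = _ := by rw [mul_assoc, mul_assoc, ← Real.exp_add, ← Real.exp_add]; ring_nf
    · exact (measurableSet_eq_fun (measurable_sgn.comp (by fun_prop))
        (measurable_sgn.comp (by fun_prop))).compl
  have hbi := (((integrable_exp_abs_inner (R⁻¹ • a) 2).const_mul (R * Real.exp 2)).const_mul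
    (gdens s))
  refine (integral_mono (integrable_resample hv hFi).integral_prod_left hbi hin).trans ?_
  rw [integral_const_mul, integral_const_mul]
  have h2 : ∫ x, Real.exp (2 * |⟪R⁻¹ • a, x⟫|) ∂(stdGaussian E) ≤ 2 * Real.exp 2 := by
    refine (integral_exp_abs_inner_le _ 2).trans ?_
    gcongr; nlinarith [norm_nonneg (R⁻¹ • a)]
  have hg := gdens_pos s
  calc _ ≤ gdens s * (R * 7.3891 * (2 * 7.3891)) := by
        gcongr
        · exact exp_two_lt.le
        · exact h2.trans (by linarith [exp_two_lt])
    _ ≤ _ := by nlinarith [mul_pos hg hR]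

/-- The smaller side of a halfspace with offset `t` has mass at most `exp (-t ^ 2 / 2)`. -/
theorem min_mass_le {w : E} (hw : ‖w‖ = 1) (t : ℝ) :
    min ((stdGaussian E).real {x | sgn (⟪w, x⟫ + t) = 1})
      ((stdGaussian E).real {x | sgn (⟪w, x⟫ + t) = -1}) ≤ Real.exp (-t ^ 2 / 2) := by
  have key : ∀ (u : E), ‖u‖ = 1 → ∀ r : ℝ, 0 ≤ r →
      (stdGaussian E).real {x | ⟪u, x⟫ + r < 0} ≤ Real.exp (-r ^ 2 / 2) := by
    intro u hu r hr
    refine le_trans (le_of_eq ?_) (gaussian_tail hr)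
    have h1 : ‖u‖₊ ^ 2 = 1 := by ext; simp [hu]
    rw [← h1, ← stdGaussian_map_inner u, map_measureReal_apply (by fun_prop)
      (measurableSet_lt (by fun_prop) (by fun_prop))]
    rfl
  rcases le_total 0 t with ht | ht
  · refine (min_le_right _ _).trans (le_trans (le_of_eq ?_) (key w hw t ht))
    simp only [sgn_eq_neg_one_iff]
  · refine (min_le_left _ _).trans ?_
    have h := key (-w) (by rwa [norm_neg]) (-t) (by linarith)
    have heq : (stdGaussian E).real {x | sgn (⟪w, x⟫ + t) = 1} =
        (stdGaussian E).real {x | ⟪w, x⟫ + t ∈ Set.Ici (0 : ℝ)} := by simp [sgn_eq_one_iff]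
    -- Since the sign of 0 is 1, the positive side is closed. The strict tail bound applied to `-w`
    -- misses the boundary hyperplane, which is a null set.
    have hnull : (stdGaussian E) {x | ⟪w, x⟫ = -t} = 0 := by
      have h1 : ‖w‖₊ ^ 2 = 1 := by ext; simp [hw]
      have h2 : (gaussianReal 0 1) {-t} = 0 := by
        have := nullSingletonClass_gaussianReal (μ := 0) (v := 1) one_ne_zero
        exact measure_singleton _
      rw [← h1, ← stdGaussian_map_inner w, Measure.map_apply (by fun_prop)
        (measurableSet_singleton _)] at h2
      exact h2
    rw [heq]
    have hsub : {x : E | ⟪w, x⟫ + t ∈ Set.Ici (0 : ℝ)} ⊆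
        {x | ⟪-w, x⟫ + -t < 0} ∪ {x | ⟪w, x⟫ = -t} := by
      intro x hx
      simp only [Set.mem_ofPred_eq, Set.mem_Ici, Set.mem_union, inner_neg_left] at hx ⊢
      rcases eq_or_lt_of_le hx with h' | h'
      · right; linarith
      · left; linarith
    refine (measureReal_mono hsub).trans ((measureReal_union_le _ _).trans ?_)
    rw [measureReal_def _ {x : E | ⟪w, x⟫ = -t}, hnull]
    simpa using h

end Statistics

/-! ### Deviation of statistics that depend on earlier samples -/

/-- The radius `√(4Vℓ/n)` makes the Bernstein exponent equal to `ℓ`, and `ℓ/n ≤ a²V` keeps it in the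
Bernstein range. The radius depends on the adaptive parameter through `V`, and `valid` discards
parameters without a moment bound. -/
theorem adaptive_deviation {Z : Type*} [MeasurableSpace Z] {D : Measure Z} [IsProbabilityMeasure D]
    {X : Type*} [MeasurableSpace X] {o n : ℕ} (hn : 0 < n) {g : (ℕ → Z) → X}
    (hg : Measurable g) (hdep : DependsBefore o g) {Y : X → Z → ℝ}
    (hY : Measurable (Function.uncurry Y)) {valid : Set X} (hvalid : MeasurableSet valid)
    {V : X → ℝ} (hVm : Measurable V) {a ℓ : ℝ} (ha : 0 ≤ a) (hℓ : 0 ≤ ℓ)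
    (h : ∀ x ∈ valid, 0 < V x ∧ Integrable (fun z => Y x z ^ 2 * Real.exp (a * |Y x z|)) D ∧
      ∫ z, Y x z ^ 2 * Real.exp (a * |Y x z|) ∂D ≤ V x ∧ ℓ / n ≤ a ^ 2 * V x) :
    Measure.infinitePi (fun _ : ℕ => D)
      {s | g s ∈ valid ∧ Real.sqrt (4 * V (g s) * ℓ / n) ≤
        |(∑ i ∈ Finset.range n, Y (g s) (s (o + i))) / n - ∫ z, Y (g s) z ∂D|} ≤
      ENNReal.ofReal (2 * Real.exp (-ℓ)) := by
  have hmean : Measurable (fun x => ∫ z, Y x z ∂D) :=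
    (hY.stronglyMeasurable.integral_prod_right).measurable
  set B : Set (X × (Fin n → Z)) := {p | p.1 ∈ valid ∧ Real.sqrt (4 * V p.1 * ℓ / n) ≤
    |(∑ i : Fin n, Y p.1 (p.2 i)) / n - ∫ z, Y p.1 z ∂D|} with hBdef
  have hsumm : Measurable (fun p : X × (Fin n → Z) => ∑ i : Fin n, Y p.1 (p.2 i)) := by
    refine Finset.measurable_sum _ fun i _ => ?_
    exact hY.comp (measurable_fst.prodMk ((measurable_pi_apply i).comp measurable_snd))
  have hB : MeasurableSet B := by
    have hBeq : B = Prod.fst ⁻¹' valid ∩ {p : X × (Fin n → Z) | Real.sqrt (4 * V p.1 * ℓ / n) ≤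
      |(∑ i : Fin n, Y p.1 (p.2 i)) / n - ∫ z, Y p.1 z ∂D|} := rfl
    rw [hBeq]
    refine (measurable_fst hvalid).inter (measurableSet_le ?_ ?_)
    · have : Measurable (fun p : X × (Fin n → Z) => V p.1) := hVm.comp measurable_fst
      exact ((((this.const_mul 4).mul_const ℓ).div_const _)).sqrt
    · have : Measurable (fun p : X × (Fin n → Z) => ∫ z, Y p.1 z ∂D) := hmean.comp measurable_fst
      exact ((hsumm.div_const _).sub this).abs
  have hq : ∀ x, Measure.infinitePi (fun _ : ℕ => D) {s | (x, block o n s) ∈ B} ≤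
      ENNReal.ofReal (2 * Real.exp (-ℓ)) := by
    intro x
    by_cases hx : x ∈ valid
    · obtain ⟨hV0, hVi, hVle, hVn⟩ := h x hx
      have hn' : (0 : ℝ) < n := by exact_mod_cast hn
      set r := Real.sqrt (4 * V x * ℓ / n) with hr
      have hra : r ≤ 2 * a * V x := by
        rw [hr, Real.sqrt_le_left (by positivity)]
        calc 4 * V x * ℓ / n = 4 * V x * (ℓ / n) := by ring
          _ ≤ 4 * V x * (a ^ 2 * V x) := by gcongr
          _ = _ := by ring
      have ht := block_average_tail (hY.comp measurable_prodMk_left : Measurable (Y x)) ha hVi hVle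
        hV0 o hn (Real.sqrt_nonneg _) hra
      have hexp : (n : ℝ) * (r ^ 2 / (4 * V x)) = ℓ := by
        rw [hr, Real.sq_sqrt (by positivity)]; field_simp
      rw [hexp] at ht
      have hset : {s | (x, block o n s) ∈ B} = {s | r ≤
          |(∑ i ∈ Finset.range n, Y x (s (o + i))) / n - ∫ z, Y x z ∂D|} := by
        ext s
        simp [hBdef, hx, block, Finset.sum_range, hr]
      rw [hset, ← ENNReal.ofReal_toReal (measure_ne_top _ _)]
      exact ENNReal.ofReal_le_ofReal ht
    · have : {s | (x, block o n s) ∈ B} = ∅ := by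
        ext s; simp [hBdef, hx]
      rw [this]; simp
  have := measure_adaptive_le (D := D) hg hdep hB hq
  convert this using 3
  ext s
  simp [hBdef, block, Finset.sum_range]

/-! ### The learner as a function of the sample sequence -/

section Model

variable {d : ℕ}

/-- Labelled examples. -/
abbrev Sample (d : ℕ) := EuclideanSpace ℝ (Fin d) × ℤˣ

/-- The label as a real number. -/
def label (z : Sample d) : ℝ := ((z.2 : ℤ) : ℝ)

theorem measurable_label_sample : Measurable (label (d := d)) :=
  measurable_label.comp measurable_snd

/-- The weight of the first two passes of a round. -/
def hermite (p : ℝ) : ℝ := p ^ 2 - 1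

/-- Weighted average of the label times the component of the example orthogonal to `v`. -/
def vecAvg (W : ℝ → ℝ) (v : EuclideanSpace ℝ (Fin d)) (o n : ℕ) (s : ℕ → Sample d) :
    EuclideanSpace ℝ (Fin d) :=
  (n : ℝ)⁻¹ • ∑ i ∈ Finset.range n,
    (label (s (o + i)) * W ⟪v, (s (o + i)).1⟫) • perp v (s (o + i)).1

/-- Weighted average of the label. -/
def scAvg (W : ℝ → ℝ) (v : EuclideanSpace ℝ (Fin d)) (o n : ℕ) (s : ℕ → Sample d) : ℝ :=
  (n : ℝ)⁻¹ * ∑ i ∈ Finset.range n, label (s (o + i)) * W ⟪v, (s (o + i)).1⟫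

/-- A scalar statistic of one example. -/
def stat (W : ℝ → ℝ) (v e : EuclideanSpace ℝ (Fin d)) (c : ℝ) (z : Sample d) : ℝ :=
  label z * (W ⟪v, z.1⟫ * (⟪e, perp v z.1⟫ + c))

/-- The averages of all scalar statistics are linear functionals of one vector average and one
scalar average, the two quantities that a pass accumulates. -/
theorem average_stat (W : ℝ → ℝ) (v e : EuclideanSpace ℝ (Fin d)) (c : ℝ) (o n : ℕ)
    (s : ℕ → Sample d) :
    (∑ i ∈ Finset.range n, stat W v e c (s (o + i))) / n =
      ⟪e, vecAvg W v o n s⟫ + c * scAvg W v o n s := by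
  unfold vecAvg scAvg stat
  rw [real_inner_smul_right, inner_sum, div_eq_inv_mul, mul_left_comm c, ← mul_add]
  congr 1
  rw [Finset.mul_sum, ← Finset.sum_add_distrib]
  refine Finset.sum_congr rfl fun i _ => ?_
  rw [real_inner_smul_right]; ring

/-- The polylogarithmic scale. -/
def Lam (ε : ℝ) : ℝ := 4 * (1 + Real.log (1 / ε))

/-- The confidence scale. -/
def ell (d : ℕ) (ε δ : ℝ) : ℝ := 40 * Real.log (10 * d / (ε * δ))

/-- The nominal block length of round `i`. -/
def nomLen (d : ℕ) (ε δ : ℝ) (i : ℕ) : ℝ := d * ell d ε δ * 2 ^ i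

/-- The block length of round `i`. -/
def len (d : ℕ) (ε δ : ℝ) (i : ℕ) : ℕ := ⌈nomLen d ε δ i⌉₊

/-- The number of samples drawn before round `i`. -/
def offset (d : ℕ) (ε δ : ℝ) (i : ℕ) : ℕ := ∑ k ∈ Finset.range i, 2 * len d ε δ k

/-- The accuracy before refinement stage `j`. -/
def rad (ε : ℝ) (j : ℕ) : ℝ := 1 / (1200 * Lam ε ^ 2) / 2 ^ j

/-- The empirical first Chow parameters of round `i`. -/
def chow (ε δ : ℝ) (i : ℕ) (s : ℕ → Sample d) : EuclideanSpace ℝ (Fin d) :=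
  -- With `v = 0` the weight is `hermite 0 = -1` and `perp 0 x = x`, so the pass used for the second
  -- coefficient also yields the Chow parameters, up to the sign corrected here.
  -vecAvg hermite 0 (offset d ε δ i) (len d ε δ i) s

/-- The average label of round `i`. -/
def chowZero (ε δ : ℝ) (i : ℕ) (s : ℕ → Sample d) : ℝ :=
  -scAvg hermite 0 (offset d ε δ i) (len d ε δ i) s

/-- The initial direction of round `i`. -/
def dir (ε δ : ℝ) (i : ℕ) (s : ℕ → Sample d) : EuclideanSpace ℝ (Fin d) :=
  ‖chow ε δ i s‖⁻¹ • chow ε δ i s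

/-- The empirical second Hermite coefficient in the initial direction of round `i`. -/
def hermiteAvg (ε δ : ℝ) (i : ℕ) (s : ℕ → Sample d) : ℝ :=
  scAvg hermite (dir ε δ i s) (offset d ε δ i + len d ε δ i) (len d ε δ i) s

/-- The initial threshold of round `i`. -/
def thr (ε δ : ℝ) (i : ℕ) (s : ℕ → Sample d) : ℝ :=
  -hermiteAvg ε δ i s / ‖chow ε δ i s‖

/-- One refinement step from the hypothesis `h`. -/
def refine (m σ : ℝ) (o n : ℕ) (s : ℕ → Sample d) (h : EuclideanSpace ℝ (Fin d) × ℝ) :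
    EuclideanSpace ℝ (Fin d) × ℝ :=
  let v := h.1 + m⁻¹ • vecAvg (band h.2 σ) h.1 o n s
  (‖v‖⁻¹ • v, (h.2 + m⁻¹ * scAvg (band h.2 σ) h.1 o n s) / ‖v‖)

/-- Position of the block of refinement stage `j` of round `i`. -/
def stageOffset (d : ℕ) (ε δ : ℝ) (i j : ℕ) : ℕ := offset d ε δ (i + 1) + j * len d ε δ i

/-- The hypothesis of round `i` after `j` refinement stages. -/
def hyp (ε δ : ℝ) (i : ℕ) (s : ℕ → Sample d) : ℕ → EuclideanSpace ℝ (Fin d) × ℝ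
  | 0 => (dir ε δ i s, thr ε δ i s)
  | j + 1 => refine ‖chow ε δ i s‖ (600 * Lam ε * rad ε j) (stageOffset d ε δ i j) (len d ε δ i) s
      (hyp ε δ i s j)

/-! #### Measurability and locality -/

theorem measurable_vecAvg {X : Type*} [MeasurableSpace X] {W : X → ℝ → ℝ}
    (hW : Measurable (Function.uncurry W)) {v : X → EuclideanSpace ℝ (Fin d)} (hv : Measurable v)
    {f : X → ℕ → Sample d} (hf : Measurable f) (o n : ℕ) :
    Measurable (fun x => vecAvg (W x) (v x) o n (f x)) := by
  unfold vecAvg perp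
  have hsum : Measurable (fun x => ∑ i ∈ Finset.range n,
      (label (f x (o + i)) * W x ⟪v x, (f x (o + i)).1⟫) •
        ((f x (o + i)).1 - ⟪v x, (f x (o + i)).1⟫ • v x)) := by
    refine Finset.measurable_sum _ fun i _ => ?_
    have h1 : Measurable (fun x => f x (o + i)) := (measurable_pi_apply _).comp hf
    have h2 : Measurable (fun x => (f x (o + i)).1) := measurable_fst.comp h1
    have h3 : Measurable (fun x => ⟪v x, (f x (o + i)).1⟫) := hv.inner h2
    exact ((measurable_label_sample.comp h1).mul (hW.comp (measurable_id.prodMk h3))).smul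
      (h2.sub (h3.smul hv))
  exact hsum.const_smul ((n : ℝ)⁻¹)

theorem measurable_scAvg {X : Type*} [MeasurableSpace X] {W : X → ℝ → ℝ}
    (hW : Measurable (Function.uncurry W)) {v : X → EuclideanSpace ℝ (Fin d)} (hv : Measurable v)
    {f : X → ℕ → Sample d} (hf : Measurable f) (o n : ℕ) :
    Measurable (fun x => scAvg (W x) (v x) o n (f x)) := by
  unfold scAvg
  refine Measurable.const_mul (Finset.measurable_sum _ fun i _ => ?_) _
  have h1 : Measurable (fun x => f x (o + i)) := (measurable_pi_apply _).comp hf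
  have h2 : Measurable (fun x => (f x (o + i)).1) := measurable_fst.comp h1
  have h3 : Measurable (fun x => ⟪v x, (f x (o + i)).1⟫) := hv.inner h2
  exact (measurable_label_sample.comp h1).mul (hW.comp (measurable_id.prodMk h3))

theorem measurable_hermite : Measurable hermite := by unfold hermite; fun_prop

theorem measurable_chow (ε δ : ℝ) (i : ℕ) : Measurable (chow (d := d) ε δ i) :=
  (measurable_vecAvg (W := fun _ => hermite) (measurable_hermite.comp measurable_snd)
    measurable_const measurable_id _ _).neg

theorem measurable_dir (ε δ : ℝ) (i : ℕ) : Measurable (dir (d := d) ε δ i) :=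
  (measurable_chow ε δ i).norm.inv.smul (measurable_chow ε δ i)

theorem measurable_hermiteAvg (ε δ : ℝ) (i : ℕ) : Measurable (hermiteAvg (d := d) ε δ i) :=
  measurable_scAvg (W := fun _ => hermite) (measurable_hermite.comp measurable_snd)
    (measurable_dir ε δ i) measurable_id _ _

theorem measurable_hyp (ε δ : ℝ) (i j : ℕ) : Measurable (fun s => hyp (d := d) ε δ i s j) := by
  induction j with
  | zero =>
    exact (measurable_dir ε δ i).prodMk
      ((measurable_hermiteAvg ε δ i).neg.div (measurable_chow ε δ i).norm)
  | succ j ih =>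
    have h1 : Measurable (fun s => (hyp (d := d) ε δ i s j).1) := measurable_fst.comp ih
    have h2 : Measurable (fun s => (hyp (d := d) ε δ i s j).2) := measurable_snd.comp ih
    have hm := (measurable_chow (d := d) ε δ i).norm.inv
    have hW : Measurable (Function.uncurry fun s : ℕ → Sample d =>
        band (hyp (d := d) ε δ i s j).2 (600 * Lam ε * rad ε j)) := by
      refine measurable_band.comp (((h2.comp measurable_fst)).prodMk
        (measurable_const.prodMk measurable_snd))
    have hv := h1.add (hm.smul (measurable_vecAvg hW h1 measurable_id
      (stageOffset d ε δ i j) (len d ε δ i)))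
    exact (hv.norm.inv.smul hv).prodMk
      ((h2.add (hm.mul (measurable_scAvg hW h1 measurable_id
        (stageOffset d ε δ i j) (len d ε δ i)))).div hv.norm)

theorem vecAvg_congr {W : ℝ → ℝ} {v : EuclideanSpace ℝ (Fin d)} {o n : ℕ} {s s' : ℕ → Sample d}
    (h : ∀ i < o + n, s i = s' i) : vecAvg W v o n s = vecAvg W v o n s' := by
  unfold vecAvg
  congr 1
  refine Finset.sum_congr rfl fun i hi => ?_
  rw [h (o + i) (by simp at hi; omega)]

theorem scAvg_congr {W : ℝ → ℝ} {v : EuclideanSpace ℝ (Fin d)} {o n : ℕ} {s s' : ℕ → Sample d}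
    (h : ∀ i < o + n, s i = s' i) : scAvg W v o n s = scAvg W v o n s' := by
  unfold scAvg
  congr 1
  refine Finset.sum_congr rfl fun i hi => ?_
  rw [h (o + i) (by simp at hi; omega)]

theorem offset_succ (d : ℕ) (ε δ : ℝ) (i : ℕ) :
    offset d ε δ (i + 1) = offset d ε δ i + 2 * len d ε δ i := by
  unfold offset; rw [Finset.sum_range_succ]

theorem dependsBefore_chow (ε δ : ℝ) (i : ℕ) :
    DependsBefore (offset d ε δ i + len d ε δ i) (chow (d := d) ε δ i) := by
  intro s s' h
  unfold chow; rw [vecAvg_congr h]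

theorem dependsBefore_dir (ε δ : ℝ) (i : ℕ) :
    DependsBefore (offset d ε δ i + len d ε δ i) (dir (d := d) ε δ i) := by
  intro s s' h
  unfold dir; rw [dependsBefore_chow ε δ i s s' h]

/-- Stage `j` starts where the data behind its hypothesis end, so every stage averages over a block
that is independent of the hypothesis it refines. -/
theorem dependsBefore_hyp (ε δ : ℝ) (i j : ℕ) :
    DependsBefore (stageOffset d ε δ i j) (fun s => hyp (d := d) ε δ i s j) := by
  induction j with
  | zero =>
    intro s s' h
    simp only [stageOffset, offset_succ] at h
    have h1 := dependsBefore_chow ε δ i s s' fun k hk => h k (by omega)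
    have h2 := dependsBefore_dir ε δ i s s' fun k hk => h k (by omega)
    simp only [hyp, thr, hermiteAvg]
    rw [h2, h1, scAvg_congr fun k hk => h k (by omega)]
  | succ j ih =>
    intro s s' h
    have hle : stageOffset d ε δ i (j + 1) = stageOffset d ε δ i j + len d ε δ i := by
      unfold stageOffset; ring
    rw [hle] at h
    have hoff : offset d ε δ i + len d ε δ i ≤ stageOffset d ε δ i j := by
      unfold stageOffset; rw [offset_succ]; omega
    have h1 := dependsBefore_chow ε δ i s s' fun k hk => h k (by omega)
    have h2 := ih s s' fun k hk => h k (by omega)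
    simp only at h2
    simp only [hyp, refine]
    rw [h2, h1, vecAvg_congr h, scAvg_congr h]

end Model

/-! ### The good event -/

section GoodEvent

variable {d : ℕ}

/-- The average of a statistic over a block. -/
def statAvg (W : ℝ → ℝ) (v e : EuclideanSpace ℝ (Fin d)) (c : ℝ) (o n : ℕ) (s : ℕ → Sample d) : ℝ :=
  (∑ i ∈ Finset.range n, stat W v e c (s (o + i))) / n

/-- The mean of a statistic. -/
def statMean (D : Measure (Sample d)) (W : ℝ → ℝ) (v e : EuclideanSpace ℝ (Fin d)) (c : ℝ) : ℝ :=
  ∫ z, stat W v e c z ∂D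

/-- The test vectors: the coordinate directions and the constant. -/
def testVec : Option (Fin d) → EuclideanSpace ℝ (Fin d)
  | none => 0
  | some j => EuclideanSpace.single j 1

/-- The constant part of the test functions. -/
def testConst : Option (Fin d) → ℝ
  | none => 1
  | some _ => 0

theorem norm_testVec_le (k : Option (Fin d)) : ‖testVec k‖ ≤ 1 := by
  cases k <;> simp [testVec]

theorem abs_testConst_le (k : Option (Fin d)) : |testConst k| ≤ 1 := by
  cases k <;> simp [testConst]

/-- The half-width of the band of refinement stage `j`. -/
def bandWidth (ε : ℝ) (j : ℕ) : ℝ := 600 * Lam ε * rad ε j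

/-- All statistics of the first `R` rounds, with at most `J` refinement stages, are close to their
means. -/
structure Good (D : Measure (Sample d)) (ε δ : ℝ) (R J : ℕ) (s : ℕ → Sample d) : Prop where
  first : ∀ i < R, ∀ k, |statAvg hermite 0 (testVec k) (testConst k) (offset d ε δ i)
      (len d ε δ i) s - statMean D hermite 0 (testVec k) (testConst k)| <
        Real.sqrt (960 * ell d ε δ / len d ε δ i)
  second : ∀ i < R, ‖dir ε δ i s‖ = 1 → |statAvg hermite (dir ε δ i s) 0 1
      (offset d ε δ i + len d ε δ i) (len d ε δ i) s - statMean D hermite (dir ε δ i s) 0 1| <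
        Real.sqrt (960 * ell d ε δ / len d ε δ i)
  -- The three premises are those under which the moment bound and the Bernstein range are
  -- available; they are verified along the actual run in `Good.stage_step`.
  stage : ∀ i < R, ∀ j < J, ∀ k, ‖(hyp ε δ i s j).1‖ = 1 →
      bandWidth ε j * (|(hyp ε δ i s j).2| + bandWidth ε j) ≤ 1 →
      ell d ε δ ≤ len d ε δ i * (bandWidth ε j * gdens (hyp ε δ i s j).2) →
      |statAvg (band (hyp ε δ i s j).2 (bandWidth ε j)) (hyp ε δ i s j).1 (testVec k) (testConst k)
        (stageOffset d ε δ i j) (len d ε δ i) s -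
        statMean D (band (hyp ε δ i s j).2 (bandWidth ε j)) (hyp ε δ i s j).1 (testVec k)
          (testConst k)| <
        Real.sqrt (5280 * (bandWidth ε j * gdens (hyp ε δ i s j).2) * ell d ε δ / len d ε δ i)

theorem label_sq (z : Sample d) : label z ^ 2 = 1 := by
  unfold label
  rcases Int.units_eq_one_or z.2 with h | h <;> simp [h]

theorem abs_label (z : Sample d) : |label z| = 1 := by
  unfold label
  rcases Int.units_eq_one_or z.2 with h | h <;> simp [h]

theorem stat_sq_mul_exp (W : ℝ → ℝ) (v e : EuclideanSpace ℝ (Fin d)) (c a : ℝ) (z : Sample d) :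
    stat W v e c z ^ 2 * Real.exp (a * |stat W v e c z|) =
      (W ⟪v, z.1⟫ * (⟪e, perp v z.1⟫ + c)) ^ 2 *
        Real.exp (a * |W ⟪v, z.1⟫ * (⟪e, perp v z.1⟫ + c)|) := by
  unfold stat
  rw [mul_pow, label_sq, abs_mul, abs_label, one_mul, one_mul]

/-- Labels are `±1` and drop out of squares and absolute values, so the moments under `D` are
moments of `x` alone, whatever the noise. -/
theorem IsRCN.stat_moment {D : Measure (Sample d)} {f : EuclideanSpace ℝ (Fin d) → ℤˣ} {η : ℝ}
    (hD : IsRCN D f η) {W : ℝ → ℝ} {v e : EuclideanSpace ℝ (Fin d)} {c a V : ℝ}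
    (h : Integrable (fun x => (W ⟪v, x⟫ * (⟪e, perp v x⟫ + c)) ^ 2 *
        Real.exp (a * |W ⟪v, x⟫ * (⟪e, perp v x⟫ + c)|)) (stdGaussian _) ∧
      ∫ x, (W ⟪v, x⟫ * (⟪e, perp v x⟫ + c)) ^ 2 *
        Real.exp (a * |W ⟪v, x⟫ * (⟪e, perp v x⟫ + c)|) ∂(stdGaussian _) ≤ V) :
    Integrable (fun z => stat W v e c z ^ 2 * Real.exp (a * |stat W v e c z|)) D ∧
      ∫ z, stat W v e c z ^ 2 * Real.exp (a * |stat W v e c z|) ∂D ≤ V := by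
  simp_rw [stat_sq_mul_exp]
  exact ⟨hD.integrable_comp_fst h.1, (hD.integral_comp_fst h.1).trans_le h.2⟩

theorem perp_zero_left (x : EuclideanSpace ℝ (Fin d)) : perp 0 x = x := by simp [perp]

theorem first_moment {e : EuclideanSpace ℝ (Fin d)} (he : ‖e‖ ≤ 1) {c : ℝ} (hc : |c| ≤ 1) :
    Integrable (fun x => (hermite ⟪0, x⟫ * (⟪e, perp 0 x⟫ + c)) ^ 2 *
        Real.exp (1 / 8 * |hermite ⟪0, x⟫ * (⟪e, perp 0 x⟫ + c)|)) (stdGaussian _) ∧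
      ∫ x, (hermite ⟪0, x⟫ * (⟪e, perp 0 x⟫ + c)) ^ 2 *
        Real.exp (1 / 8 * |hermite ⟪0, x⟫ * (⟪e, perp 0 x⟫ + c)|) ∂(stdGaussian _) ≤ 240 := by
  have h1 : ∀ x : EuclideanSpace ℝ (Fin d), (hermite ⟪0, x⟫ * (⟪e, perp 0 x⟫ + c)) ^ 2 *
      Real.exp (1 / 8 * |hermite ⟪0, x⟫ * (⟪e, perp 0 x⟫ + c)|) =
      (⟪e, x⟫ + c) ^ 2 * Real.exp (1 / 8 * |⟪e, x⟫ + c|) := by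
    intro x
    simp only [perp_zero_left, hermite, inner_zero_left]
    rw [abs_mul, mul_pow]; norm_num
  simp_rw [h1]
  obtain ⟨hi, hle⟩ := integral_affine_sq_mul_exp_le he hc
  have hb : ∀ x : EuclideanSpace ℝ (Fin d), (⟪e, x⟫ + c) ^ 2 * Real.exp (1 / 8 * |⟪e, x⟫ + c|) ≤
      (⟪e, x⟫ + c) ^ 2 * Real.exp |⟪e, x⟫ + c| := by
    intro x; gcongr; linarith [abs_nonneg (⟪e, x⟫ + c)]
  have hI : Integrable (fun x => (⟪e, x⟫ + c) ^ 2 * Real.exp (1 / 8 * |⟪e, x⟫ + c|))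
      (stdGaussian _) := by
    refine hi.mono' (Measurable.aestronglyMeasurable (by fun_prop)) (ae_of_all _ fun x => ?_)
    rw [Real.norm_eq_abs, abs_of_nonneg (by positivity)]; exact hb x
  exact ⟨hI, (integral_mono hI hi hb).trans (by linarith)⟩

theorem second_moment {v : EuclideanSpace ℝ (Fin d)} (hv : ‖v‖ = 1) :
    Integrable (fun x => (hermite ⟪v, x⟫ * (⟪0, perp v x⟫ + 1)) ^ 2 *
        Real.exp (1 / 8 * |hermite ⟪v, x⟫ * (⟪0, perp v x⟫ + 1)|)) (stdGaussian _) ∧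
      ∫ x, (hermite ⟪v, x⟫ * (⟪0, perp v x⟫ + 1)) ^ 2 *
        Real.exp (1 / 8 * |hermite ⟪v, x⟫ * (⟪0, perp v x⟫ + 1)|) ∂(stdGaussian _) ≤ 240 := by
  simpa [hermite] using integral_sq_sub_one_sq_mul_exp_le hv

theorem measurable_stat {X : Type*} [MeasurableSpace X] {W : X → ℝ → ℝ}
    (hW : Measurable (Function.uncurry W)) {v : X → EuclideanSpace ℝ (Fin d)} (hv : Measurable v)
    (e : EuclideanSpace ℝ (Fin d)) (c : ℝ) :
    Measurable (Function.uncurry fun x z => stat (W x) (v x) e c z) := by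
  unfold stat perp Function.uncurry
  have h2 : Measurable (fun p : X × Sample d => p.2.1) := measurable_fst.comp measurable_snd
  have h3 : Measurable (fun p : X × Sample d => v p.1) := hv.comp measurable_fst
  have h4 : Measurable (fun p : X × Sample d => ⟪v p.1, p.2.1⟫) := h3.inner h2
  have h5 : Measurable (fun p : X × Sample d => p.2.1 - ⟪v p.1, p.2.1⟫ • v p.1) :=
    h2.sub (h4.smul h3)
  have h6 : Measurable (fun p : X × Sample d => ⟪e, p.2.1 - ⟪v p.1, p.2.1⟫ • v p.1⟫ + c) :=
    (measurable_const.inner h5).add_const c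
  exact (measurable_label_sample.comp measurable_snd).mul
    ((hW.comp (measurable_fst.prodMk h4)).mul h6)

theorem one_le_ell {d : ℕ} (hd : 1 ≤ d) {ε δ : ℝ} (hε : 0 < ε) (hε' : ε < 1 / 2) (hδ : 0 < δ)
    (hδ' : δ < 1 / 2) : 1 ≤ ell d ε δ := by
  unfold ell
  have hd' : (1 : ℝ) ≤ d := by exact_mod_cast hd
  have h1 : Real.exp 1 ≤ 10 * d / (ε * δ) := by
    rw [le_div_iff₀ (by positivity)]
    have := Real.exp_one_lt_d9
    have h2 : ε * δ ≤ 1 / 4 := by nlinarith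
    have h3 : 0 < ε * δ := by positivity
    nlinarith
  have : 1 ≤ Real.log (10 * d / (ε * δ)) := by
    rw [Real.le_log_iff_exp_le (by positivity)]; exact h1
  linarith

theorem ell_le_len {d : ℕ} (hd : 1 ≤ d) {ε δ : ℝ} (hl : 1 ≤ ell d ε δ) (i : ℕ) :
    ell d ε δ ≤ len d ε δ i := by
  refine le_trans ?_ (Nat.le_ceil _)
  unfold nomLen
  have hd' : (1 : ℝ) ≤ d := by exact_mod_cast hd
  have h2 : (1 : ℝ) ≤ 2 ^ i := one_le_pow₀ (by norm_num)
  have : ell d ε δ * 1 ≤ ell d ε δ * (d * 2 ^ i) := by gcongr; nlinarith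
  nlinarith

theorem Lam_pos {ε : ℝ} (hε : 0 < ε) (hε' : ε < 1 / 2) : 4 ≤ Lam ε := by
  unfold Lam
  have : 0 ≤ Real.log (1 / ε) := Real.log_nonneg (by rw [le_div_iff₀ hε]; linarith)
  linarith

theorem rad_pos {ε : ℝ} (hε : 0 < ε) (hε' : ε < 1 / 2) (j : ℕ) : 0 < rad ε j := by
  have := Lam_pos hε hε'
  unfold rad; positivity

theorem bandWidth_pos {ε : ℝ} (hε : 0 < ε) (hε' : ε < 1 / 2) (j : ℕ) : 0 < bandWidth ε j := by
  have := Lam_pos hε hε'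
  have := rad_pos hε hε' j
  unfold bandWidth; positivity

/-- Union bound over one event per round and test vector, one per round for the second pass, and one
per round, stage and test vector. The number of events is fixed although the stopping round is
random. -/
theorem measure_not_good_le {D : Measure (Sample d)} [IsProbabilityMeasure D] (hd : 1 ≤ d)
    {f : EuclideanSpace ℝ (Fin d) → ℤˣ} {η ε δ : ℝ} (hD : IsRCN D f η)
    (hε : 0 < ε) (hε' : ε < 1 / 2) (hδ : 0 < δ) (hδ' : δ < 1 / 2) (R J : ℕ) :
    Measure.infinitePi (fun _ : ℕ => D) {s | ¬ Good D ε δ R J s} ≤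
      (R * ((d + 1) + (1 + J * (d + 1))) : ℕ) * ENNReal.ofReal (2 * Real.exp (-ell d ε δ)) := by
  have hl := one_le_ell hd hε hε' hδ hδ'
  have hlen : ∀ i, (0 : ℝ) < len d ε δ i := fun i => by linarith [ell_le_len hd hl i]
  have hlen' : ∀ i, 0 < len d ε δ i := fun i => by exact_mod_cast hlen i
  have hdiv : ∀ i, ell d ε δ / len d ε δ i ≤ (1 / 8) ^ 2 * 240 := fun i => by
    rw [div_le_iff₀ (hlen i)]; linarith [ell_le_len hd hl i, hlen i]
  set q := ENNReal.ofReal (2 * Real.exp (-ell d ε δ)) with hq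
  set μ := Measure.infinitePi (fun _ : ℕ => D)
  let bad : Fin R × (Option (Fin d) ⊕ (Unit ⊕ Fin J × Option (Fin d))) → Set (ℕ → Sample d)
    | (i, Sum.inl k) => {s | ¬ |statAvg hermite 0 (testVec k) (testConst k) (offset d ε δ i)
      (len d ε δ i) s - statMean D hermite 0 (testVec k) (testConst k)| <
        Real.sqrt (960 * ell d ε δ / len d ε δ i)}
    | (i, Sum.inr (Sum.inl _)) => {s | ¬ (‖dir ε δ i s‖ = 1 → |statAvg hermite (dir ε δ i s) 0 1
      (offset d ε δ i + len d ε δ i) (len d ε δ i) s - statMean D hermite (dir ε δ i s) 0 1| <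
        Real.sqrt (960 * ell d ε δ / len d ε δ i))}
    | (i, Sum.inr (Sum.inr (j, k))) => {s | ¬ (‖(hyp ε δ i s j).1‖ = 1 →
      bandWidth ε j * (|(hyp ε δ i s j).2| + bandWidth ε j) ≤ 1 →
      ell d ε δ ≤ len d ε δ i * (bandWidth ε j * gdens (hyp ε δ i s j).2) →
      |statAvg (band (hyp ε δ i s j).2 (bandWidth ε j)) (hyp ε δ i s j).1 (testVec k) (testConst k)
        (stageOffset d ε δ i j) (len d ε δ i) s -
        statMean D (band (hyp ε δ i s j).2 (bandWidth ε j)) (hyp ε δ i s j).1 (testVec k)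
          (testConst k)| <
        Real.sqrt (5280 * (bandWidth ε j * gdens (hyp ε δ i s j).2) * ell d ε δ / len d ε δ i))}
  have hsub : {s | ¬ Good D ε δ R J s} ⊆ ⋃ x, bad x := by
    intro s hs
    by_contra hcon
    apply hs
    simp only [Set.mem_iUnion, not_exists] at hcon
    refine ⟨fun i hi k => ?_, fun i hi => ?_, fun i hi j hj k => ?_⟩
    · exact not_not.1 (hcon (⟨i, hi⟩, Sum.inl k))
    · exact not_not.1 (hcon (⟨i, hi⟩, Sum.inr (Sum.inl ())))
    · exact not_not.1 (hcon (⟨i, hi⟩, Sum.inr (Sum.inr (⟨j, hj⟩, k))))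
  have hbad : ∀ x, μ (bad x) ≤ q := by
    rintro ⟨i, k | _ | ⟨j, k⟩⟩
    · have h := adaptive_deviation (D := D) (X := Unit) (hlen' i) (g := fun _ => ())
        (o := offset d ε δ i) measurable_const (fun _ _ _ => rfl)
        (Y := fun _ z => stat hermite 0 (testVec k) (testConst k) z)
        (measurable_stat (W := fun _ => hermite) (measurable_hermite.comp measurable_snd)
          measurable_const _ _)
        MeasurableSet.univ (V := fun _ => 240) measurable_const (a := 1 / 8) (ℓ := ell d ε δ)
        (by norm_num) (by linarith)
        (fun x _ => ⟨by norm_num, (hD.stat_moment (first_moment (norm_testVec_le k)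
          (abs_testConst_le k))).1, (hD.stat_moment (first_moment (norm_testVec_le k)
          (abs_testConst_le k))).2, hdiv i⟩)
      refine (measure_mono ?_).trans h
      intro s hs
      simp only [bad, Set.mem_ofPred_eq, not_lt] at hs
      refine ⟨trivial, ?_⟩
      rw [show (4 : ℝ) * 240 = 960 by norm_num]
      exact hs
    · have h := adaptive_deviation (D := D) (hlen' i) (measurable_dir (d := d) ε δ i)
        (dependsBefore_dir ε δ i)
        (Y := fun v z => stat hermite v 0 1 z)
        (measurable_stat (W := fun _ => hermite) (measurable_hermite.comp measurable_snd)
          measurable_id _ _)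
        (valid := {v | ‖v‖ = 1}) (measurableSet_eq_fun measurable_norm measurable_const)
        (V := fun _ => 240) measurable_const (a := 1 / 8) (ℓ := ell d ε δ)
        (by norm_num) (by linarith)
        (fun v hv => ⟨by norm_num, (hD.stat_moment (second_moment hv)).1,
          (hD.stat_moment (second_moment hv)).2, hdiv i⟩)
      refine (measure_mono ?_).trans h
      intro s hs
      simp only [bad, Set.mem_ofPred_eq, Classical.not_imp, not_lt] at hs
      refine ⟨hs.1, ?_⟩
      rw [show (4 : ℝ) * 240 = 960 by norm_num]
      exact hs.2
    · have hσ := bandWidth_pos hε hε' j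
      have hgm : Measurable gdens := by unfold gdens; fun_prop
      have h := adaptive_deviation (D := D) (hlen' i) (measurable_hyp (d := d) ε δ i j)
        (dependsBefore_hyp ε δ i j)
        (Y := fun h z => stat (band h.2 (bandWidth ε j)) h.1 (testVec k) (testConst k) z)
        (measurable_stat (X := EuclideanSpace ℝ (Fin d) × ℝ)
          (W := fun h => band h.2 (bandWidth ε j))
          (measurable_band.comp ((measurable_snd.comp measurable_fst).prodMk
            (measurable_const.prodMk measurable_snd))) measurable_fst _ _)
        (valid := {h | ‖h.1‖ = 1} ∩ ({h | bandWidth ε j * (|h.2| + bandWidth ε j) ≤ 1} ∩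
          {h | ell d ε δ ≤ len d ε δ i * (bandWidth ε j * gdens h.2)}))
        ((measurableSet_eq_fun measurable_fst.norm measurable_const).inter
          ((measurableSet_le (by fun_prop) measurable_const).inter
            (measurableSet_le measurable_const (by fun_prop))))
        (V := fun h => 1320 * (bandWidth ε j * gdens h.2)) (by fun_prop) (a := 1 / 3)
        (ℓ := ell d ε δ) (by norm_num) (by linarith)
        (fun h hh => by
          obtain ⟨h1, h2, h3⟩ := hh
          have hg := gdens_pos h.2
          have hm := hD.stat_moment (integral_band_statistic_sq_le h1 (norm_testVec_le k)
            (abs_testConst_le k) hσ.le h2)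
          refine ⟨by positivity, hm.1, hm.2, ?_⟩
          rw [div_le_iff₀ (hlen i)]
          have : 0 < bandWidth ε j * gdens h.2 := by positivity
          simp only [Set.mem_ofPred_eq] at h3
          have h4 := mul_pos (hlen i) this
          nlinarith)
      refine (measure_mono ?_).trans h
      intro s hs
      simp only [bad, Set.mem_ofPred_eq, Classical.not_imp, not_lt] at hs
      refine ⟨⟨hs.1, hs.2.1, hs.2.2.1⟩, ?_⟩
      refine le_trans (le_of_eq ?_) hs.2.2.2
      congr 1; ring
  calc μ {s | ¬ Good D ε δ R J s} ≤ μ (⋃ x, bad x) := measure_mono hsub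
    _ ≤ ∑ x, μ (bad x) := measure_iUnion_fintype_le _ _
    _ ≤ ∑ _x : Fin R × (Option (Fin d) ⊕ (Unit ⊕ Fin J × Option (Fin d))), q :=
        Finset.sum_le_sum fun x _ => hbad x
    _ = _ := by simp

end GoodEvent

/-! ### Means of the statistics under random classification noise -/

section Means

variable {d : ℕ} {D : Measure (Sample d)} [IsProbabilityMeasure D] {η : ℝ}
  {w : EuclideanSpace ℝ (Fin d)} {t : ℝ}

theorem halfspace_cast (w : EuclideanSpace ℝ (Fin d)) (t : ℝ) (x : EuclideanSpace ℝ (Fin d)) :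
    ((halfspace w t x : ℤ) : ℝ) = rsgn (⟪w, x⟫ + t) := sgn_cast _

theorem halfspace_smul {a : ℝ} (ha : 0 < a) (w : EuclideanSpace ℝ (Fin d)) (t : ℝ) :
    halfspace (a • w) (a * t) = halfspace w t := by
  funext x
  unfold halfspace sgn
  have : ⟪a • w, x⟫ + a * t = a * (⟪w, x⟫ + t) := by rw [real_inner_smul_left]; ring
  rw [this]
  congr 1
  simp [ha]

theorem IsRCN.statMean_eq (hD : IsRCN D (halfspace w t) η) (h0 : 0 < η) (h1 : η < 1)
    {W : ℝ → ℝ} {v e : EuclideanSpace ℝ (Fin d)} {c : ℝ}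
    (hi : Integrable (fun x => W ⟪v, x⟫ * (⟪e, perp v x⟫ + c)) (stdGaussian _)) :
    statMean D W v e c = (1 - 2 * η) *
      ∫ x, rsgn (⟪w, x⟫ + t) * (W ⟪v, x⟫ * (⟪e, perp v x⟫ + c)) ∂(stdGaussian _) := by
  unfold statMean stat _root_.label
  rw [hD.integral_label_mul (measurable_halfspace w t) h0 h1 hi]
  simp_rw [halfspace_cast]

/-- The average of a halfspace under the Gaussian. -/
def meanSign (w : EuclideanSpace ℝ (Fin d)) (t : ℝ) : ℝ :=
  ∫ x, rsgn (⟪w, x⟫ + t) ∂(stdGaussian (EuclideanSpace ℝ (Fin d)))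

theorem integrable_rsgn (w : EuclideanSpace ℝ (Fin d)) (t : ℝ) :
    Integrable (fun x => rsgn (⟪w, x⟫ + t)) (stdGaussian (EuclideanSpace ℝ (Fin d))) :=
  (integrable_const (1 : ℝ)).mono' (measurable_rsgn.comp (by fun_prop)).aestronglyMeasurable
    (ae_of_all _ fun _ => (abs_rsgn _).le)

theorem integrable_first (e : EuclideanSpace ℝ (Fin d)) (c : ℝ) :
    Integrable (fun x => hermite ⟪0, x⟫ * (⟪e, perp 0 x⟫ + c))
      (stdGaussian (EuclideanSpace ℝ (Fin d))) := by
  simp only [perp_zero_left]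
  have := ((integrable_inner e).add (integrable_const c)).const_mul (-1 : ℝ)
  simpa [hermite] using this

theorem statMean_first_aux (hD : IsRCN D (halfspace w t) η) (h0 : 0 < η) (h1 : η < 1)
    (e : EuclideanSpace ℝ (Fin d)) (c : ℝ) :
    statMean D hermite 0 e c = -((1 - 2 * η) *
      (∫ x, rsgn (⟪w, x⟫ + t) * ⟪e, x⟫ ∂(stdGaussian _) + c * meanSign w t)) := by
  rw [hD.statMean_eq h0 h1 (integrable_first e c), ← mul_neg]
  congr 1
  have : ∀ x, rsgn (⟪w, x⟫ + t) * (hermite ⟪(0 : EuclideanSpace ℝ (Fin d)), x⟫ *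
      (⟪e, perp 0 x⟫ + c)) = -(rsgn (⟪w, x⟫ + t) * ⟪e, x⟫ + c * rsgn (⟪w, x⟫ + t)) := by
    intro x
    simp [perp_zero_left, hermite]; ring
  simp_rw [this]
  rw [integral_neg, integral_add (Integrable.rsgn_mul (integrable_inner e) (by fun_prop))
    ((integrable_rsgn w t).const_mul c), integral_const_mul, meanSign]

theorem statMean_first (hw : ‖w‖ = 1) (hD : IsRCN D (halfspace w t) η) (h0 : 0 < η) (h1 : η < 1)
    (e : EuclideanSpace ℝ (Fin d)) (c : ℝ) :
    statMean D hermite 0 e c = -(⟪e, (2 * (1 - 2 * η) * gdens t) • w⟫ +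
      c * ((1 - 2 * η) * meanSign w t)) := by
  rw [statMean_first_aux hD h0 h1, integral_halfspace_mul_inner hw, real_inner_smul_right]; ring

/-- A constant target cannot be normalized; it corresponds to a vanishing Chow vector and is treated
separately. -/
theorem statMean_first_zero (hD : IsRCN D (halfspace 0 t) η) (h0 : 0 < η) (h1 : η < 1)
    (e : EuclideanSpace ℝ (Fin d)) (c : ℝ) :
    statMean D hermite 0 e c = -(⟪e, (0 : EuclideanSpace ℝ (Fin d))⟫ +
      c * ((1 - 2 * η) * meanSign (0 : EuclideanSpace ℝ (Fin d)) t)) := by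
  rw [statMean_first_aux hD h0 h1]
  simp only [inner_zero_left, zero_add, integral_const_mul, integral_inner_stdGaussian,
    inner_zero_right]
  ring

theorem statMean_second (hw : ‖w‖ = 1) (hD : IsRCN D (halfspace w t) η) (h0 : 0 < η) (h1 : η < 1)
    {v : EuclideanSpace ℝ (Fin d)} (hv : ‖v‖ = 1) :
    statMean D hermite v 0 1 = (1 - 2 * η) * (-2 * t * gdens t * ⟪v, w⟫ ^ 2) := by
  rw [hD.statMean_eq h0 h1]
  · simp only [inner_zero_left, zero_add, mul_one, hermite]
    rw [integral_halfspace_mul_sq hw hv]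
  · simp only [inner_zero_left, zero_add, mul_one, hermite]
    simp_rw [sq]
    exact (integrable_inner_mul v v).sub (integrable_const 1)

theorem rsgn_mul {a : ℝ} (ha : 0 < a) (u : ℝ) : rsgn (a * u) = rsgn u := by
  unfold rsgn; simp [ha]

theorem norm_le_of_inner_le {a : EuclideanSpace ℝ (Fin d)} {r : ℝ} (hr : 0 ≤ r)
    (h : ∀ e : EuclideanSpace ℝ (Fin d), ‖e‖ ≤ 1 → |⟪e, a⟫| ≤ r) : ‖a‖ ≤ r := by
  rcases eq_or_ne a 0 with rfl | ha
  · simpa using hr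
  · have hna : 0 < ‖a‖ := norm_pos_iff.2 ha
    have := h (‖a‖⁻¹ • a) (by rw [norm_smul, norm_inv, norm_norm, inv_mul_cancel₀ hna.ne'])
    rw [real_inner_smul_left, real_inner_self_eq_norm_sq, sq, ← mul_assoc,
      inv_mul_cancel₀ hna.ne', one_mul, abs_of_pos hna] at this
    exact this

/-- The mean of the band statistics, relative to the hyperplane `⟪v, x⟫ + ⟪a, x⟫ + B = 0`. -/
theorem exists_statMean_stage {v a : EuclideanSpace ℝ (Fin d)} {c s σ R : ℝ} (hv : ‖v‖ = 1)
    (hc : 0 < c) (hwa : w = c • (v + a)) (ha : ⟪v, a⟫ = 0)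
    (hD : IsRCN D (halfspace w t) η) (h0 : 0 < η) (h1 : η < 1)
    (hσ : 0 < σ) (hsσ : σ * (|s| + σ) ≤ 1) (hR : 0 < R) (haR : ‖a‖ ≤ R) (hbR : |t / c - s| ≤ R) :
    ∃ (I : EuclideanSpace ℝ (Fin d)) (I₀ : ℝ),
      (∀ e c₀, statMean D (band s σ) v e c₀ =
        2 * (1 - 2 * η) * gdens s * (⟪e, I⟫ + c₀ * I₀)) ∧
      ‖I - a‖ ≤ 220 * R ^ 3 / σ ^ 2 ∧ |I₀ - (t / c - s)| ≤ 220 * R ^ 3 / σ ^ 2 := by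
  set b := t / c - s with hb
  set g : EuclideanSpace ℝ (Fin d) → ℝ := fun x => clip σ (⟪a, x⟫ + b) with hg
  have hgm : Measurable g := (measurable_clip σ).comp (by fun_prop)
  have hgi : Integrable (fun x => g x • perp v x) (stdGaussian (EuclideanSpace ℝ (Fin d))) := by
    have hi : Integrable (fun x => σ * ‖x‖) (stdGaussian (EuclideanSpace ℝ (Fin d))) :=
      IsGaussian.integrable_id.norm.const_mul σ
    refine hi.mono' (hgm.smul (measurable_perp v)).aestronglyMeasurable (ae_of_all _ fun x => ?_)
    rw [norm_smul, Real.norm_eq_abs]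
    have h2 := abs_clip_le hσ.le (⟪a, x⟫ + b)
    have h3 := norm_perp_le hv.le x
    exact mul_le_mul h2 h3 (norm_nonneg _) hσ.le
  have hgi0 : Integrable g (stdGaussian (EuclideanSpace ℝ (Fin d))) :=
    (integrable_const σ).mono' hgm.aestronglyMeasurable
      (ae_of_all _ fun x => abs_clip_le hσ.le (⟪a, x⟫ + b))
  -- One vector and one scalar represent the means of all test functionals at once, so the
  -- truncation bias is bounded in norm without a factor `√d`.
  set I := ∫ x, g x • perp v x ∂(stdGaussian (EuclideanSpace ℝ (Fin d))) with hI
  set I₀ := ∫ x, g x ∂(stdGaussian (EuclideanSpace ℝ (Fin d))) with hI0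
  have hint : ∀ (e : EuclideanSpace ℝ (Fin d)) (c₀ : ℝ),
      ∫ x, g x * (⟪e, perp v x⟫ + c₀) ∂(stdGaussian _) = ⟪e, I⟫ + c₀ * I₀ := by
    intro e c₀
    rw [hI, ← integral_inner hgi, hI0, ← integral_const_mul, ← integral_add]
    · refine integral_congr_ae (ae_of_all _ fun x => ?_)
      simp only [real_inner_smul_right]; ring
    · exact hgi.const_inner e
    · exact hgi0.const_mul _
  have hbias : ∀ (e : EuclideanSpace ℝ (Fin d)) (c₀ : ℝ), ‖e‖ ≤ 1 → |c₀| ≤ 1 →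
      |⟪e, I⟫ + c₀ * I₀ - (⟪a, e⟫ + b * c₀)| ≤ 220 * R ^ 3 / σ ^ 2 := by
    intro e c₀ he hc₀
    rw [← hint]
    exact abs_integral_clip_sub_le hv ha hR haR hbR he hc₀ hσ
  refine ⟨I, I₀, fun e c₀ => ?_, ?_, ?_⟩
  · rw [hD.statMean_eq h0 h1 (integrable_band_mul hsσ (integrable_affine_perp c₀)), ← hint]
    have hr : ∀ x, rsgn (⟪w, x⟫ + t) = rsgn (⟪v, x⟫ + ⟪a, x⟫ + t / c) := by
      intro x
      rw [← rsgn_mul hc (⟪v, x⟫ + ⟪a, x⟫ + t / c), hwa, real_inner_smul_left, inner_add_left]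
      congr 1; field_simp
    simp_rw [hr]
    rw [integral_halfspace_mul_band hv ha hσ.le hsσ]
    simp only [hg, hb]; ring
  · refine norm_le_of_inner_le (by positivity) fun e he => ?_
    have := hbias e 0 he (by simp)
    rw [inner_sub_right]
    simpa [real_inner_comm] using this
  · have := hbias 0 1 (by simp) (by simp)
    simpa using this

/-- Only the coordinate directions are tested, to keep the union bound finite. The resulting loss of
`√d` is why block lengths are proportional to `d`. -/
theorem norm_sub_le_of_test {a A : EuclideanSpace ℝ (Fin d)} {b B r : ℝ} (hr : 0 ≤ r)
    (h : ∀ k, |⟪testVec k, a⟫ + testConst k * b - (⟪testVec k, A⟫ + testConst k * B)| < r) :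
    ‖a - A‖ ≤ Real.sqrt d * r ∧ |b - B| ≤ r := by
  constructor
  · rw [EuclideanSpace.norm_eq]
    have h1 : ∀ j : Fin d, ‖(a - A) j‖ ^ 2 ≤ r ^ 2 := by
      intro j
      have := h (some j)
      simp only [testVec, testConst, EuclideanSpace.inner_single_left] at this
      rw [Real.norm_eq_abs]
      have h2 : |(a - A) j| ≤ r := by simpa using this.le
      gcongr
    calc Real.sqrt (∑ j, ‖(a - A) j‖ ^ 2) ≤ Real.sqrt (∑ _j : Fin d, r ^ 2) := by
          apply Real.sqrt_le_sqrt; exact Finset.sum_le_sum fun j _ => h1 j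
      _ = _ := by
          simp [Real.sqrt_sq hr]
  · have := h none
    simpa [testVec, testConst] using this.le

end Means

/-! ### Geometry of the refinement steps -/

section Geometry

variable {E : Type*} [NormedAddCommGroup E] [InnerProductSpace ℝ E]

theorem inner_eq_of_unit {v w : E} (hv : ‖v‖ = 1) (hw : ‖w‖ = 1) :
    ⟪v, w⟫ = 1 - ‖v - w‖ ^ 2 / 2 := by
  have := norm_sub_sq_real v w
  rw [hv, hw] at this; linarith

/-- The orthogonal offset that turns `v` into a multiple of `w`. -/
def tilt (v w : E) : E := ⟪v, w⟫⁻¹ • w - v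

theorem inner_tilt {v w : E} (hv : ‖v‖ = 1) (hc : ⟪v, w⟫ ≠ 0) : ⟪v, tilt v w⟫ = 0 := by
  rw [tilt, inner_sub_right, real_inner_smul_right, inv_mul_cancel₀ hc,
    real_inner_self_eq_norm_sq, hv]; norm_num

theorem add_tilt (v w : E) : v + tilt v w = ⟪v, w⟫⁻¹ • w := by simp [tilt]

theorem inner_smul_add_tilt {v w : E} (hc : ⟪v, w⟫ ≠ 0) : w = ⟪v, w⟫ • (v + tilt v w) := by
  rw [add_tilt, smul_smul, mul_inv_cancel₀ hc, one_smul]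

theorem half_lt_inner {v w : E} (hv : ‖v‖ = 1) (hw : ‖w‖ = 1) {ρ : ℝ} (hρ : ρ ≤ 1 / 10)
    (h : ‖v - w‖ ≤ ρ) : 1 - ρ ^ 2 / 2 ≤ ⟪v, w⟫ ∧ 1 / 2 < ⟪v, w⟫ ∧ ⟪v, w⟫ ≤ 1 := by
  rw [inner_eq_of_unit hv hw]
  have h0 := norm_nonneg (v - w)
  refine ⟨by nlinarith, by nlinarith, by nlinarith⟩

/-- The norm is the tangent of the angle between `v` and `w`: its square is `⟪v,w⟫⁻² - 1`. -/
theorem norm_tilt_le {v w : E} (hv : ‖v‖ = 1) (hw : ‖w‖ = 1) {ρ : ℝ} (hρ : ρ ≤ 1 / 10)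
    (h : ‖v - w‖ ≤ ρ) : ‖tilt v w‖ ≤ 2 * ρ := by
  obtain ⟨h1, h2, h3⟩ := half_lt_inner hv hw hρ h
  have hρ0 : 0 ≤ ρ := (norm_nonneg _).trans h
  set c := ⟪v, w⟫ with hc
  have hsq : ‖tilt v w‖ ^ 2 = c⁻¹ ^ 2 - 1 := by
    rw [tilt, norm_sub_sq_real, norm_smul, mul_pow, real_inner_smul_left, real_inner_comm v w, hv, hw,
      Real.norm_eq_abs, sq_abs, ← hc, inv_mul_cancel₀ (by linarith)]
    ring
  have hle : c⁻¹ ^ 2 - 1 ≤ (2 * ρ) ^ 2 := by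
    rw [inv_pow, sub_le_iff_le_add, inv_le_iff_one_le_mul₀ (by positivity)]
    have h4 : 1 - ρ ^ 2 ≤ c ^ 2 := by nlinarith
    have h5 : ρ ^ 2 ≤ 1 / 100 := by nlinarith
    have : (1 - ρ ^ 2) * ((2 * ρ) ^ 2 + 1) ≤ c ^ 2 * ((2 * ρ) ^ 2 + 1) := by gcongr
    nlinarith [sq_nonneg ρ]
  exact le_of_sq_le_sq (hsq.trans_le hle) (by positivity)

/-- Rescaling the threshold by the inverse cosine changes it by at most `|t| ρ²`, which is of lower
order because `Λρ ≤ 1/10`. -/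
theorem abs_div_sub_le {c s t ρ Λ : ℝ} (h1 : 1 - ρ ^ 2 / 2 ≤ c) (h2 : 1 / 2 < c) (h3 : c ≤ 1)
    (hρ0 : 0 ≤ ρ) (hst : |s - t| ≤ ρ) (hΛ : |t| + 1 ≤ Λ) (hΛρ : Λ * ρ ≤ 1 / 10) :
    |t / c - s| ≤ 2 * ρ := by
  have e : t / c - s = -(s - t) + t * ((1 - c) / c) := by field_simp; ring
  have h4 : (1 - c) / c ≤ ρ ^ 2 := by
    rw [div_le_iff₀ (by linarith)]; nlinarith [sq_nonneg ρ]
  have h5 : 0 ≤ (1 - c) / c := div_nonneg (by linarith) (by linarith)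
  rw [e]
  have h6 : |t| ≤ Λ := by linarith
  have h7 : 0 ≤ Λ := (abs_nonneg t).trans h6
  calc |-(s - t) + t * ((1 - c) / c)| ≤ |-(s - t)| + |t * ((1 - c) / c)| := abs_add_le _ _
    _ = |s - t| + |t| * ((1 - c) / c) := by rw [abs_neg, abs_mul, abs_of_nonneg h5]
    _ ≤ ρ + Λ * ρ ^ 2 := by gcongr
    _ ≤ 2 * ρ := by nlinarith

/-- One refinement step halves the error. -/
theorem refine_step {v w a : E} {s t b ρ Λ : ℝ} (hv : ‖v‖ = 1) (hw : ‖w‖ = 1)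
    (hvw : ‖v - w‖ ≤ ρ) (hρ : 0 < ρ) (hΛ : |t| + 1 ≤ Λ) (hΛρ : Λ * ρ ≤ 1 / 10)
    (ha : ‖a - tilt v w‖ ≤ 0.03 * ρ / Λ) (hb : |b - (t / ⟪v, w⟫ - s)| ≤ 0.03 * ρ / Λ) :
    ‖(‖v + a‖⁻¹ • (v + a))‖ = 1 ∧ ‖(‖v + a‖⁻¹ • (v + a)) - w‖ ≤ ρ / 2 ∧
      |(s + b) / ‖v + a‖ - t| ≤ ρ / 2 := by
  have hΛ1 : 1 ≤ Λ := by linarith [abs_nonneg t]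
  have hρ1 : ρ ≤ 1 / 10 := by nlinarith
  obtain ⟨h1, h2, h3⟩ := half_lt_inner hv hw hρ1 hvw
  set c := ⟪v, w⟫ with hc
  -- The corrected vector lies within `τ` of `c⁻¹ • w`. Normalizing it also removes `c⁻¹` from the
  -- threshold, but multiplies the error of the norm by `|t|`; the division by `Λ` in `τ` absorbs
  -- this.
  set τ := 0.03 * ρ / Λ with hτ
  have hτ0 : 0 < τ := by positivity
  have hτΛ : τ * Λ = 0.03 * ρ := by rw [hτ]; field_simp
  have hτle : τ ≤ 0.03 * ρ := by nlinarith
  set x := v + a with hx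
  have hxy : ‖x - c⁻¹ • w‖ ≤ τ := by
    have : x - c⁻¹ • w = a - tilt v w := by rw [hx, tilt]; abel
    rw [this]; exact ha
  have hyn : ‖c⁻¹ • w‖ = c⁻¹ := by
    rw [norm_smul, hw, mul_one, Real.norm_eq_abs, abs_of_pos (by positivity)]
  have hc1 : 1 ≤ c⁻¹ := by rw [one_le_inv₀ (by linarith)]; exact h3
  have hxd : |‖x‖ - c⁻¹| ≤ τ := by rw [← hyn]; exact (abs_norm_sub_norm_le _ _).trans hxy
  have hxl : 0.97 ≤ ‖x‖ := by have := (abs_le.1 hxd).1; nlinarith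
  have hx0 : 0 < ‖x‖ := by linarith
  have h4 : |1 - c * ‖x‖| ≤ c * τ := by
    have : 1 - c * ‖x‖ = -(c * (‖x‖ - c⁻¹)) := by field_simp; ring
    rw [this, abs_neg, abs_mul, abs_of_pos (by linarith : 0 < c)]; gcongr
  refine ⟨?_, ?_, ?_⟩
  · rw [norm_smul, norm_inv, norm_norm, inv_mul_cancel₀ hx0.ne']
  · have e : ‖x‖⁻¹ • x - w = c • (x - c⁻¹ • w) + (‖x‖⁻¹ * (1 - c * ‖x‖)) • x := by
      have h5 : ‖x‖⁻¹ * (1 - c * ‖x‖) = ‖x‖⁻¹ - c := by field_simp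
      rw [h5, smul_sub, smul_smul, mul_inv_cancel₀ (by linarith), one_smul, sub_smul]; abel
    rw [e]
    refine (norm_add_le _ _).trans ?_
    rw [norm_smul, norm_smul, Real.norm_eq_abs, Real.norm_eq_abs, abs_of_pos (by linarith : 0 < c),
      abs_mul, abs_of_pos (inv_pos.2 hx0), mul_comm ‖x‖⁻¹, mul_assoc, inv_mul_cancel₀ hx0.ne',
      mul_one]
    have h6 : c * ‖x - c⁻¹ • w‖ ≤ c * τ := by gcongr
    nlinarith
  · have e : (s + b) / ‖x‖ - t = ((b - (t / c - s)) + t * (c⁻¹ * (1 - c * ‖x‖))) / ‖x‖ := by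
      have : c ≠ 0 := by linarith
      field_simp; ring
    rw [e, abs_div, abs_of_pos hx0, div_le_iff₀ hx0]
    have h5 : |c⁻¹ * (1 - c * ‖x‖)| ≤ τ := by
      rw [abs_mul, abs_of_pos (by positivity), inv_mul_le_iff₀ (by linarith)]; exact h4
    calc _ ≤ |b - (t / c - s)| + |t * (c⁻¹ * (1 - c * ‖x‖))| := abs_add_le _ _
      _ ≤ τ + |t| * τ := by rw [abs_mul]; gcongr
      _ = (|t| + 1) * τ := by ring
      _ ≤ Λ * τ := by gcongr
      _ ≤ _ := by nlinarith

/-- The first two passes give a rough hypothesis. -/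
theorem initial_hypothesis {u w : E} {G t T κ Λ : ℝ} (hw : ‖w‖ = 1) (hu : 0 < ‖u‖)
    (hκ : 0 < κ) (hκ' : κ ≤ 1 / 100) (hΛ : |t| + 1 ≤ Λ) (h : ‖u - G • w‖ ≤ κ * ‖u‖)
    (hG : 0 ≤ G) (hT : |T + t * G * ⟪‖u‖⁻¹ • u, w⟫ ^ 2| ≤ κ * ‖u‖) :
    |G - ‖u‖| ≤ κ * ‖u‖ ∧ ‖(‖u‖⁻¹ • u) - w‖ ≤ 2 * κ ∧ |-T / ‖u‖ - t| ≤ 5 * κ * Λ := by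
  set m := ‖u‖ with hm
  have hGm : |G - m| ≤ κ * m := by
    have : ‖G • w‖ = G := by rw [norm_smul, hw, mul_one, Real.norm_eq_abs, abs_of_nonneg hG]
    rw [← this, hm, abs_sub_comm]; exact (abs_norm_sub_norm_le _ _).trans h
  have hv1 : ‖m⁻¹ • u‖ = 1 := by
    rw [norm_smul, norm_inv, Real.norm_eq_abs, abs_of_pos hu, ← hm, inv_mul_cancel₀ hu.ne']
  have hG2 : |G / m - 1| ≤ κ := by
    have : G / m - 1 = (G - m) / m := by field_simp
    rw [this, abs_div, abs_of_pos hu, div_le_iff₀ hu]; exact hGm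
  have hvw : ‖m⁻¹ • u - w‖ ≤ 2 * κ := by
    have e : m⁻¹ • u - w = m⁻¹ • (u - G • w) + (G / m - 1) • w := by
      rw [smul_sub, smul_smul, sub_smul, one_smul, div_eq_inv_mul]; abel
    rw [e]
    refine (norm_add_le _ _).trans ?_
    rw [norm_smul, norm_smul, hw, mul_one, Real.norm_eq_abs, Real.norm_eq_abs,
      abs_of_pos (inv_pos.2 hu)]
    have : m⁻¹ * ‖u - G • w‖ ≤ κ := by
      rw [inv_mul_le_iff₀ hu]; linarith
    linarith
  refine ⟨hGm, hvw, ?_⟩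
  have hc := inner_eq_of_unit hv1 hw
  set c := ⟪m⁻¹ • u, w⟫ with hcdef
  have hn0 := norm_nonneg (m⁻¹ • u - w)
  have hc1 : c ≤ 1 := by nlinarith
  have hc2 : 1 - 2 * κ ^ 2 ≤ c := by nlinarith
  have hc0 : 0 ≤ c := by nlinarith
  -- The direction error enters `c` only quadratically, so the relative error of the scale
  -- dominates.
  have hcc : |G / m * c ^ 2 - 1| ≤ 2 * κ := by
    rw [abs_le] at hG2 ⊢
    have h5 : c ^ 2 ≤ 1 := by nlinarith
    have h6 : 1 - 4 * κ ^ 2 ≤ c ^ 2 := by nlinarith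
    have h7 : 0 ≤ G / m := by positivity
    constructor
    · have : (1 - κ) * (1 - 4 * κ ^ 2) ≤ G / m * c ^ 2 := by
        apply mul_le_mul (by linarith) h6 (by nlinarith) h7
      nlinarith [sq_nonneg κ]
    · nlinarith
  have e : -T / m - t = -(T + t * G * c ^ 2) / m + t * (G / m * c ^ 2 - 1) := by
    field_simp; ring
  rw [e]
  calc _ ≤ |-(T + t * G * c ^ 2) / m| + |t * (G / m * c ^ 2 - 1)| := abs_add_le _ _
    _ ≤ κ + |t| * (2 * κ) := by
        rw [abs_div, abs_neg, abs_of_pos hu, abs_mul]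
        gcongr
        rw [div_le_iff₀ hu]; exact hT
    _ ≤ _ := by nlinarith [abs_nonneg t]

/-- Ratio of the densities at nearby points. -/
theorem gdens_ratio {s t Λ ρ : ℝ} (hs : |s| ≤ Λ) (ht : |t| ≤ Λ) (hst : |s - t| ≤ ρ)
    (hρ : Λ * ρ ≤ 1) : |gdens s / gdens t - 1| ≤ 2 * (Λ * ρ) := by
  have h1 : gdens s / gdens t = Real.exp ((t ^ 2 - s ^ 2) / 2) := by
    rw [div_eq_iff (gdens_pos t).ne', mul_comm, gdens_mul_exp]
  have h2 : |(t ^ 2 - s ^ 2) / 2| ≤ Λ * ρ := by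
    have : (t ^ 2 - s ^ 2) / 2 = -((s - t) * ((s + t) / 2)) := by ring
    rw [this, abs_neg, abs_mul, mul_comm]
    have h3 : |(s + t) / 2| ≤ Λ := by
      rw [abs_div, abs_two, div_le_iff₀ (by norm_num)]
      linarith [abs_add_le s t]
    have := (abs_nonneg _).trans h3
    gcongr
  rw [h1]
  exact (Real.abs_exp_sub_one_le (h2.trans hρ)).trans (by linarith)

/-- The rescaled band statistics estimate the tilt and the offset. -/
theorem estimate_error {I A a : E} {I₀ b₀ b m L ρ Λ : ℝ} (hm : 0 < m) (hΛ : 4 ≤ Λ) (hρ : 0 < ρ)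
    (hL : |L / m - 1| ≤ 0.002 / Λ)
    (hA : ‖A‖ ≤ 2 * ρ) (hb₀ : |b₀| ≤ 2 * ρ) (hI : ‖I - A‖ ≤ 0.005 * ρ / Λ)
    (hI₀ : |I₀ - b₀| ≤ 0.005 * ρ / Λ) (ha : ‖a - L • I‖ ≤ 0.01 * ρ / Λ * m)
    (hb : |b - L * I₀| ≤ 0.01 * ρ / Λ * m) :
    ‖m⁻¹ • a - A‖ ≤ 0.03 * ρ / Λ ∧ |m⁻¹ * b - b₀| ≤ 0.03 * ρ / Λ := by
  have hL1 : |L / m| ≤ 1.1 := by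
    have h2 : 0.002 / Λ ≤ 0.1 := by rw [div_le_iff₀ (by linarith)]; linarith
    have := (abs_le.1 hL); rw [abs_le]; constructor <;> linarith
  have hρΛ : 0 < ρ / Λ := by positivity
  have e3 : ∀ x : ℝ, x * ρ / Λ = x * (ρ / Λ) := fun x => by ring
  have h22 : 0.002 / Λ * (2 * ρ) = 0.004 * (ρ / Λ) := by ring
  constructor
  -- Three sources of error: sampling noise, truncation bias, and the mismatch between the scale `L`
  -- of the band statistics and the divisor `m`.
  · have e : m⁻¹ • a - A = m⁻¹ • (a - L • I) + ((L / m) • (I - A) + (L / m - 1) • A) := by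
      rw [smul_sub, smul_smul, sub_smul, one_smul, smul_sub, div_eq_inv_mul]; abel
    rw [e]
    calc _ ≤ ‖m⁻¹ • (a - L • I)‖ + (‖(L / m) • (I - A)‖ + ‖(L / m - 1) • A‖) :=
          (norm_add_le _ _).trans (by gcongr; exact norm_add_le _ _)
      _ ≤ 0.01 * ρ / Λ + (1.1 * (0.005 * ρ / Λ) + 0.002 / Λ * (2 * ρ)) := by
          rw [norm_smul, norm_smul, norm_smul, Real.norm_eq_abs, Real.norm_eq_abs,
            Real.norm_eq_abs, abs_of_pos (inv_pos.2 hm)]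
          gcongr
          rw [inv_mul_le_iff₀ hm]; linarith
      _ ≤ _ := by rw [e3, e3, e3, h22]; linarith
  · have e : m⁻¹ * b - b₀ = m⁻¹ * (b - L * I₀) + ((L / m) * (I₀ - b₀) + (L / m - 1) * b₀) := by
      rw [div_eq_inv_mul]; ring
    rw [e]
    calc _ ≤ |m⁻¹ * (b - L * I₀)| + (|(L / m) * (I₀ - b₀)| + |(L / m - 1) * b₀|) :=
          (abs_add_le _ _).trans (by gcongr; exact abs_add_le _ _)
      _ ≤ 0.01 * ρ / Λ + (1.1 * (0.005 * ρ / Λ) + 0.002 / Λ * (2 * ρ)) := by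
          rw [abs_mul, abs_mul, abs_mul, abs_of_pos (inv_pos.2 hm)]
          gcongr
          rw [inv_mul_le_iff₀ hm]; linarith
      _ ≤ _ := by rw [e3, e3, e3, h22]; linarith

end Geometry

/-! ### Accuracy of the learner on the good event -/

section Accuracy

variable {d : ℕ} {D : Measure (Sample d)} [IsProbabilityMeasure D] {η ε δ : ℝ} {R J i : ℕ}
  {s : ℕ → Sample d} {w : EuclideanSpace ℝ (Fin d)} {t : ℝ}

theorem nomLen_le_len (d : ℕ) (ε δ : ℝ) (i : ℕ) : nomLen d ε δ i ≤ len d ε δ i := Nat.le_ceil _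

theorem one_le_nomLen (hd : 1 ≤ d) (hl : 1 ≤ ell d ε δ) (i : ℕ) : 1 ≤ nomLen d ε δ i := by
  unfold nomLen
  have hd' : (1 : ℝ) ≤ d := by exact_mod_cast hd
  have h2 : (1 : ℝ) ≤ 2 ^ i := one_le_pow₀ (by norm_num)
  exact one_le_mul_of_one_le_of_one_le (one_le_mul_of_one_le_of_one_le hd' hl) h2

theorem len_le (hd : 1 ≤ d) (hl : 1 ≤ ell d ε δ) (i : ℕ) :
    (len d ε δ i : ℝ) ≤ 2 * nomLen d ε δ i := by
  have h := one_le_nomLen hd hl i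
  have := Nat.ceil_lt_add_one (show 0 ≤ nomLen d ε δ i by linarith)
  unfold len; linarith

/-- The accuracy of the first two passes of round `i`. -/
def firstErr (i : ℕ) : ℝ := Real.sqrt (960 / 2 ^ i)

/-- The block length `dℓ2^i` is designed so that dimension and confidence cancel, leaving an
accuracy that depends on the round only. -/
theorem sqrt_mul_sqrt_le_firstErr (hd : 1 ≤ d) (hl : 1 ≤ ell d ε δ) (i : ℕ) :
    Real.sqrt d * Real.sqrt (960 * ell d ε δ / len d ε δ i) ≤ firstErr i := by
  rw [← Real.sqrt_mul (by positivity)]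
  apply Real.sqrt_le_sqrt
  have h1 := one_le_nomLen hd hl i
  have h2 := nomLen_le_len d ε δ i
  have h3 : (0 : ℝ) < len d ε δ i := by linarith
  rw [← mul_div_assoc, div_le_div_iff₀ h3 (by positivity)]
  unfold nomLen at h2; nlinarith

theorem Good.first_bounds (hg : Good D ε δ R J s) (hd : 1 ≤ d) (hl : 1 ≤ ell d ε δ) (hi : i < R)
    {g : EuclideanSpace ℝ (Fin d)} {M : ℝ}
    (hmean : ∀ e c, statMean D hermite 0 e c = -(⟪e, g⟫ + c * M)) :
    ‖chow ε δ i s - g‖ ≤ firstErr i ∧ |chowZero ε δ i s - M| ≤ firstErr i := by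
  have hle := sqrt_mul_sqrt_le_firstErr (ε := ε) (δ := δ) hd hl i
  have h := norm_sub_le_of_test (a := chow ε δ i s) (A := g) (b := chowZero ε δ i s) (B := M)
    (Real.sqrt_nonneg (960 * ell d ε δ / len d ε δ i)) (fun k => by
      have := hg.first i hi k
      rw [statAvg, average_stat, hmean] at this
      rw [← abs_neg]
      convert this using 2
      simp only [chow, chowZero, inner_neg_right]
      ring)
  refine ⟨h.1.trans hle, h.2.trans (le_trans ?_ hle)⟩
  refine le_mul_of_one_le_left (Real.sqrt_nonneg _) ?_
  rw [Real.one_le_sqrt]; exact_mod_cast hd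

theorem Good.second_bound (hg : Good D ε δ R J s) (hd : 1 ≤ d) (hl : 1 ≤ ell d ε δ) (hi : i < R)
    (hw : ‖w‖ = 1) (hD : IsRCN D (halfspace w t) η) (h0 : 0 < η) (h1 : η < 1)
    (hv : ‖dir ε δ i s‖ = 1) :
    |hermiteAvg ε δ i s + t * (2 * (1 - 2 * η) * gdens t) * ⟪dir ε δ i s, w⟫ ^ 2| ≤
      firstErr i := by
  have hle := sqrt_mul_sqrt_le_firstErr (ε := ε) (δ := δ) hd hl i
  have h := hg.second i hi hv
  rw [statAvg, average_stat, statMean_second hw hD h0 h1 hv] at h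
  refine le_trans (le_of_eq ?_) (h.le.trans (le_trans ?_ hle))
  · simp only [hermiteAvg, inner_zero_left]; congr 1; ring
  refine le_mul_of_one_le_left (Real.sqrt_nonneg _) ?_
  rw [Real.one_le_sqrt]; exact_mod_cast hd

theorem sqrt_two_pi_bounds : 2.5 < Real.sqrt (2 * Real.pi) ∧ Real.sqrt (2 * Real.pi) < 2.51 := by
  have h1 := Real.pi_gt_d2
  have h2 := Real.pi_lt_d2
  constructor
  · apply Real.lt_sqrt_of_sq_lt; norm_num; linarith
  · rw [Real.sqrt_lt' (by norm_num)]; norm_num; linarith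

theorem gdens_bounds (t : ℝ) : 0.398 * Real.exp (-t ^ 2 / 2) ≤ gdens t ∧
    gdens t ≤ 0.4 * Real.exp (-t ^ 2 / 2) := by
  obtain ⟨h1, h2⟩ := sqrt_two_pi_bounds
  have he := Real.exp_pos (-t ^ 2 / 2)
  unfold gdens
  rw [le_div_iff₀ (by linarith), div_le_iff₀ (by linarith)]
  constructor <;> nlinarith

/-- The hypothesis gives `t²/2 ≤ 4 + log(1/ε)`. So a signal of size ε already forces the unknown
threshold to be logarithmic, and this is the role of `Lam`. -/
theorem abs_add_one_le_Lam (hε : 0 < ε) (hε' : ε < 1 / 2) (h : 0.02 * ε ≤ gdens t) :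
    |t| + 1 ≤ Lam ε := by
  have h1 := (gdens_bounds t).2
  have h2 : Real.log (0.05 * ε) ≤ -t ^ 2 / 2 := by
    rw [Real.log_le_iff_le_exp (by positivity)]; linarith
  have h3 : Real.log (0.05 * ε) = Real.log 0.05 - Real.log (1 / ε) := by
    rw [Real.log_mul (by norm_num) hε.ne', one_div, Real.log_inv]; ring
  have h4 : -4 ≤ Real.log 0.05 := by
    rw [Real.le_log_iff_exp_le (by norm_num), Real.exp_neg, inv_le_comm₀ (Real.exp_pos _)
      (by norm_num)]
    have : Real.exp 4 = Real.exp 1 ^ 4 := by rw [← Real.exp_nat_mul]; norm_num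
    rw [this]
    calc (0.05 : ℝ)⁻¹ ≤ 2.7 ^ 4 := by norm_num
      _ ≤ _ := by gcongr; linarith [Real.exp_one_gt_d9]
  have h5 : 0 ≤ Real.log (1 / ε) := Real.log_nonneg (by rw [le_div_iff₀ hε]; linarith)
  unfold Lam
  set x := Real.log (1 / ε)
  have h6 : |t| ≤ 3 + 4 * x := abs_le_of_sq_le_sq (by nlinarith) (by linarith)
  linarith

/-- What the first two passes provide. -/
structure Rough (ε η t : ℝ) (w : EuclideanSpace ℝ (Fin d)) (m : ℝ)
    (h : EuclideanSpace ℝ (Fin d) × ℝ) : Prop where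
  target : |t| + 1 ≤ Lam ε
  scale : |2 * (1 - 2 * η) * gdens t - m| ≤ 1 / (6000 * Lam ε ^ 3) * m
  unit : ‖h.1‖ = 1
  vec : ‖h.1 - w‖ ≤ rad ε 0
  thr : |h.2 - t| ≤ rad ε 0

/-- A Chow norm of at least `ε/20` bounds `φ(t)` below, hence `|t|` by Λ; the precision hypothesis
makes the relative error `1/(6000Λ³)`, so that even the factor Λ lost in the threshold estimate is
harmless. -/
theorem Good.rough (hg : Good D ε δ R J s) (hd : 1 ≤ d) (hε : 0 < ε) (hε' : ε < 1 / 2)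
    (hδ : 0 < δ) (hδ' : δ < 1 / 2) (hi : i < R)
    (hw : ‖w‖ = 1) (hD : IsRCN D (halfspace w t) η) (h0 : 0 < η) (h1 : η < 1 / 2)
    (hm : ε ≤ 20 * ‖chow ε δ i s‖)
    (hκ : firstErr i ≤ 1 / (6000 * Lam ε ^ 3) * ‖chow ε δ i s‖) :
    Rough ε η t w ‖chow ε δ i s‖ (hyp ε δ i s 0) := by
  have hl := one_le_ell hd hε hε' hδ hδ'
  have hΛ := Lam_pos hε hε'
  set Λ := Lam ε with hΛdef
  set u := chow ε δ i s with hu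
  have hu0 : 0 < ‖u‖ := by linarith
  have hgt := gdens_pos t
  set κ := 1 / (6000 * Λ ^ 3) with hκdef
  have hκ0 : 0 < κ := by positivity
  have hΛ3 : (64 : ℝ) ≤ Λ ^ 3 := by
    calc (64 : ℝ) = 4 ^ 3 := by norm_num
      _ ≤ _ := by gcongr
  have hκ1 : κ ≤ 1 / 100 := by
    rw [hκdef, div_le_div_iff₀ (by positivity) (by norm_num)]; linarith
  have hfirst := (hg.first_bounds hd hl hi (fun e c =>
    statMean_first hw hD h0 (by linarith) e c)).1
  rw [← hu] at hfirst
  set G := 2 * (1 - 2 * η) * gdens t with hG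
  have hG0 : 0 ≤ G := mul_nonneg (by linarith) hgt.le
  have hv1 : ‖dir ε δ i s‖ = 1 := by
    rw [dir, ← hu, norm_smul, norm_inv, norm_norm, inv_mul_cancel₀ hu0.ne']
  have hsecond := hg.second_bound hd hl hi hw hD h0 (by linarith) hv1
  rw [← hG] at hsecond
  have hGm : |G - ‖u‖| ≤ κ * ‖u‖ := by
    have : ‖G • w‖ = G := by rw [norm_smul, hw, mul_one, Real.norm_eq_abs, abs_of_nonneg hG0]
    rw [← this, abs_sub_comm]
    exact ((abs_norm_sub_norm_le _ _).trans hfirst).trans hκ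
  have htΛ : |t| + 1 ≤ Λ := by
    apply abs_add_one_le_Lam hε hε'
    have h2 := (abs_le.1 hGm).1
    have h3 : G ≤ 2 * gdens t := by rw [hG]; nlinarith
    nlinarith
  have hini := initial_hypothesis (Λ := Λ) hw hu0 hκ0 hκ1 htΛ (hfirst.trans hκ) hG0
    (T := hermiteAvg ε δ i s) (hsecond.trans hκ)
  -- The starting radius of the refinement is exactly the threshold error of `initial_hypothesis`;
  -- the direction error `2κ` is smaller.
  have hrad : rad ε 0 = 5 * κ * Λ := by
    rw [rad, hκdef, ← hΛdef]; field_simp; norm_num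
  refine ⟨htΛ, hGm, hv1, ?_, ?_⟩
  · rw [hrad]; refine hini.2.1.trans ?_; nlinarith
  · rw [hrad]; exact hini.2.2

end Accuracy

/-! ### One refinement stage on the good event. -/

section Refinement

variable {d : ℕ} {D : Measure (Sample d)} [IsProbabilityMeasure D] {η ε δ : ℝ} {R J i j : ℕ}
  {s : ℕ → Sample d} {w : EuclideanSpace ℝ (Fin d)} {t : ℝ}

theorem rad_succ (ε : ℝ) (j : ℕ) : rad ε (j + 1) = rad ε j / 2 := by
  unfold rad; rw [pow_succ (2 : ℝ) j, ← div_div]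

theorem rad_le_zero (hε : 0 < ε) (hε' : ε < 1 / 2) (j : ℕ) : rad ε j ≤ rad ε 0 := by
  have := Lam_pos hε hε'
  unfold rad
  have h2 : (1 : ℝ) ≤ 2 ^ j := one_le_pow₀ (by norm_num)
  rw [pow_zero, div_one]
  exact div_le_self (by positivity) h2

theorem rad_mul_sq_le (hε : 0 < ε) (hε' : ε < 1 / 2) (j : ℕ) :
    rad ε j * (1200 * Lam ε ^ 2) ≤ 1 := by
  have h := Lam_pos hε hε'
  have h1 := rad_le_zero hε hε' j
  have h2 : rad ε 0 * (1200 * Lam ε ^ 2) = 1 := by unfold rad; field_simp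
  calc _ ≤ rad ε 0 * (1200 * Lam ε ^ 2) := by gcongr
    _ = 1 := h2

theorem Lam_mul_rad_le (hε : 0 < ε) (hε' : ε < 1 / 2) (j : ℕ) :
    Lam ε * rad ε j ≤ 1 / (1200 * Lam ε) ∧ Lam ε * rad ε j ≤ 1 / 4800 := by
  have h := Lam_pos hε hε'
  have h1 := rad_mul_sq_le hε hε' j
  have h2 : Lam ε * rad ε j ≤ 1 / (1200 * Lam ε) := by
    rw [le_div_iff₀ (by positivity)]; nlinarith
  refine ⟨h2, h2.trans ?_⟩
  rw [div_le_div_iff₀ (by positivity) (by norm_num)]; linarith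

/-- The program always divides by `m`, while the scale of a stage involves the density at the
current threshold. A radius of order `Λ⁻²` and thresholds of size at most `Λ` make these agree up to
a relative error of order `1/Λ`, as `estimate_error` requires. -/
theorem Rough.scale_near {m : ℝ} {h : EuclideanSpace ℝ (Fin d) × ℝ} (hr : Rough ε η t w m h)
    (hε : 0 < ε) (hε' : ε < 1 / 2) (hm : 0 < m) {r : ℝ} (hrt : |r - t| ≤ rad ε 0) :
    |r| ≤ Lam ε ∧ |r| + 1 / 2 ≤ Lam ε ∧
      |2 * (1 - 2 * η) * gdens r / m - 1| ≤ 0.002 / Lam ε := by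
  have hΛ := Lam_pos hε hε'
  obtain ⟨h1, h2⟩ := Lam_mul_rad_le hε hε' 0
  have h0 := rad_pos hε hε' 0
  have ht := hr.target
  have hsc := hr.scale
  set Λ := Lam ε with hΛd
  set ρ := rad ε 0 with hρd
  have hρ : ρ ≤ 1 / 4800 := by nlinarith
  have h3 : |r| ≤ |t| + ρ := by
    have : r = (r - t) + t := by ring
    rw [this]; linarith [abs_add_le (r - t) t]
  refine ⟨by linarith, by linarith, ?_⟩
  have h4 := gdens_ratio (s := r) (t := t) (by linarith : |r| ≤ Λ) (by linarith) hrt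
    (by linarith)
  have hgt := gdens_pos t
  set y := gdens r / gdens t with hy
  have e : 2 * (1 - 2 * η) * gdens r / m - 1 =
      (2 * (1 - 2 * η) * gdens t - m) / m * y + (y - 1) := by
    rw [hy]; field_simp; ring
  have hy1 : |y| ≤ 1.01 := by
    have := abs_le.1 h4; rw [abs_le]; constructor <;> linarith
  have h5 : |(2 * (1 - 2 * η) * gdens t - m) / m| ≤ 1 / (6000 * Λ ^ 3) := by
    rw [abs_div, abs_of_pos hm, div_le_iff₀ hm]; exact hsc
  have h6 : 1 / (6000 * Λ ^ 3) ≤ 0.0001 / Λ := by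
    rw [div_le_div_iff₀ (by positivity) (by positivity)]
    nlinarith [sq_nonneg Λ, mul_pos (show 0 < Λ by linarith) (show 0 < Λ by linarith)]
  have h7 : 1 / (1200 * Λ) = (1 / 1200) * (1 / Λ) := by rw [div_mul_div_comm]; norm_num
  have h8 : ∀ x : ℝ, x / Λ = x * (1 / Λ) := fun x => by ring
  have h9 : 0 < 1 / Λ := by positivity
  rw [h8] at h6 ⊢
  rw [e]
  calc _ ≤ |(2 * (1 - 2 * η) * gdens t - m) / m * y| + |y - 1| := abs_add_le _ _
    _ ≤ (0.0001 * (1 / Λ)) * 1.01 + 2 * ((1 / 1200) * (1 / Λ)) := by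
        rw [abs_mul]
        have := h5.trans h6
        have hh : 2 * (Λ * ρ) ≤ 2 * ((1 / 1200) * (1 / Λ)) := by rw [← h7]; linarith
        have hh2 := h4.trans hh
        gcongr
    _ ≤ _ := by nlinarith

/-- The acceptance test sees only the initial estimated threshold; this transfers its guarantee to
the densities at all later thresholds. -/
theorem Rough.gdens_le_thr {m : ℝ} {h : EuclideanSpace ℝ (Fin d) × ℝ} (hr : Rough ε η t w m h)
    (hε : 0 < ε) (hε' : ε < 1 / 2) (hm : 0 < m) {r : ℝ} (hrt : |r - t| ≤ rad ε 0) :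
    gdens r ≤ 0.41 * Real.exp (-h.2 ^ 2 / 2) := by
  have hΛ := Lam_pos hε hε'
  have h1 := (hr.scale_near hε hε' hm hrt).1
  have h2 := (hr.scale_near hε hε' hm hr.thr).1
  have h3 := (Lam_mul_rad_le hε hε' 0).2
  have h4 := gdens_ratio (ρ := 2 * rad ε 0) h1 h2 (by
    have : r - h.2 = (r - t) - (h.2 - t) := by ring
    rw [this]
    exact (abs_sub _ _).trans (by linarith [hr.thr])) (by linarith)
  have h5 : gdens r / gdens h.2 ≤ 1.01 := by linarith [(abs_le.1 h4).2]
  rw [div_le_iff₀ (gdens_pos _)] at h5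
  have h6 := (gdens_bounds h.2).2
  have h7 := Real.exp_pos (-h.2 ^ 2 / 2)
  nlinarith

/-- The hypothesis `h` is within `ρ` of the target. -/
structure Near (w : EuclideanSpace ℝ (Fin d)) (t ρ : ℝ) (h : EuclideanSpace ℝ (Fin d) × ℝ) :
    Prop where
  unit : ‖h.1‖ = 1
  vec : ‖h.1 - w‖ ≤ ρ
  thr : |h.2 - t| ≤ ρ

theorem Near.tilt {h : EuclideanSpace ℝ (Fin d) × ℝ} {ρ : ℝ} (hn : Near w t ρ h) (hw : ‖w‖ = 1)
    (hε : 0 < ε) (hε' : ε < 1 / 2) (ht : |t| + 1 ≤ Lam ε) (hρ0 : 0 < ρ) (hρ : ρ ≤ rad ε 0) :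
    0 < ⟪h.1, w⟫ ∧ ‖tilt h.1 w‖ ≤ 2 * ρ ∧ |t / ⟪h.1, w⟫ - h.2| ≤ 2 * ρ := by
  have hΛ := Lam_pos hε hε'
  have h3 := (Lam_mul_rad_le hε hε' 0).2
  have h0 := rad_pos hε hε' 0
  have hρ1 : ρ ≤ 1 / 10 := by nlinarith
  have hΛρ : Lam ε * ρ ≤ 1 / 10 := by
    calc Lam ε * ρ ≤ Lam ε * rad ε 0 := by gcongr
      _ ≤ _ := by linarith
  obtain ⟨c1, c2, c3⟩ := half_lt_inner hn.unit hw hρ1 hn.vec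
  exact ⟨by linarith, norm_tilt_le hn.unit hw hρ1 hn.vec,
    abs_div_sub_le c1 c2 c3 hρ0.le hn.thr ht hΛρ⟩

/-- Squared noise is of order `Λρg/2^i` and must be below a small multiple of `(ρm/Λ)²`, so `2^i m
(mρ)` must exceed a large multiple of `Λ³g`. While the loop runs, `mρ > ε/120`, so the refinement
test suffices. -/
theorem stage_noise {d : ℕ} {n q Λ ρ m g ψ ε ℓ : ℝ} (hΛ : 4 ≤ Λ) (hρ : 0 < ρ) (hm : 0 < m)
    (hg : 0 < g) (hgψ : g ≤ 0.41 * ψ) (hℓ : 0 < ℓ) (hd : 1 ≤ d) (hq : 0 < q)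
    (hn : d * ℓ * q ≤ n) (hc : 4000000000000 * Λ ^ 3 * ψ ≤ q * m * ε) (hρε : ε < 120 * m * ρ) :
    Real.sqrt d * Real.sqrt (5280 * (600 * Λ * ρ * g) * ℓ / n) ≤ 0.01 * ρ / Λ * m := by
  have hd' : (1 : ℝ) ≤ d := by exact_mod_cast hd
  have hn0 : 0 < n := lt_of_lt_of_le (by positivity) hn
  rw [← Real.sqrt_mul (by positivity)]
  apply Real.sqrt_le_iff.2
  refine ⟨by positivity, ?_⟩
  have h1 : d * (5280 * (600 * Λ * ρ * g) * ℓ / n) ≤ 5280 * (600 * Λ * ρ * g) / q := by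
    rw [← mul_div_assoc, div_le_div_iff₀ hn0 hq]
    have : 5280 * (600 * Λ * ρ * g) * (d * ℓ * q) ≤ 5280 * (600 * Λ * ρ * g) * n := by gcongr
    linarith
  refine h1.trans ?_
  rw [div_le_iff₀ hq]
  have h2 : (0.01 * ρ / Λ * m) ^ 2 * q = 0.0001 * ρ * (q * m * (m * ρ)) / Λ ^ 2 := by ring
  rw [h2, le_div_iff₀ (by positivity)]
  have h3 : q * m * ε ≤ q * m * (120 * m * ρ) := by gcongr
  have h4 : 0 < Λ ^ 3 := by positivity
  have h5 : Λ ^ 3 * g ≤ Λ ^ 3 * (0.41 * ψ) := by gcongr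
  have h6 : 33000000000 * (Λ ^ 3 * g) ≤ q * m * (m * ρ) := by nlinarith
  have h7 := mul_le_mul_of_nonneg_left h6 hρ.le
  have h8 : 0 < ρ * (Λ ^ 3 * g) := by positivity
  have h9 : 5280 * (600 * Λ * ρ * g) * Λ ^ 2 = 3168000 * (ρ * (Λ ^ 3 * g)) := by ring
  have h10 : 0.0001 * ρ * (q * m * (m * ρ)) = 0.0001 * (ρ * (q * m * (m * ρ))) := by ring
  rw [h9, h10]
  linarith

/-- The effective number of samples in the band is at least `ℓ`: the refinement test and `m ≤ ψ`
give `2^i ε ≥ 1`, and the loop condition makes the band's mass at least of order ε. -/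
theorem stage_valid {d n q Λ ρ m g ψ ε ℓ : ℝ} (hΛ : 4 ≤ Λ) (hρ : 0 < ρ) (hm : 0 < m)
    (hgm : 0.495 * m ≤ g) (hψ : m ≤ ψ) (hℓ : 0 < ℓ) (hd : 1 ≤ d) (hq : 0 < q)
    (hn : d * ℓ * q ≤ n) (hc : 4000000000000 * Λ ^ 3 * ψ ≤ q * m * ε) (hρε : ε < 120 * m * ρ) :
    ℓ ≤ n * (600 * Λ * ρ * g) := by
  have hg : 0 < g := by linarith
  have hΛ3 : (64 : ℝ) ≤ Λ ^ 3 := by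
    calc (64 : ℝ) = 4 ^ 3 := by norm_num
      _ ≤ _ := by gcongr
  have hqε : 1 ≤ q * ε := by
    have h2 : 4000000000000 * 64 * m ≤ 4000000000000 * Λ ^ 3 * ψ := by gcongr
    have h3 : 1 * m ≤ (q * ε) * m := by linarith
    exact le_of_mul_le_mul_right h3 hm
  have h2 : 1 ≤ q * (600 * Λ * ρ * g) := by
    have h3 : 600 * 4 * ρ * (0.495 * m) ≤ 600 * Λ * ρ * g := by gcongr
    have h4 : ε ≤ 600 * Λ * ρ * g := by
      have : 0 < m * ρ := by positivity
      linarith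
    calc 1 ≤ q * ε := hqε
      _ ≤ _ := by gcongr
  calc ℓ ≤ ℓ * (d * (q * (600 * Λ * ρ * g))) :=
        le_mul_of_one_le_right hℓ.le (one_le_mul_of_one_le_of_one_le hd h2)
    _ = d * ℓ * q * (600 * Λ * ρ * g) := by ring
    _ ≤ _ := by gcongr

/-- On the good event, noise and truncation bias are both small multiples of `ρ/Λ`; `estimate_error`
combines them with the scale mismatch and `refine_step` halves the radius. -/
theorem Good.stage_step (hg : Good D ε δ R J s) (hd : 1 ≤ d) (hε : 0 < ε) (hε' : ε < 1 / 2)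
    (hδ : 0 < δ) (hδ' : δ < 1 / 2) (hi : i < R) (hj : j < J)
    (hw : ‖w‖ = 1) (hD : IsRCN D (halfspace w t) η) (h0 : 0 < η) (h1 : η < 1 / 2)
    (hm : 0 < ‖chow ε δ i s‖) (hr : Rough ε η t w ‖chow ε δ i s‖ (hyp ε δ i s 0))
    (hc : 4000000000000 * Lam ε ^ 3 * Real.exp (-(hyp ε δ i s 0).2 ^ 2 / 2) ≤
      2 ^ i * ‖chow ε δ i s‖ * ε)
    (hn : Near w t (rad ε j) (hyp ε δ i s j)) (hρε : ε < 120 * ‖chow ε δ i s‖ * rad ε j) :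
    Near w t (rad ε (j + 1)) (hyp ε δ i s (j + 1)) := by
  have hl := one_le_ell hd hε hε' hδ hδ'
  have hΛ := Lam_pos hε hε'
  have hρ := rad_pos hε hε' j
  have hρ0 := rad_le_zero hε hε' j
  have hΛρ := Lam_mul_rad_le hε hε' j
  have hσ := bandWidth_pos hε hε' j
  have hrt : |(hyp ε δ i s j).2 - t| ≤ rad ε 0 := hn.thr.trans hρ0
  obtain ⟨hs1, hs2, hs3⟩ := hr.scale_near hε hε' hm hrt
  have hgψ := hr.gdens_le_thr hε hε' hm hrt
  have hgpos := gdens_pos (hyp ε δ i s j).2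
  obtain ⟨hcpos, htilt, hb⟩ := hn.tilt hw hε hε' hr.target hρ hρ0
  have hlen : (d : ℝ) * ell d ε δ * 2 ^ i ≤ len d ε δ i := nomLen_le_len d ε δ i
  have hd' : (1 : ℝ) ≤ d := by exact_mod_cast hd
  set m := ‖chow ε δ i s‖ with hmd
  set h := hyp ε δ i s j with hh
  set Λ := Lam ε with hΛd
  set ρ := rad ε j with hρd
  set g := gdens h.2 with hgd
  have hσd : bandWidth ε j = 600 * Λ * ρ := rfl
  have hσsmall : bandWidth ε j ≤ 1 / 2 := by rw [hσd]; linarith [hΛρ.2]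
  have hσsmall' : bandWidth ε j * Λ ≤ 1 / 2 := by
    rw [hσd]
    have : Λ * ρ * (1200 * Λ) ≤ 1 := by
      have := hΛρ.1; rwa [le_div_iff₀ (by positivity)] at this
    nlinarith
  have hsσ : bandWidth ε j * (|h.2| + bandWidth ε j) ≤ 1 := by
    calc bandWidth ε j * (|h.2| + bandWidth ε j) ≤ bandWidth ε j * Λ := by gcongr; linarith
      _ ≤ 1 := by linarith
  have hL : 0.99 * m ≤ 2 * (1 - 2 * η) * g := by
    have h2 : 0.002 / Λ ≤ 0.01 := by rw [div_le_iff₀ (by linarith)]; linarith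
    have h3 := (abs_le.1 hs3).1
    have h4 : 0.99 ≤ 2 * (1 - 2 * η) * g / m := by linarith
    rwa [le_div_iff₀ hm] at h4
  have hgm : 0.495 * m ≤ g := by
    have : 2 * (1 - 2 * η) * g ≤ 2 * 1 * g := by gcongr; linarith
    linarith
  have hψ : m ≤ Real.exp (-(hyp ε δ i s 0).2 ^ 2 / 2) := by linarith
  have hvalid : ell d ε δ ≤ len d ε δ i * (bandWidth ε j * g) :=
    stage_valid hΛ hρ hm hgm hψ (by linarith) hd' (by positivity) hlen hc hρε
  obtain ⟨I, I₀, hmean, hI, hI₀⟩ := exists_statMean_stage (c := ⟪h.1, w⟫) (R := 2 * ρ) hn.unit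
    hcpos (inner_smul_add_tilt hcpos.ne') (inner_tilt hn.unit hcpos.ne') hD h0 (by linarith) hσ hsσ
    (by positivity) htilt hb
  -- This fixes the width `600Λρ`: it is large enough for the cubic bias, and with `1200Λ²ρ ≤ 1`
  -- still small enough for the band condition.
  have hbias : 220 * (2 * ρ) ^ 3 / bandWidth ε j ^ 2 ≤ 0.005 * ρ / Λ := by
    rw [hσd, div_le_div_iff₀ (by positivity) (by linarith)]
    have h2 : 0 < ρ ^ 3 := by positivity
    nlinarith [mul_nonneg (mul_nonneg h2.le (show 0 ≤ Λ by linarith)) (show 0 ≤ Λ - 4 by linarith)]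
  have htest := norm_sub_le_of_test (a := vecAvg (band h.2 (bandWidth ε j)) h.1
      (stageOffset d ε δ i j) (len d ε δ i) s) (A := (2 * (1 - 2 * η) * g) • I)
    (b := scAvg (band h.2 (bandWidth ε j)) h.1 (stageOffset d ε δ i j) (len d ε δ i) s)
    (B := (2 * (1 - 2 * η) * g) * I₀)
    (Real.sqrt_nonneg (5280 * (bandWidth ε j * g) * ell d ε δ / len d ε δ i)) (fun k => by
      have := hg.stage i hi j hj k hn.unit hsσ hvalid
      rw [statAvg, average_stat, hmean] at this
      convert this using 3
      rw [real_inner_smul_right]; ring)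
  have hnoise := stage_noise (d := d) hΛ hρ hm hgpos hgψ (by linarith : 0 < ell d ε δ) hd
    (by positivity : (0 : ℝ) < 2 ^ i) hlen hc hρε
  rw [← hσd] at hnoise
  have hest := estimate_error hm hΛ hρ hs3 htilt hb (hI.trans hbias) (hI₀.trans hbias)
    (htest.1.trans hnoise) (htest.2.trans ((le_mul_of_one_le_left (Real.sqrt_nonneg _)
      (by rw [Real.one_le_sqrt]; exact_mod_cast hd)).trans hnoise))
  obtain ⟨r1, r2, r3⟩ := refine_step hn.unit hw hn.vec hρ hr.target (by linarith [hΛρ.2])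
    hest.1 hest.2
  rw [rad_succ]
  exact ⟨r1, r2, r3⟩

end Refinement

/-! ### Stopping rules and excess error of the output. -/

section Outcome

variable {d : ℕ} {D : Measure (Sample d)} [IsProbabilityMeasure D] {η ε δ : ℝ} {R J K i j : ℕ}
  {s : ℕ → Sample d} {w : EuclideanSpace ℝ (Fin d)} {t : ℝ}

/-- Round `i` has enough samples to start the refinement. -/
structure Accept (ε δ : ℝ) (i : ℕ) (s : ℕ → Sample d) : Prop where
  large : ε ≤ 20 * ‖chow ε δ i s‖
  direction : 40000000000 * Lam ε ^ 6 ≤ 2 ^ i * ‖chow ε δ i s‖ ^ 2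
  refinement : 4000000000000 * Lam ε ^ 3 * Real.exp (-thr ε δ i s ^ 2 / 2) ≤ 2 ^ i * ‖chow ε δ i s‖ * ε

/-- Round `i` is so long that a constant hypothesis is good enough if it is not accepted. -/
def Long (ε : ℝ) (i : ℕ) : Prop := 100000000000000 * Lam ε ^ 6 ≤ 2 ^ i * ε ^ 2

/-- The learner stops in round `i` after `K` refinement stages with hypothesis `h`. -/
inductive Outcome (ε δ : ℝ) (s : ℕ → Sample d) :
    ℕ → ℕ → EuclideanSpace ℝ (Fin d) × ℝ → Prop
  | accepted (i K : ℕ) (prev : ∀ k < i, ¬ Accept ε δ k s ∧ ¬ Long ε k) (acc : Accept ε δ i s)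
      (before : ∀ j < K, ε < 120 * ‖chow ε δ i s‖ * rad ε j)
      (after : 120 * ‖chow ε δ i s‖ * rad ε K ≤ ε) :
      Outcome ε δ s i K (hyp ε δ i s K)
  | constant (i : ℕ) (prev : ∀ k < i, ¬ Accept ε δ k s ∧ ¬ Long ε k) (rej : ¬ Accept ε δ i s)
      (long : Long ε i) : Outcome ε δ s i 0 (0, chowZero ε δ i s)

theorem firstErr_le_of_direction (hε : 0 < ε) (hε' : ε < 1 / 2) {m : ℝ} (hm : 0 ≤ m)
    (h : 40000000000 * Lam ε ^ 6 ≤ 2 ^ i * m ^ 2) : firstErr i ≤ 1 / (6000 * Lam ε ^ 3) * m := by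
  have hΛ := Lam_pos hε hε'
  unfold firstErr
  refine Real.sqrt_le_iff.2 ⟨by positivity, ?_⟩
  rw [div_le_iff₀ (by positivity)]
  have e : (1 / (6000 * Lam ε ^ 3) * m) ^ 2 * 2 ^ i =
      (2 ^ i * m ^ 2) / (36000000 * Lam ε ^ 6) := by
    field_simp; ring
  rw [e, le_div_iff₀ (by positivity)]
  have : 0 < Lam ε ^ 6 := by positivity
  linarith

theorem Good.near_hyp (hg : Good D ε δ R J s) (hd : 1 ≤ d) (hε : 0 < ε) (hε' : ε < 1 / 2)
    (hδ : 0 < δ) (hδ' : δ < 1 / 2) (hi : i < R) (hw : ‖w‖ = 1) (hD : IsRCN D (halfspace w t) η)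
    (h0 : 0 < η) (h1 : η < 1 / 2) (hr : Rough ε η t w ‖chow ε δ i s‖ (hyp ε δ i s 0))
    (hm : 0 < ‖chow ε δ i s‖) (hc : 4000000000000 * Lam ε ^ 3 * Real.exp (-thr ε δ i s ^ 2 / 2) ≤
      2 ^ i * ‖chow ε δ i s‖ * ε) (hK : K ≤ J)
    (hb : ∀ j < K, ε < 120 * ‖chow ε δ i s‖ * rad ε j) :
    Near w t (rad ε K) (hyp ε δ i s K) := by
  induction K with
  | zero => exact ⟨hr.unit, hr.vec, hr.thr⟩
  | succ k ih =>
    exact hg.stage_step hd hε hε' hδ hδ' hi (by omega) hw hD h0 h1 hm hr hc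
      (ih (by omega) fun j hj => hb j (by omega)) (hb k (by omega))

/-- Disagreement is at most `220ρφ(s)`, and `2(1-2η)φ(s) ≤ 1.01m`; the unknown noise rate thus
cancels against the observed scale, which justifies the stopping rule `120mρ ≤ ε`. -/
theorem Near.excess_le {h : EuclideanSpace ℝ (Fin d) × ℝ} {m ρ : ℝ}
    {h₀ : EuclideanSpace ℝ (Fin d) × ℝ} (hn : Near w t ρ h) (hr : Rough ε η t w m h₀)
    (hε : 0 < ε) (hε' : ε < 1 / 2) (hw : ‖w‖ = 1) (h1 : η < 1 / 2)
    (hm : 0 < m) (hρ0 : 0 < ρ) (hρ : ρ ≤ rad ε 0) (hf : 120 * m * ρ ≤ ε) :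
    (1 - 2 * η) * (stdGaussian _).real {x | halfspace h.1 h.2 x ≠ halfspace w t x} ≤ ε := by
  have hΛ := Lam_pos hε hε'
  obtain ⟨hc, ha, hb⟩ := hn.tilt hw hε hε' hr.target hρ0 hρ
  obtain ⟨h2, -, h3⟩ := hr.scale_near hε hε' hm (hn.thr.trans hρ)
  have h5 := (Lam_mul_rad_le hε hε' 0).2
  have hdis := disagreement_le (E := EuclideanSpace ℝ (Fin d)) hn.unit
    (inner_tilt hn.unit hc.ne') (R := 2 * ρ) (by positivity) ha hb (by
      calc |h.2| * (2 * ρ) ≤ Lam ε * (2 * rad ε 0) := by gcongr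
        _ ≤ 1 := by linarith)
  have hset : {x | halfspace h.1 h.2 x ≠ halfspace w t x} =
      {x | sgn (⟪h.1, x⟫ + h.2) ≠ sgn (⟪h.1, x⟫ + ⟪_root_.tilt h.1 w, x⟫ + t / ⟪h.1, w⟫)} := by
    have e : halfspace w t = halfspace (h.1 + _root_.tilt h.1 w) (t / ⟪h.1, w⟫) := by
      have := halfspace_smul hc (h.1 + _root_.tilt h.1 w) (t / ⟪h.1, w⟫)
      rw [← inner_smul_add_tilt hc.ne', mul_div_cancel₀ _ hc.ne'] at this
      exact this
    ext x
    rw [e]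
    simp only [halfspace, inner_add_left]
  rw [hset]
  have h4 : 2 * (1 - 2 * η) * gdens h.2 ≤ 1.01 * m := by
    have h6 : 0.002 / Lam ε ≤ 0.01 := by rw [div_le_iff₀ (by linarith)]; linarith
    have := (abs_le.1 h3).2
    rw [← div_le_iff₀ hm]; linarith
  calc _ ≤ (1 - 2 * η) * (110 * (2 * ρ * gdens h.2)) := by gcongr; linarith
    _ = 110 * ρ * (2 * (1 - 2 * η) * gdens h.2) := by ring
    _ ≤ 110 * ρ * (1.01 * m) := by gcongr
    _ ≤ ε := by nlinarith [mul_pos hρ0 hm]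

theorem bias_nonneg (f : EuclideanSpace ℝ (Fin d) → ℤˣ) : 0 ≤ bias f :=
  le_min measureReal_nonneg measureReal_nonneg

theorem bias_le_exp (hw : ‖w‖ = 1) : bias (halfspace w t) ≤ Real.exp (-t ^ 2 / 2) :=
  min_mass_le hw t

theorem mass_add_mass (w : EuclideanSpace ℝ (Fin d)) (t : ℝ) :
    (stdGaussian (EuclideanSpace ℝ (Fin d))).real {x | halfspace w t x = 1} +
      (stdGaussian (EuclideanSpace ℝ (Fin d))).real {x | halfspace w t x = -1} = 1 := by
  have hms : MeasurableSet {x | halfspace w t x = 1} :=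
    measurableSet_eq_fun (measurable_halfspace w t) measurable_const
  have hc : {x | halfspace w t x = -1} = {x | halfspace w t x = 1}ᶜ := by
    ext x
    rcases Int.units_eq_one_or (halfspace w t x) with h | h <;> simp [h]
  rw [hc, measureReal_compl hms, probReal_univ]; ring

theorem meanSign_eq (w : EuclideanSpace ℝ (Fin d)) (t : ℝ) :
    meanSign w t = (stdGaussian (EuclideanSpace ℝ (Fin d))).real {x | halfspace w t x = 1} -
      (stdGaussian (EuclideanSpace ℝ (Fin d))).real {x | halfspace w t x = -1} := by
  have hms : MeasurableSet {x | halfspace w t x = 1} :=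
    measurableSet_eq_fun (measurable_halfspace w t) measurable_const
  have h : ∀ x, rsgn (⟪w, x⟫ + t) =
      2 * ({x | halfspace w t x = 1}.indicator (fun _ => (1 : ℝ)) x) - 1 := by
    intro x
    rw [← halfspace_cast]
    by_cases hx : halfspace w t x = 1
    · rw [Set.indicator_of_mem (show x ∈ {x | halfspace w t x = 1} from hx), hx]; norm_num
    · rw [Set.indicator_of_notMem (show x ∉ {x | halfspace w t x = 1} from hx)]
      rcases Int.units_eq_one_or (halfspace w t x) with h | h
      · exact absurd h hx
      · rw [h]; norm_num
  unfold meanSign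
  simp_rw [h]
  rw [integral_sub (((integrable_const 1).indicator hms).const_mul 2) (integrable_const 1),
    integral_const_mul, integral_indicator hms]
  have := mass_add_mass w t
  simp
  linarith

/-- A constant hypothesis with the sign of an estimate of the mean label. -/
theorem constant_excess_le (h1 : η < 1 / 2) {b r p : ℝ} (hp : (1 - 2 * η) * bias (halfspace w t) ≤ p)
    (hr : |b - (1 - 2 * η) * meanSign w t| ≤ r) :
    (1 - 2 * η) * (stdGaussian _).real
      {x | halfspace (0 : EuclideanSpace ℝ (Fin d)) b x ≠ halfspace w t x} ≤ p + r := by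
  have hadd := mass_add_mass w t
  have hM := meanSign_eq w t
  set P := (stdGaussian (EuclideanSpace ℝ (Fin d))).real {x | halfspace w t x = 1} with hP
  set N := (stdGaussian (EuclideanSpace ℝ (Fin d))).real {x | halfspace w t x = -1} with hN
  have hb : bias (halfspace w t) = min P N := rfl
  rw [hb] at hp
  have hr2 := abs_le.1 hr
  have hr0 := (abs_nonneg _).trans hr
  have hβ : 0 < 1 - 2 * η := by linarith
  rw [hM] at hr2
  rcases le_or_gt 0 b with h | h
  · have hset : {x | halfspace (0 : EuclideanSpace ℝ (Fin d)) b x ≠ halfspace w t x} =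
        {x | halfspace w t x = -1} := by
      ext x
      have : halfspace (0 : EuclideanSpace ℝ (Fin d)) b x = 1 := by simp [halfspace, sgn, h]
      simp only [Set.mem_ofPred_eq, this]
      rcases Int.units_eq_one_or (halfspace w t x) with h | h <;> simp [h]
    rw [hset, ← hN]
    -- If the chosen constant is on the smaller side, the estimate has the wrong sign, so the scaled
    -- gap between the two masses is at most the estimation error `r`.
    rcases min_choice P N with hc | hc <;> rw [hc] at hp
    · nlinarith
    · linarith
  · have hset : {x | halfspace (0 : EuclideanSpace ℝ (Fin d)) b x ≠ halfspace w t x} =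
        {x | halfspace w t x = 1} := by
      ext x
      have : halfspace (0 : EuclideanSpace ℝ (Fin d)) b x = -1 := by simp [halfspace, sgn, h]
      simp only [Set.mem_ofPred_eq, this]
      rcases Int.units_eq_one_or (halfspace w t x) with h | h <;> simp [h]
    rw [hset, ← hP]
    rcases min_choice P N with hc | hc <;> rw [hc] at hp
    · linarith
    · nlinarith

theorem exists_normalized (w : EuclideanSpace ℝ (Fin d)) (t : ℝ) :
    ∃ w' t', halfspace w' t' = halfspace w t ∧ (‖w'‖ = 1 ∨ w' = 0) := by
  rcases eq_or_ne w 0 with h | h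
  · exact ⟨w, t, rfl, Or.inr h⟩
  · have hn : 0 < ‖w‖ := norm_pos_iff.2 h
    refine ⟨‖w‖⁻¹ • w, ‖w‖⁻¹ * t, halfspace_smul (inv_pos.2 hn) w t, Or.inl ?_⟩
    rw [norm_smul, norm_inv, norm_norm, inv_mul_cancel₀ hn.ne']

theorem bias_zero (t : ℝ) : bias (halfspace (0 : EuclideanSpace ℝ (Fin d)) t) = 0 := by
  refine le_antisymm ?_ (bias_nonneg _)
  rcases le_or_gt 0 t with h | h
  · refine (min_le_right _ _).trans (le_of_eq ?_)
    simp [halfspace, sgn, h]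
  · refine (min_le_left _ _).trans (le_of_eq ?_)
    simp [halfspace, sgn, h]

/-- A constant target cannot pass the tests: its empirical Chow vector is pure noise, of norm at
most `firstErr i`, and the direction test asks for a norm more than twice that. -/
theorem Good.rough_of_direction (hg : Good D ε δ R J s) (hd : 1 ≤ d) (hε : 0 < ε)
    (hε' : ε < 1 / 2) (hδ : 0 < δ) (hδ' : δ < 1 / 2) (hi : i < R) (hw : ‖w‖ = 1 ∨ w = 0)
    (hD : IsRCN D (halfspace w t) η) (h0 : 0 < η) (h1 : η < 1 / 2)
    (hm : ε ≤ 20 * ‖chow ε δ i s‖) (hc : 40000000000 * Lam ε ^ 6 ≤ 2 ^ i * ‖chow ε δ i s‖ ^ 2) :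
    ‖w‖ = 1 ∧ Rough ε η t w ‖chow ε δ i s‖ (hyp ε δ i s 0) := by
  have hκ := firstErr_le_of_direction hε hε' (norm_nonneg _) hc
  rcases hw with hw | rfl
  · exact ⟨hw, hg.rough hd hε hε' hδ hδ' hi hw hD h0 h1 hm hκ⟩
  · exfalso
    have hl := one_le_ell hd hε hε' hδ hδ'
    have h := (hg.first_bounds hd hl hi (fun e c => statMean_first_zero hD h0 (by linarith) e c)).1
    rw [sub_zero] at h
    have hΛ := Lam_pos hε hε'
    have h2 : 1 / (6000 * Lam ε ^ 3) ≤ 1 / 2 := by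
      have : (1 : ℝ) ≤ Lam ε ^ 3 := one_le_pow₀ (by linarith)
      rw [div_le_div_iff₀ (by positivity) (by norm_num)]; linarith
    nlinarith [norm_nonneg (chow ε δ i s)]

theorem firstErr_le_of_le {x : ℝ} (hx : 0 < x) (hε : 0 < ε) (hε' : ε < 1 / 2)
    (h : 100000000000000 * Lam ε ^ 6 ≤ 2 ^ i * x ^ 2) : firstErr i ≤ 0.00001 * x := by
  have hΛ : (1 : ℝ) ≤ Lam ε ^ 6 := one_le_pow₀ (by linarith [Lam_pos hε hε'])
  unfold firstErr
  refine Real.sqrt_le_iff.2 ⟨by positivity, ?_⟩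
  rw [div_le_iff₀ (by positivity)]
  nlinarith

/-- In a long round, `m ≥ ε/20` would make all three tests succeed, so rejection forces `m < ε/20`.
Then `(1-2η)φ(t)` is small, and the Gaussian tail bounds the bias by a multiple of `φ(t)`. -/
theorem Good.bias_le_of_long (hg : Good D ε δ R J s) (hd : 1 ≤ d) (hε : 0 < ε)
    (hε' : ε < 1 / 2) (hδ : 0 < δ) (hδ' : δ < 1 / 2) (hi : i < R) (hw : ‖w‖ = 1)
    (hD : IsRCN D (halfspace w t) η) (h0 : 0 < η) (h1 : η < 1 / 2)
    (hrej : ¬ Accept ε δ i s) (hlong : Long ε i) :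
    (1 - 2 * η) * bias (halfspace w t) ≤ 0.1 * ε := by
  have hl := one_le_ell hd hε hε' hδ hδ'
  have hΛ := Lam_pos hε hε'
  have hΛ3 : (64 : ℝ) ≤ Lam ε ^ 3 := by
    calc (64 : ℝ) = 4 ^ 3 := by norm_num
      _ ≤ _ := by gcongr
  have hΛ6 : Lam ε ^ 6 = Lam ε ^ 3 * Lam ε ^ 3 := by ring
  have hΛ36 : 64 * Lam ε ^ 3 ≤ Lam ε ^ 6 := by rw [hΛ6]; gcongr
  have hfe := firstErr_le_of_le hε hε hε' hlong
  unfold Long at hlong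
  have hf := (hg.first_bounds hd hl hi (fun e c => statMean_first hw hD h0 (by linarith) e c)).1
  set m := ‖chow ε δ i s‖ with hmd
  have hm : m < ε / 20 := by
    by_contra hcon
    have hm1 : ε ≤ 20 * m := by linarith [not_lt.1 hcon]
    have hm0 : 0 < m := by linarith
    apply hrej
    refine ⟨hm1, ?_, ?_⟩
    · have : 2 ^ i * ε ^ 2 ≤ 2 ^ i * (20 * m) ^ 2 := by gcongr
      rw [← hmd]; nlinarith
    · have h2 : 2 ^ i * ε ^ 2 ≤ 20 * (2 ^ i * m * ε) := by
        have : 2 ^ i * ε * ε ≤ 2 ^ i * ε * (20 * m) := by gcongr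
        nlinarith
      have h3 : Real.exp (-thr ε δ i s ^ 2 / 2) ≤ 1 := by
        rw [Real.exp_le_one_iff]; nlinarith [sq_nonneg (thr ε δ i s)]
      have h4 : 4000000000000 * Lam ε ^ 3 * Real.exp (-thr ε δ i s ^ 2 / 2) ≤ 4000000000000 * Lam ε ^ 3 * 1 := by
        gcongr
      rw [← hmd]; linarith
  have hgt := gdens_bounds t
  have hb := bias_le_exp (t := t) hw
  have hG : 2 * (1 - 2 * η) * gdens t ≤ m + firstErr i := by
    have h2 : ‖(2 * (1 - 2 * η) * gdens t) • w‖ = 2 * (1 - 2 * η) * gdens t := by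
      rw [norm_smul, hw, mul_one, Real.norm_eq_abs, abs_of_nonneg]
      have := gdens_pos t
      exact mul_nonneg (by linarith) this.le
    have := norm_sub_norm_le ((2 * (1 - 2 * η) * gdens t) • w) (chow ε δ i s)
    rw [norm_sub_rev, h2] at this
    linarith
  have hβ : 0 < 1 - 2 * η := by linarith
  have h5 : (1 - 2 * η) * (0.398 * bias (halfspace w t)) ≤ (1 - 2 * η) * gdens t := by
    gcongr; linarith
  linarith

theorem Good.excess_le (hg : Good D ε δ R J s) (hd : 1 ≤ d) (hε : 0 < ε) (hε' : ε < 1 / 2)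
    (hδ : 0 < δ) (hδ' : δ < 1 / 2) (hi : i < R) (hw : ‖w‖ = 1 ∨ w = 0)
    (hD : IsRCN D (halfspace w t) η) (h0 : 0 < η) (h1 : η < 1 / 2) (hK : K ≤ J)
    {h : EuclideanSpace ℝ (Fin d) × ℝ} (ho : Outcome ε δ s i K h) :
    (1 - 2 * η) * (stdGaussian _).real {x | halfspace h.1 h.2 x ≠ halfspace w t x} ≤ ε := by
  have hl := one_le_ell hd hε hε' hδ hδ'
  cases ho with
  | accepted _ prev acc before after =>
    obtain ⟨hw1, hr⟩ := hg.rough_of_direction hd hε hε' hδ hδ' hi hw hD h0 h1 acc.large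
      acc.direction
    have hm : 0 < ‖chow ε δ i s‖ := by linarith [acc.large]
    exact (hg.near_hyp hd hε hε' hδ hδ' hi hw1 hD h0 h1 hr hm acc.refinement hK before).excess_le
      hr hε hε' hw1 h1 hm (rad_pos hε hε' K) (rad_le_zero hε hε' K) after
  | constant prev rej long =>
    have hfe := firstErr_le_of_le hε hε hε' long
    rcases hw with hw | rfl
    · have hb := hg.bias_le_of_long hd hε hε' hδ hδ' hi hw hD h0 h1 rej long
      have hf := (hg.first_bounds hd hl hi
        (fun e c => statMean_first hw hD h0 (by linarith) e c)).2
      exact (constant_excess_le h1 hb hf).trans (by linarith)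
    · have hf := (hg.first_bounds hd hl hi
        (fun e c => statMean_first_zero hD h0 (by linarith) e c)).2
      exact (constant_excess_le h1 (p := 0) (by rw [bias_zero]; simp) hf).trans (by linarith)

end Outcome

/-! ### Rounds, stages, samples and failure probability. -/

section SampleCount

variable {d : ℕ} {D : Measure (Sample d)} [IsProbabilityMeasure D] {η ε δ : ℝ} {R J K i j k : ℕ}
  {s : ℕ → Sample d} {w : EuclideanSpace ℝ (Fin d)} {t : ℝ}

theorem bias_le_one (f : EuclideanSpace ℝ (Fin d) → ℤˣ) : bias f ≤ 1 :=
  (min_le_left _ _).trans measureReal_le_one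

/-- The number of samples per dimension, up to logarithmic factors. -/
def unitScale (ε η p : ℝ) : ℝ := 1 / ((1 - 2 * η) * ε) + 1 / (max (p * (1 - 2 * η)) ε) ^ 2

theorem sampleScale_eq (d : ℕ) (ε η p : ℝ) : sampleScale d ε η p = d * unitScale ε η p := by
  unfold sampleScale unitScale; ring

/-- Suppose `2^i` is larger. The quadratic term and failure of `Long` force `p(1-2η) > ε`, so the
target is not constant; then `m ≥ 0.78 p(1-2η)`, and the first two tests pass. These already give a
rough hypothesis, whence `(1-2η)ψ ≤ 1.3m`, and the term `1/((1-2η)ε)` yields the third test,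
contradicting rejection. -/
theorem Good.two_pow_le (hg : Good D ε δ R J s) (hd : 1 ≤ d) (hε : 0 < ε) (hε' : ε < 1 / 2)
    (hδ : 0 < δ) (hδ' : δ < 1 / 2) (hi : i < R) (hw : ‖w‖ = 1 ∨ w = 0)
    (hD : IsRCN D (halfspace w t) η) (h0 : 0 < η) (h1 : η < 1 / 2)
    (hrej : ¬ Accept ε δ i s) (hlong : ¬ Long ε i) :
    (2 : ℝ) ^ i ≤ 100000000000000 * Lam ε ^ 6 * unitScale ε η (bias (halfspace w t)) := by
  by_contra hcon
  have hcon := not_le.1 hcon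
  have hl := one_le_ell hd hε hε' hδ hδ'
  have hΛ := Lam_pos hε hε'
  have hβ : 0 < 1 - 2 * η := by linarith
  set p := bias (halfspace w t) with hp
  set M := max (p * (1 - 2 * η)) ε with hM
  have hM0 : 0 < M := lt_of_lt_of_le hε (le_max_right _ _)
  have hΛ6 : 0 < Lam ε ^ 6 := by positivity
  have hc1 : 100000000000000 * Lam ε ^ 6 < 2 ^ i * M ^ 2 := by
    rw [← div_lt_iff₀ (by positivity)]
    refine lt_of_le_of_lt ?_ hcon
    have : 1 / M ^ 2 ≤ unitScale ε η p := by
      unfold unitScale; rw [← hM]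
      have : 0 < 1 / ((1 - 2 * η) * ε) := by positivity
      linarith
    calc _ = 100000000000000 * Lam ε ^ 6 * (1 / M ^ 2) := by ring
      _ ≤ _ := by gcongr
  have hc2 : 100000000000000 * Lam ε ^ 6 < 2 ^ i * ((1 - 2 * η) * ε) := by
    rw [← div_lt_iff₀ (by positivity)]
    refine lt_of_le_of_lt ?_ hcon
    have : 1 / ((1 - 2 * η) * ε) ≤ unitScale ε η p := by
      unfold unitScale; rw [← hM]
      have : 0 < 1 / M ^ 2 := by positivity
      linarith
    calc _ = 100000000000000 * Lam ε ^ 6 * (1 / ((1 - 2 * η) * ε)) := by ring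
      _ ≤ _ := by gcongr
  have hMp : ε < p * (1 - 2 * η) ∧ M = p * (1 - 2 * η) := by
    rcases le_or_gt (p * (1 - 2 * η)) ε with h | h
    · exfalso
      rw [hM, max_eq_right h] at hc1
      exact hlong hc1.le
    · exact ⟨h, max_eq_left h.le⟩
  rw [hMp.2] at hc1 hM0
  have hw1 : ‖w‖ = 1 := by
    rcases hw with hw | rfl
    · exact hw
    · rw [hp, bias_zero] at hM0; simp at hM0
  have hfe := firstErr_le_of_le hM0 hε hε' hc1.le
  have hf := (hg.first_bounds hd hl hi (fun e c => statMean_first hw1 hD h0 (by linarith) e c)).1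
  set m := ‖chow ε δ i s‖ with hmd
  have hgt := gdens_bounds t
  have hb : p ≤ Real.exp (-t ^ 2 / 2) := bias_le_exp (t := t) hw1
  have hG : 2 * (1 - 2 * η) * gdens t ≤ m + firstErr i := by
    have h2 : ‖(2 * (1 - 2 * η) * gdens t) • w‖ = 2 * (1 - 2 * η) * gdens t := by
      rw [norm_smul, hw1, mul_one, Real.norm_eq_abs, abs_of_nonneg]
      have := gdens_pos t
      exact mul_nonneg (by linarith) this.le
    have := norm_sub_norm_le ((2 * (1 - 2 * η) * gdens t) • w) (chow ε δ i s)
    rw [norm_sub_rev, h2] at this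
    linarith
  have hmlow : 0.78 * (p * (1 - 2 * η)) ≤ m := by
    have h5 : (1 - 2 * η) * (0.398 * p) ≤ (1 - 2 * η) * gdens t := by gcongr; linarith
    linarith
  have hm0 : 0 < m := by linarith
  have hm1 : ε ≤ 20 * m := by linarith
  have hm2 : 40000000000 * Lam ε ^ 6 ≤ 2 ^ i * m ^ 2 := by
    have : 2 ^ i * (0.78 * (p * (1 - 2 * η))) ^ 2 ≤ 2 ^ i * m ^ 2 := by gcongr
    linarith
  obtain ⟨-, hr⟩ := hg.rough_of_direction hd hε hε' hδ hδ' hi hw hD h0 h1 hm1 hm2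
  rw [← hmd] at hr
  have hsc := (hr.scale_near hε hε' hm0 hr.thr).2.2
  apply hrej
  refine ⟨hm1, hm2, ?_⟩
  have h4 : 2 * (1 - 2 * η) * gdens (thr ε δ i s) ≤ 1.01 * m := by
    have h6 : 0.002 / Lam ε ≤ 0.01 := by rw [div_le_iff₀ (by linarith)]; linarith
    have := (abs_le.1 hsc).2
    rw [← div_le_iff₀ hm0]
    change 2 * (1 - 2 * η) * gdens (hyp ε δ i s 0).2 / m ≤ 1.01
    linarith
  have h5 := (gdens_bounds (thr ε δ i s)).1
  set ψ := Real.exp (-thr ε δ i s ^ 2 / 2) with hψ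
  have h6 : (1 - 2 * η) * ψ ≤ 1.3 * m := by
    have : (1 - 2 * η) * (0.398 * ψ) ≤ (1 - 2 * η) * gdens (thr ε δ i s) := by gcongr
    linarith
  have hΛ3 : Lam ε ^ 3 ≤ Lam ε ^ 6 := pow_le_pow_right₀ (by linarith) (by norm_num)
  have h7 : (1 - 2 * η) * (4000000000000 * Lam ε ^ 3 * ψ) ≤ (1 - 2 * η) * (2 ^ i * m * ε) := by
    calc (1 - 2 * η) * (4000000000000 * Lam ε ^ 3 * ψ) = 4000000000000 * Lam ε ^ 3 * ((1 - 2 * η) * ψ) := by ring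
      _ ≤ 4000000000000 * Lam ε ^ 6 * (1.3 * m) := by gcongr
      _ = 5200000000000 * Lam ε ^ 6 * m := by ring
      _ ≤ 2 ^ i * ((1 - 2 * η) * ε) * m := mul_le_mul_of_nonneg_right (by linarith) hm0.le
      _ = _ := by ring
  exact le_of_mul_le_mul_left h7 hβ

/-- The Chow norm is at most 2 on the good event, so the running condition `ε < 120 m ρ_j` alone
caps the number of stages logarithmically. -/
theorem Good.two_pow_stage_lt (hg : Good D ε δ R J s) (hd : 1 ≤ d) (hε : 0 < ε)
    (hε' : ε < 1 / 2) (hδ : 0 < δ) (hδ' : δ < 1 / 2) (hi : i < R) (hw : ‖w‖ = 1 ∨ w = 0)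
    (hD : IsRCN D (halfspace w t) η) (h0 : 0 < η) (h1 : η < 1 / 2)
    {h : EuclideanSpace ℝ (Fin d) × ℝ} (ho : Outcome ε δ s i K h) :
    ∀ j < K, 2 ^ j * ε < 1 := by
  cases ho with
  | accepted _ prev acc before after =>
    intro j hj
    obtain ⟨-, hr⟩ := hg.rough_of_direction hd hε hε' hδ hδ' hi hw hD h0 h1 acc.large
      acc.direction
    have hΛ := Lam_pos hε hε'
    have hsc := (abs_le.1 hr.scale).1
    set m := ‖chow ε δ i s‖
    have hm0 : 0 ≤ m := norm_nonneg _
    have h2 : 1 / (6000 * Lam ε ^ 3) ≤ 1 / 2 := by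
      have : (1 : ℝ) ≤ Lam ε ^ 3 := one_le_pow₀ (by linarith)
      rw [div_le_div_iff₀ (by positivity) (by norm_num)]; linarith
    have hG : 2 * (1 - 2 * η) * gdens t ≤ 0.8 := by
      have h3 := (gdens_bounds t).2
      have h4 : Real.exp (-t ^ 2 / 2) ≤ 1 := by
        rw [Real.exp_le_one_iff]; nlinarith [sq_nonneg t]
      have h5 := gdens_pos t
      calc 2 * (1 - 2 * η) * gdens t ≤ 2 * 1 * 0.4 := by gcongr <;> linarith
        _ = _ := by norm_num
    have hm : m ≤ 2 := by nlinarith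
    have hb := before j hj
    have hr0 := rad_pos hε hε' j
    have h3 : rad ε j * 2 ^ j ≤ 1 / 1200 := by
      unfold rad
      rw [div_mul_cancel₀ _ (by positivity), div_le_div_iff₀ (by positivity) (by norm_num)]
      nlinarith
    have h4 : (0 : ℝ) < 2 ^ j := by positivity
    calc 2 ^ j * ε < 2 ^ j * (120 * m * rad ε j) := by gcongr
      _ = 120 * m * (rad ε j * 2 ^ j) := by ring
      _ ≤ 120 * 2 * (1 / 1200) := by gcongr
      _ < 1 := by norm_num
  | constant => intro j hj; omega

theorem offset_le (hd : 1 ≤ d) (hl : 1 ≤ ell d ε δ) (i : ℕ) :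
    (offset d ε δ i : ℝ) ≤ 4 * (d * ell d ε δ * 2 ^ i) := by
  induction i with
  | zero =>
    simp only [offset, Finset.range_zero, Finset.sum_empty, Nat.cast_zero]
    have : 0 ≤ ell d ε δ := by linarith
    positivity
  | succ i ih =>
    rw [offset_succ]
    push_cast
    have := len_le hd hl i
    unfold nomLen at this
    rw [pow_succ]; linarith

theorem stages_le_Lam (hε : 0 < ε) (hε' : ε < 1 / 2) (h : ∀ j < K, 2 ^ j * ε < 1) :
    (K : ℝ) ≤ Lam ε := by
  have hx : 0 ≤ Real.log (1 / ε) := Real.log_nonneg (by rw [le_div_iff₀ hε]; linarith)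
  unfold Lam
  rcases K with _ | k
  · rw [Nat.cast_zero]; linarith
  · have h2 := h k (by omega)
    have h3 : (2 : ℝ) ^ k ≤ 1 / ε := by rw [le_div_iff₀ hε]; exact h2.le
    have h4 := Real.log_le_log (by positivity) h3
    rw [Real.log_pow] at h4
    have h5 := Real.log_two_gt_d9
    have h6 : (0 : ℝ) ≤ k := by positivity
    push_cast
    nlinarith

theorem stages_le_ceil (hε : 0 < ε) (h : ∀ j < K, 2 ^ j * ε < 1) : K ≤ ⌈1 / ε⌉₊ := by
  rcases K with _ | k
  · simp
  · have h2 := h k (by omega)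
    have h3 : (2 : ℝ) ^ k < 1 / ε := by rw [lt_div_iff₀ hε]; exact h2
    have h4 : ((k + 1 : ℕ) : ℝ) ≤ 2 ^ k := by exact_mod_cast Nat.lt_two_pow_self
    exact_mod_cast (h4.trans h3.le).trans (Nat.le_ceil _)

/-- A bound on the number of rounds. -/
def maxRounds (ε : ℝ) : ℕ := ⌈100000000000000 * Lam ε ^ 6 / ε ^ 2⌉₊ + 1

/-- Earlier rounds were not long, and `k + 1 ≤ 2^k`. The polynomial bound in `1/ε` is crude but
holds for every sample sequence, and it costs only a logarithm through `ell`. -/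
theorem Outcome.lt_maxRounds (hε : 0 < ε) {h : EuclideanSpace ℝ (Fin d) × ℝ}
    (ho : Outcome ε δ s i K h) : i < maxRounds ε := by
  have hprev : ∀ k < i, ¬ Long ε k := by
    cases ho with
    | accepted _ prev => exact fun k hk => (prev k hk).2
    | constant prev => exact fun k hk => (prev k hk).2
  unfold maxRounds
  rcases i with _ | k
  · omega
  · have h2 := hprev k (by omega)
    unfold Long at h2
    rw [not_le, ← lt_div_iff₀ (by positivity)] at h2
    have h4 : ((k + 1 : ℕ) : ℝ) ≤ 2 ^ k := by exact_mod_cast Nat.lt_two_pow_self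
    have : k + 1 ≤ ⌈100000000000000 * Lam ε ^ 6 / ε ^ 2⌉₊ := by
      exact_mod_cast (h4.trans h2.le).trans (Nat.le_ceil _)
    omega

theorem one_le_unitScale (hε : 0 < ε) (hε' : ε < 1 / 2) (h0 : 0 < η) (h1 : η < 1 / 2) {p : ℝ}
    (hp0 : 0 ≤ p) (hp : p ≤ 1) : 1 / ε + 1 ≤ unitScale ε η p := by
  have hβ : 0 < 1 - 2 * η := by linarith
  unfold unitScale
  have hM : max (p * (1 - 2 * η)) ε ≤ 1 := max_le (by nlinarith) (by linarith)
  have hM0 : 0 < max (p * (1 - 2 * η)) ε := lt_of_lt_of_le hε (le_max_right _ _)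
  gcongr ?_ + ?_
  · apply one_div_le_one_div_of_le (by positivity); nlinarith
  · rw [le_div_iff₀ (by positivity), one_mul]
    exact pow_le_one₀ hM0.le hM

/-- Block lengths grow geometrically, so the last round dominates. Its length is twice that of a
rejected, non-long round, to which `Good.two_pow_le` applies; for round 0, `unitScale ≥ 1` suffices.
The stages contribute a further factor of at most Λ. -/
theorem Good.drawn_le (hg : Good D ε δ R J s) (hd : 1 ≤ d) (hε : 0 < ε)
    (hε' : ε < 1 / 2) (hδ : 0 < δ) (hδ' : δ < 1 / 2) (hi : i < R) (hw : ‖w‖ = 1 ∨ w = 0)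
    (hD : IsRCN D (halfspace w t) η) (h0 : 0 < η) (h1 : η < 1 / 2)
    {h : EuclideanSpace ℝ (Fin d) × ℝ} (ho : Outcome ε δ s i K h) :
    ((stageOffset d ε δ i K : ℕ) : ℝ) ≤ 800000000000000 * Lam ε ^ 7 * ell d ε δ *
      sampleScale d ε η (bias (halfspace w t)) := by
  have hK := stages_le_Lam hε hε' (hg.two_pow_stage_lt hd hε hε' hδ hδ' hi hw hD h0 h1 ho)
  have hl := one_le_ell hd hε hε' hδ hδ'
  have hΛ := Lam_pos hε hε'
  have hu := one_le_unitScale hε hε' h0 h1 (bias_nonneg (halfspace w t))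
    (bias_le_one (halfspace w t))
  have hε1 : 0 < 1 / ε := by positivity
  set U := unitScale ε η (bias (halfspace w t)) with hU
  have hΛ6 : (1 : ℝ) ≤ Lam ε ^ 6 := one_le_pow₀ (by linarith)
  have hq : (2 : ℝ) ^ i ≤ 200000000000000 * Lam ε ^ 6 * U := by
    have hprev : ∀ k < i, ¬ Accept ε δ k s ∧ ¬ Long ε k := by
      cases ho with
      | accepted _ prev => exact prev
      | constant prev => exact prev
    rcases i with _ | k
    · have : 1 * 1 ≤ Lam ε ^ 6 * U := mul_le_mul hΛ6 (by linarith) (by norm_num) (by linarith)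
      rw [pow_zero]; linarith
    · have := hg.two_pow_le hd hε hε' hδ hδ' (by omega) hw hD h0 h1 (hprev k (by omega)).1
        (hprev k (by omega)).2
      rw [pow_succ]; linarith
  have hd0 : (0 : ℝ) ≤ d := by positivity
  have hoff := offset_le (ε := ε) (δ := δ) hd hl (i + 1)
  have hlen := len_le (ε := ε) (δ := δ) hd hl i
  rw [sampleScale_eq, ← hU, stageOffset]
  push_cast
  unfold nomLen at hlen
  have hn0 : 0 ≤ (d : ℝ) * ell d ε δ * 2 ^ i := by positivity
  have h2 : (K : ℝ) * len d ε δ i ≤ Lam ε * (2 * (d * ell d ε δ * 2 ^ i)) := by gcongr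
  have h3 : 8 * (d * ell d ε δ * 2 ^ i) ≤ 2 * Lam ε * (d * ell d ε δ * 2 ^ i) := by
    gcongr; linarith
  rw [pow_succ] at hoff
  calc (offset d ε δ (i + 1) : ℝ) + K * len d ε δ i ≤ 4 * Lam ε * (d * ell d ε δ * 2 ^ i) := by
        linarith
    _ ≤ 4 * Lam ε * (d * ell d ε δ * (200000000000000 * Lam ε ^ 6 * U)) := by
        have : 0 ≤ ell d ε δ := by linarith
        gcongr
    _ = _ := by ring

/-- Both `1/ε` and `d/ε` are at most `A`, so each of the seven factors Λ costs one `log A` and `ell`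
costs `log A · log(1/δ)`. This is the exponent 8. -/
theorem scales_le (hd : 1 ≤ d) (hε : 0 < ε) (hε' : ε < 1 / 2) (hδ : 0 < δ) (hδ' : δ < 1 / 2)
    {A : ℝ} (hA : d * (1 / ε + 1) ≤ A) :
    800000000000000 * Lam ε ^ 7 * ell d ε δ * A ≤ 500000000000000000000000 * (A * Real.log A ^ 8 * Real.log (1 / δ)) := by
  have hd' : (1 : ℝ) ≤ d := by exact_mod_cast hd
  have hε2 : 2 ≤ 1 / ε := by rw [le_div_iff₀ hε]; linarith
  have hdε : (d : ℝ) / ε ≤ A := by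
    have : (d : ℝ) / ε = d * (1 / ε) := by ring
    nlinarith
  have hAε : 1 / ε ≤ A := by nlinarith
  have hA3 : 3 ≤ A := by nlinarith
  have hlog1 : 1 ≤ Real.log A := by
    rw [Real.le_log_iff_exp_le (by linarith)]; linarith [Real.exp_one_lt_d9]
  have hlδ : 0.69 ≤ Real.log (1 / δ) := by
    have : (2 : ℝ) ≤ 1 / δ := by rw [le_div_iff₀ hδ]; linarith
    have := Real.log_le_log (by norm_num) this
    linarith [Real.log_two_gt_d9]
  have hΛ : Lam ε ≤ 8 * Real.log A := by
    have := Real.log_le_log (by positivity) hAε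
    unfold Lam; linarith
  have hΛ0 := Lam_pos hε hε'
  have hℓ : ell d ε δ ≤ 240 * (Real.log A * Real.log (1 / δ)) := by
    have e : 10 * d / (ε * δ) = 10 * (d / ε) * (1 / δ) := by field_simp
    have h10 : Real.log 10 ≤ 2.4 := by
      have : Real.log 10 ≤ Real.log (2 ^ 3 * (5 / 4)) := by norm_num
      rw [Real.log_mul (by norm_num) (by norm_num), Real.log_pow] at this
      have h2 := Real.log_two_lt_d9
      have h3 := Real.log_le_sub_one_of_pos (show (0 : ℝ) < 5 / 4 by norm_num)
      push_cast at this; linarith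
    have h2 := Real.log_le_log (by positivity) hdε
    unfold ell
    rw [e, Real.log_mul (by positivity) (by positivity), Real.log_mul (by norm_num) (by positivity)]
    nlinarith
  have hℓ0 := one_le_ell hd hε hε' hδ hδ'
  calc 800000000000000 * Lam ε ^ 7 * ell d ε δ * A
      ≤ 800000000000000 * (8 * Real.log A) ^ 7 * (240 * (Real.log A * Real.log (1 / δ))) * A := by
        gcongr
    _ = 800000000000000 * 8 ^ 7 * 240 * (A * Real.log A ^ 8 * Real.log (1 / δ)) := by ring
    _ ≤ _ := by gcongr; norm_num

theorem measure_not_good_le_delta (hd : 1 ≤ d) {f : EuclideanSpace ℝ (Fin d) → ℤˣ}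
    (hD : IsRCN D f η) (hε : 0 < ε) (hε' : ε < 1 / 2) (hδ : 0 < δ) (hδ' : δ < 1 / 2) :
    Measure.infinitePi (fun _ : ℕ => D) {s | ¬ Good D ε δ (maxRounds ε) ⌈1 / ε⌉₊ s} ≤
      ENNReal.ofReal δ := by
  refine (measure_not_good_le hd hD hε hε' hδ hδ' _ _).trans ?_
  rw [← ENNReal.ofReal_natCast, ← ENNReal.ofReal_mul (by positivity)]
  apply ENNReal.ofReal_le_ofReal
  have hd' : (1 : ℝ) ≤ d := by exact_mod_cast hd
  have hε2 : 2 ≤ 1 / ε := by rw [le_div_iff₀ hε]; linarith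
  set x := 1 / ε with hx
  have hΛ : Lam ε ≤ 4 * x := by
    have := Real.log_le_sub_one_of_pos (show 0 < 1 / ε by positivity)
    unfold Lam; linarith
  have hΛ0 := Lam_pos hε hε'
  have hJ : (⌈x⌉₊ : ℝ) ≤ 2 * x := by
    have := Nat.ceil_lt_add_one (show 0 ≤ x by linarith); linarith
  have hx8 : (1 : ℝ) ≤ x ^ 8 := one_le_pow₀ (by linarith)
  have hR : (maxRounds ε : ℝ) ≤ 500000000000000000 * x ^ 8 := by
    unfold maxRounds
    have e : 100000000000000 * Lam ε ^ 6 / ε ^ 2 = 100000000000000 * Lam ε ^ 6 * x ^ 2 := by rw [hx]; field_simp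
    rw [e]
    have h2 := Nat.ceil_lt_add_one (show 0 ≤ 100000000000000 * Lam ε ^ 6 * x ^ 2 by positivity)
    have h3 : 100000000000000 * Lam ε ^ 6 * x ^ 2 ≤ 100000000000000 * (4 * x) ^ 6 * x ^ 2 := by gcongr
    have h4 : 100000000000000 * (4 * x) ^ 6 * x ^ 2 = 100000000000000 * 4096 * x ^ 8 := by ring
    push_cast
    linarith
  set y := ε * δ / (10 * d) with hy
  have hy0 : 0 < y := by positivity
  -- The factor 40 in `ell` pays for the union bound: nine powers of `y` cancel those of `1/ε` and
  -- the factor `d`, thirty absorb the numerical constant, and one gives `δ`.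
  have hexp : Real.exp (-ell d ε δ) = y ^ 40 := by
    have : -ell d ε δ = (40 : ℕ) * Real.log y := by
      rw [hy, ← inv_div, Real.log_inv]; unfold ell; push_cast; ring
    rw [this, Real.exp_nat_mul, Real.exp_log hy0]
  have hyδ : y ≤ δ := by
    rw [hy, div_le_iff₀ (by positivity)]; nlinarith
  have hy1 : y ≤ 1 / 10 := by
    rw [hy, div_le_div_iff₀ (by positivity) (by norm_num)]; nlinarith
  have hxy : x * y * d ≤ 1 := by
    have : x * y * d = δ / 10 := by rw [hx, hy]; field_simp
    rw [this]; linarith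
  have hxy1 : x * y ≤ 1 := by
    have : 0 < x * y := by positivity
    nlinarith
  rw [hexp]
  push_cast
  have h1 : ((d : ℝ) + 1 + (1 + ⌈x⌉₊ * (d + 1))) ≤ 6 * (d * x) := by
    have : (⌈x⌉₊ : ℝ) * (d + 1) ≤ 2 * x * (2 * d) := by gcongr; linarith
    nlinarith
  calc (maxRounds ε : ℝ) * ((d : ℝ) + 1 + (1 + ⌈x⌉₊ * (d + 1))) * (2 * y ^ 40)
      ≤ 500000000000000000 * x ^ 8 * (6 * (d * x)) * (2 * y ^ 40) := by gcongr
    _ = 6000000000000000000 * ((x * y) ^ 8 * (x * y * d)) * (y ^ 30 * y) := by ring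
    _ ≤ 6000000000000000000 * (1 ^ 8 * 1) * ((1 / 10) ^ 30 * δ) := by gcongr
    _ ≤ δ := by nlinarith

end SampleCount

/-! ### Programs -/

namespace RealRAM

section Machine

variable {d : ℕ} {s : ℕ → EuclideanSpace ℝ (Fin d) × ℤˣ}

/-- Execution within a time bound. -/
def Within (s : ℕ → EuclideanSpace ℝ (Fin d) × ℤˣ) (c : Prog) (σ σ' : State) (B : ℕ) : Prop :=
  ∃ T ≤ B, Exec s c σ σ' T

theorem Within.mono {c : Prog} {σ σ' : State} {B B' : ℕ} (h : Within s c σ σ' B) (hB : B ≤ B') :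
    Within s c σ σ' B' := by
  obtain ⟨T, hT, h⟩ := h
  exact ⟨T, hT.trans hB, h⟩

theorem Within.seq {c₁ c₂ : Prog} {σ₀ σ₁ σ₂ : State} {B₁ B₂ : ℕ} (h₁ : Within s c₁ σ₀ σ₁ B₁)
    (h₂ : Within s c₂ σ₁ σ₂ B₂) : Within s (.seq c₁ c₂) σ₀ σ₂ (B₁ + B₂) := by
  obtain ⟨T₁, hT₁, h₁⟩ := h₁
  obtain ⟨T₂, hT₂, h₂⟩ := h₂
  exact ⟨T₁ + T₂, by omega, h₁.seq h₂⟩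

theorem Within.iteTrue {b : BExp} {c₁ c₂ : Prog} {σ σ' : State} {B : ℕ} (hb : b.holds σ)
    (h : Within s c₁ σ σ' B) : Within s (.ite b c₁ c₂) σ σ' (b.cost + B) := by
  obtain ⟨T, hT, h⟩ := h
  exact ⟨b.cost + T, by omega, h.iteTrue hb⟩

theorem Within.iteFalse {b : BExp} {c₁ c₂ : Prog} {σ σ' : State} {B : ℕ} (hb : ¬ b.holds σ)
    (h : Within s c₂ σ σ' B) : Within s (.ite b c₁ c₂) σ σ' (b.cost + B) := by
  obtain ⟨T, hT, h⟩ := h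
  exact ⟨b.cost + T, by omega, h.iteFalse hb⟩

theorem Within.whileFalse {b : BExp} {c : Prog} {σ : State} (hb : ¬ b.holds σ) :
    Within s (.while b c) σ σ b.cost := ⟨_, le_rfl, .whileFalse hb⟩

theorem Within.whileTrue {b : BExp} {c : Prog} {σ₀ σ₁ σ₂ : State} {B₁ B₂ : ℕ} (hb : b.holds σ₀)
    (h₁ : Within s c σ₀ σ₁ B₁) (h₂ : Within s (.while b c) σ₁ σ₂ B₂) :
    Within s (.while b c) σ₀ σ₂ (b.cost + B₁ + B₂) := by
  obtain ⟨T₁, hT₁, h₁⟩ := h₁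
  obtain ⟨T₂, hT₂, h₂⟩ := h₂
  exact ⟨b.cost + T₁ + T₂, by omega, .whileTrue hb h₁ h₂⟩

/-- A loop that runs through the states `f 0, …, f n`. -/
theorem Within.while_chain {b : BExp} {c : Prog} {n : ℕ} (f : ℕ → State) {B : ℕ}
    (hb : ∀ j < n, b.holds (f j)) (hn : ¬ b.holds (f n))
    (hc : ∀ j < n, Within s c (f j) (f (j + 1)) B) :
    Within s (.while b c) (f 0) (f n) (n * (b.cost + B) + b.cost) := by
  suffices h : ∀ k ≤ n, Within s (.while b c) (f (n - k)) (f n) (k * (b.cost + B) + b.cost) by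
    simpa using h n le_rfl
  intro k
  induction k with
  | zero => intro _; simpa using Within.whileFalse hn
  | succ k ih =>
    intro hk
    have e : n - (k + 1) + 1 = n - k := by omega
    have h₁ := hc (n - (k + 1)) (by omega)
    rw [e] at h₁
    refine (Within.whileTrue (hb _ (by omega)) h₁ (ih (by omega))).mono (le_of_eq ?_)
    ring

/-- The real memory: a hypothesis `V`, an example `X`, an accumulator `A`, two working cells and
the scalars `S`. -/
def mem (d : ℕ) (V X A : ℕ → ℝ) (p g : ℝ) (S : ℕ → ℝ) (j : ℕ) : ℝ :=
  if j < d + 1 then V j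
  else if j < 2 * (d + 1) then X (j - (d + 1))
  else if j < 3 * (d + 1) then A (j - 2 * (d + 1))
  else if j = 3 * (d + 1) then p
  else if j = 3 * (d + 1) + 1 then g
  else S (j - (3 * (d + 1) + 2))

/-- The natural-number memory: the dimension, a loop index, a counter and a flag. -/
def nats (d i c f j : ℕ) : ℕ :=
  if j = 0 then d else if j = 1 then i else if j = 2 then c else if j = 3 then f else 0

/-- The machine states that occur. -/
def st (d : ℕ) (V X A : ℕ → ℝ) (p g : ℝ) (S : ℕ → ℝ) (i c f N : ℕ) : State where
  nmem := nats d i c f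
  rmem := mem d V X A p g S
  drawn := N

variable {V X A S : ℕ → ℝ} {p g r : ℝ} {i c f N j k : ℕ}

/-- Only the first `d + 1` values of the functions `V` and `A` are stored; loop invariants may
therefore use total functions with any values beyond. -/
theorem mem_congr {V' A' : ℕ → ℝ} (hV : ∀ j < d + 1, V j = V' j) (hA : ∀ j < d + 1, A j = A' j) :
    mem d V X A p g S = mem d V' X A' p g S := by
  funext j
  unfold mem
  split_ifs
  · exact hV j ‹_›
  · rfl
  · exact hA _ (by omega)
  · rfl
  · rfl
  · rfl

theorem st_congr {V' A' : ℕ → ℝ} (hV : ∀ j < d + 1, V j = V' j) (hA : ∀ j < d + 1, A j = A' j) :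
    st d V X A p g S i c f N = st d V' X A' p g S i c f N := by
  unfold st; rw [mem_congr hV hA]

theorem mem_V (hj : j < d + 1) : mem d V X A p g S j = V j := by simp [mem, hj]

theorem mem_X (hj : j < d + 1) : mem d V X A p g S (d + 1 + j) = X j := by
  unfold mem
  rw [if_neg (by omega), if_pos (by omega)]; congr 1; omega

theorem mem_A (hj : j < d + 1) : mem d V X A p g S (2 * (d + 1) + j) = A j := by
  unfold mem
  rw [if_neg (by omega), if_neg (by omega), if_pos (by omega)]; congr 1; omega

theorem mem_p : mem d V X A p g S (3 * (d + 1)) = p := by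
  unfold mem
  rw [if_neg (by omega), if_neg (by omega), if_neg (by omega), if_pos rfl]

theorem mem_g : mem d V X A p g S (3 * (d + 1) + 1) = g := by
  unfold mem
  rw [if_neg (by omega), if_neg (by omega), if_neg (by omega), if_neg (by omega), if_pos rfl]

theorem mem_S : mem d V X A p g S (3 * (d + 1) + (k + 2)) = S k := by
  unfold mem
  rw [if_neg (by omega), if_neg (by omega), if_neg (by omega), if_neg (by omega),
    if_neg (by omega)]; congr 1; omega

theorem update_mem_V (hj : j < d + 1) :
    Function.update (mem d V X A p g S) j r = mem d (Function.update V j r) X A p g S := by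
  funext l
  by_cases h : l = j
  · subst h; simp [mem_V hj]
  · rw [Function.update_of_ne h]; unfold mem; rw [Function.update_of_ne h]

theorem update_mem_A (hj : j < d + 1) :
    Function.update (mem d V X A p g S) (2 * (d + 1) + j) r =
      mem d V X (Function.update A j r) p g S := by
  funext l
  by_cases h : l = 2 * (d + 1) + j
  · subst h; simp [mem_A hj]
  · rw [Function.update_of_ne h]; unfold mem
    split_ifs <;> try rfl
    rw [Function.update_of_ne (by omega)]

theorem update_mem_p :
    Function.update (mem d V X A p g S) (3 * (d + 1)) r = mem d V X A r g S := by
  funext l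
  by_cases h : l = 3 * (d + 1)
  · subst h; simp [mem_p]
  · rw [Function.update_of_ne h]; simp only [mem, if_neg h]

theorem update_mem_g :
    Function.update (mem d V X A p g S) (3 * (d + 1) + 1) r = mem d V X A p r S := by
  funext l
  by_cases h : l = 3 * (d + 1) + 1
  · subst h; simp [mem_g]
  · rw [Function.update_of_ne h]; simp only [mem, if_neg h]

theorem update_mem_S :
    Function.update (mem d V X A p g S) (3 * (d + 1) + (k + 2)) r =
      mem d V X A p g (Function.update S k r) := by
  funext l
  by_cases h : l = 3 * (d + 1) + (k + 2)
  · subst h; simp [mem_S]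
  · rw [Function.update_of_ne h]; unfold mem
    split_ifs <;> try rfl
    rw [Function.update_of_ne (by omega)]

/-- The coordinates of an example, followed by its label. -/
def coords (z : EuclideanSpace ℝ (Fin d) × ℤˣ) (j : ℕ) : ℝ :=
  if h : j < d then z.1 ⟨j, h⟩ else ((z.2 : ℤ) : ℝ)

theorem writeExample_mem (z : EuclideanSpace ℝ (Fin d) × ℤˣ) :
    writeExample (mem d V X A p g S) (d + 1) z = mem d V (coords z) A p g S := by
  funext l
  unfold writeExample
  split_ifs with h1 h2
  · obtain ⟨j, rfl⟩ := Nat.exists_eq_add_of_le h1.1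
    rw [mem_X (by omega), coords, dif_pos (by omega)]
    exact congrArg z.1.ofLp (Fin.ext (by dsimp only; omega))
  · subst h2; rw [mem_X (by omega), coords, dif_neg (by omega)]
  · unfold mem
    split_ifs <;> first | rfl | omega

theorem update_nats_idx : Function.update (nats d i c f) 1 k = nats d k c f := by
  funext j
  by_cases h : j = 1
  · subst h; simp [nats]
  · rw [Function.update_of_ne h]; simp [nats, h]

theorem update_nats_cnt : Function.update (nats d i c f) 2 k = nats d i k f := by
  funext j
  by_cases h : j = 2
  · subst h; simp [nats]
  · rw [Function.update_of_ne h]; simp [nats, h]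

theorem update_nats_flag : Function.update (nats d i c f) 3 k = nats d i c k := by
  funext j
  by_cases h : j = 3
  · subst h; simp [nats]
  · rw [Function.update_of_ne h]; simp [nats, h]

/-! #### Expressions for the parts of the memory -/

/-- The dimension. -/
def nD : NExp := .read (.lit 0)
/-- The dimension plus one. -/
def nE : NExp := .add nD (.lit 1)
/-- The loop index. -/
def nI : NExp := .read (.lit 1)
/-- The counter. -/
def nC : NExp := .read (.lit 2)
/-- The flag. -/
def nF : NExp := .read (.lit 3)
/-- Address of a component of the example. -/
def aX (e : NExp) : NExp := .add nE e
/-- Address of a component of the accumulator. -/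
def aA (e : NExp) : NExp := .add (.mul (.lit 2) nE) e
/-- Address of the first working cell. -/
def aP : NExp := .mul (.lit 3) nE
/-- Address of the second working cell. -/
def aG : NExp := .add (.mul (.lit 3) nE) (.lit 1)
/-- Address of a scalar. -/
def aS (k : ℕ) : NExp := .add (.mul (.lit 3) nE) (.lit (k + 2))
/-- A component of the hypothesis. -/
def rV (e : NExp) : RExp := .read e
/-- A component of the example. -/
def rX (e : NExp) : RExp := .read (aX e)
/-- A component of the accumulator. -/
def rA (e : NExp) : RExp := .read (aA e)
/-- The first working cell. -/
def rP : RExp := .read aP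
/-- The second working cell. -/
def rG : RExp := .read aG
/-- A scalar. -/
def rS (k : ℕ) : RExp := .read (aS k)
/-- A numeral. -/
def rN (k : ℕ) : RExp := .cast (.lit k)

@[simp] theorem eval_nD : nD.eval (st d V X A p g S i c f N) = d := rfl
@[simp] theorem eval_nE : nE.eval (st d V X A p g S i c f N) = d + 1 := rfl
@[simp] theorem eval_nI : nI.eval (st d V X A p g S i c f N) = i := rfl
@[simp] theorem eval_nC : nC.eval (st d V X A p g S i c f N) = c := rfl
@[simp] theorem eval_nF : nF.eval (st d V X A p g S i c f N) = f := rfl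
@[simp] theorem eval_rP : rP.eval (st d V X A p g S i c f N) = p := mem_p
@[simp] theorem eval_rG : rG.eval (st d V X A p g S i c f N) = g := mem_g
@[simp] theorem eval_rS : (rS k).eval (st d V X A p g S i c f N) = S k := mem_S
@[simp] theorem eval_rN (σ : State) : (rN k).eval σ = k := rfl
theorem eval_rV_idx (hi : i < d + 1) : (rV nI).eval (st d V X A p g S i c f N) = V i := mem_V hi
@[simp] theorem eval_rV_last : (rV nD).eval (st d V X A p g S i c f N) = V d := mem_V (by simp)
theorem eval_rX_idx (hi : i < d + 1) : (rX nI).eval (st d V X A p g S i c f N) = X i := mem_X hi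
@[simp] theorem eval_rX_last : (rX nD).eval (st d V X A p g S i c f N) = X d := mem_X (by simp)
theorem eval_rA_idx (hi : i < d + 1) : (rA nI).eval (st d V X A p g S i c f N) = A i := mem_A hi
@[simp] theorem eval_rA_last : (rA nD).eval (st d V X A p g S i c f N) = A d := mem_A (by simp)

/-! #### Assignments -/

/-- Assignment to a component of the hypothesis. -/
def setV (a : NExp) (e : RExp) : Prog := .setR a e
/-- Assignment to a component of the accumulator. -/
def setA (a : NExp) (e : RExp) : Prog := .setR (aA a) e
/-- Assignment to the first working cell. -/
def setP (e : RExp) : Prog := .setR aP e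
/-- Assignment to the second working cell. -/
def setG (e : RExp) : Prog := .setR aG e
/-- Assignment to a scalar. -/
def setS (k : ℕ) (e : RExp) : Prog := .setR (aS k) e

theorem within_setR {a : NExp} {e : RExp} {σ σ' : State} (ha : a.cost ≤ 19)
    (h : { σ with rmem := Function.update σ.rmem (a.eval σ) (e.eval σ) } = σ') :
    Within s (.setR a e) σ σ' (e.cost + 20) :=
  ⟨_, by omega, h ▸ Exec.setR a e σ⟩

theorem within_setN {a e : NExp} {σ σ' : State} (ha : a.cost ≤ 19)
    (h : { σ with nmem := Function.update σ.nmem (a.eval σ) (e.eval σ) } = σ') :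
    Within s (.setN a e) σ σ' (e.cost + 20) :=
  ⟨_, by omega, h ▸ Exec.setN a e σ⟩

theorem within_setV_idx {e : RExp} (hi : i < d + 1)
    (he : e.eval (st d V X A p g S i c f N) = r) :
    Within s (setV nI e) (st d V X A p g S i c f N) (st d (Function.update V i r) X A p g S i c f N) (e.cost + 20) :=
  within_setR (by decide) (by
    rw [he]
    exact congrArg (State.mk (nats d i c f) · N) (update_mem_V hi))

theorem within_setV_last {e : RExp} (he : e.eval (st d V X A p g S i c f N) = r) :
    Within s (setV nD e) (st d V X A p g S i c f N) (st d (Function.update V d r) X A p g S i c f N) (e.cost + 20) :=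
  within_setR (by decide) (by
    rw [he]
    exact congrArg (State.mk (nats d i c f) · N) (update_mem_V d.lt_succ_self))

theorem within_setA_idx {e : RExp} (hi : i < d + 1)
    (he : e.eval (st d V X A p g S i c f N) = r) :
    Within s (setA nI e) (st d V X A p g S i c f N) (st d V X (Function.update A i r) p g S i c f N) (e.cost + 20) :=
  within_setR (by decide) (by
    rw [he]
    exact congrArg (State.mk (nats d i c f) · N) (update_mem_A hi))

theorem within_setA_last {e : RExp} (he : e.eval (st d V X A p g S i c f N) = r) :
    Within s (setA nD e) (st d V X A p g S i c f N) (st d V X (Function.update A d r) p g S i c f N) (e.cost + 20) :=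
  within_setR (by decide) (by
    rw [he]
    exact congrArg (State.mk (nats d i c f) · N) (update_mem_A d.lt_succ_self))

theorem within_setP {e : RExp} (he : e.eval (st d V X A p g S i c f N) = r) :
    Within s (setP e) (st d V X A p g S i c f N) (st d V X A r g S i c f N) (e.cost + 20) :=
  within_setR (by decide) (by
    rw [he]
    exact congrArg (State.mk (nats d i c f) · N) (update_mem_p))

theorem within_setG {e : RExp} (he : e.eval (st d V X A p g S i c f N) = r) :
    Within s (setG e) (st d V X A p g S i c f N) (st d V X A p r S i c f N) (e.cost + 20) :=
  within_setR (by decide) (by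
    rw [he]
    exact congrArg (State.mk (nats d i c f) · N) (update_mem_g))

theorem within_setS {e : RExp} (he : e.eval (st d V X A p g S i c f N) = r) :
    Within s (setS k e) (st d V X A p g S i c f N) (st d V X A p g (Function.update S k r) i c f N) (e.cost + 20) :=
  within_setR (by simp [aS, nE, nD, NExp.cost]) (by
    rw [he]
    exact congrArg (State.mk (nats d i c f) · N) (update_mem_S))

theorem within_setIdx {e : NExp} (he : e.eval (st d V X A p g S i c f N) = k) :
    Within s (.setN (.lit 1) e) (st d V X A p g S i c f N) (st d V X A p g S k c f N) (e.cost + 20) :=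
  within_setN (by decide) (by
    rw [he]
    exact congrArg (State.mk · (mem d V X A p g S) N) update_nats_idx)

theorem within_setCnt {e : NExp} (he : e.eval (st d V X A p g S i c f N) = k) :
    Within s (.setN (.lit 2) e) (st d V X A p g S i c f N) (st d V X A p g S i k f N) (e.cost + 20) :=
  within_setN (by decide) (by
    rw [he]
    exact congrArg (State.mk · (mem d V X A p g S) N) update_nats_cnt)

theorem within_setFlag {e : NExp} (he : e.eval (st d V X A p g S i c f N) = k) :
    Within s (.setN (.lit 3) e) (st d V X A p g S i c f N) (st d V X A p g S i c k N) (e.cost + 20) :=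
  within_setN (by decide) (by
    rw [he]
    exact congrArg (State.mk · (mem d V X A p g S) N) update_nats_flag)

theorem within_draw : Within s (.draw nE) (st d V X A p g S i c f N)
    (st d V (coords (s N)) A p g S i c f (N + 1)) (d + 20) := by
  have h := Exec.draw (s := s) nE (st d V X A p g S i c f N)
  have e : nE.cost = 4 := rfl
  rw [e] at h
  refine ⟨4 + d + 1, by omega, ?_⟩
  convert h using 1
  exact congrArg (State.mk (nats d i c f) · (N + 1)) (writeExample_mem (X := X) (s N)).symm

end Machine

end RealRAM

/-! ### Loops over coordinates and passes over samples. -/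

namespace RealRAM

section Loops

variable {d : ℕ} {s : ℕ → EuclideanSpace ℝ (Fin d) × ℤˣ}
variable {V X A S : ℕ → ℝ} {p g r : ℝ} {i c f N j k n : ℕ}

/-- A loop over the indices below `b`. -/
def forN (b : NExp) (body : Prog) : Prog :=
  .seq (.setN (.lit 1) (.lit 0))
    (.while (.ltN nI b) (.seq body (.setN (.lit 1) (.add nI (.lit 1)))))

/-- The families `V'`, `A'`, `p'` describe the memory after `j` iterations. The bound `b` must be
insensitive to what the body changes, and the body must leave the index alone. -/
theorem within_forN {b : NExp} (hbc : b.cost ≤ 4)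
    (hb : ∀ V A p i, b.eval (st d V X A p g S i c f N) = n) {body : Prog} {B : ℕ}
    (V' A' : ℕ → ℕ → ℝ) (p' : ℕ → ℝ)
    (hbody : ∀ j < n, Within s body (st d (V' j) X (A' j) (p' j) g S j c f N)
      (st d (V' (j + 1)) X (A' (j + 1)) (p' (j + 1)) g S j c f N) B) :
    Within s (forN b body) (st d (V' 0) X (A' 0) (p' 0) g S i c f N)
      (st d (V' n) X (A' n) (p' n) g S n c f N) (n * (B + 40) + 40) := by
  have h1 : Within s (.setN (.lit 1) (.lit 0)) (st d (V' 0) X (A' 0) (p' 0) g S i c f N)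
      (st d (V' 0) X (A' 0) (p' 0) g S 0 c f N) _ := within_setIdx rfl
  have h2 := Within.while_chain (s := s) (b := .ltN nI b)
    (c := .seq body (.setN (.lit 1) (.add nI (.lit 1)))) (n := n)
    (fun j => st d (V' j) X (A' j) (p' j) g S j c f N)
    (fun j hj => by simpa [BExp.holds, hb] using hj) (by simp [BExp.holds, hb])
    (fun j hj => (hbody j hj).seq (within_setIdx (by simp [NExp.eval])))
  refine (h1.seq h2).mono ?_
  have e1 : (NExp.add nI (.lit 1)).cost = 4 := rfl
  have e2 : (BExp.ltN nI b).cost = 3 + b.cost := by simp [BExp.cost, nI, NExp.cost]; omega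
  have e3 : (NExp.lit 0).cost = 1 := rfl
  rw [e1, e2, e3]
  have := Nat.mul_le_mul_left n (show 3 + b.cost + (B + (4 + 20)) ≤ B + 40 by omega)
  omega

/-- Assign to every component of the hypothesis. -/
def mapV (e : RExp) : Prog := forN nE (setV nI e)

theorem within_mapV {e : RExp} (F : ℕ → ℝ) (he : ∀ j < d + 1, ∀ V' : ℕ → ℝ, V' j = V j →
      e.eval (st d V' X A p g S j c f N) = F j) :
    Within s (mapV e) (st d V X A p g S i c f N) (st d F X A p g S (d + 1) c f N)
      ((d + 1) * (e.cost + 60) + 40) := by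
  have h := within_forN (d := d) (s := s) (X := X) (g := g) (S := S) (i := i) (c := c) (f := f)
    (N := N) (b := nE) (n := d + 1) (by decide) (fun _ _ _ _ => rfl) (body := setV nI e)
    (fun j k => if k < j then F k else V k) (fun _ => A) (fun _ => p) (fun j hj => by
      have h := within_setV_idx (s := s) (e := e) (X := X) (A := A) (p := p) (g := g) (S := S)
        (c := c) (f := f) (N := N) hj
        (he j hj (fun k => if k < j then F k else V k) (by simp))
      convert h using 2
      funext k
      by_cases hk : k = j
      · subst hk; simp
      · rw [Function.update_of_ne hk]
        simp only [show k < j + 1 ↔ k < j by omega])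
  have e1 : st d (fun k => if k < 0 then F k else V k) X A p g S i c f N =
    st d V X A p g S i c f N := st_congr (fun j _ => by simp) (fun _ _ => rfl)
  have e2 : st d (fun k => if k < d + 1 then F k else V k) X A p g S (d + 1) c f N =
    st d F X A p g S (d + 1) c f N := st_congr (fun j hj => by simp [hj]) (fun _ _ => rfl)
  rw [e1, e2] at h
  exact h

/-- Assign to the components of the accumulator with an index below `b`. -/
def mapA (b : NExp) (e : RExp) : Prog := forN b (setA nI e)

theorem within_mapA {b : NExp} (hbc : b.cost ≤ 4)
    (hb : ∀ V A p i, b.eval (st d V X A p g S i c f N) = n) (hn : n ≤ d + 1) {e : RExp}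
    (F : ℕ → ℝ) (he : ∀ j < n, ∀ A' : ℕ → ℝ, A' j = A j →
      e.eval (st d V X A' p g S j c f N) = F j) (hF : ∀ j, n ≤ j → j < d + 1 → F j = A j) :
    Within s (mapA b e) (st d V X A p g S i c f N) (st d V X F p g S n c f N)
      ((d + 1) * (e.cost + 60) + 40) := by
  have h := within_forN (d := d) (s := s) (X := X) (g := g) (S := S) (i := i) (c := c) (f := f)
    (N := N) (b := b) (n := n) hbc hb (body := setA nI e)
    (fun _ => V) (fun j k => if k < j then F k else A k) (fun _ => p) (fun j hj => by
      have h := within_setA_idx (s := s) (e := e) (X := X) (V := V) (p := p) (g := g) (S := S)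
        (c := c) (f := f) (N := N) (hj.trans_le hn)
        (he j hj (fun k => if k < j then F k else A k) (by simp))
      convert h using 2
      funext k
      by_cases hk : k = j
      · subst hk; simp
      · rw [Function.update_of_ne hk]
        simp only [show k < j + 1 ↔ k < j by omega])
  have e1 : st d V X (fun k => if k < 0 then F k else A k) p g S i c f N =
    st d V X A p g S i c f N := st_congr (fun _ _ => rfl) (fun j _ => by simp)
  have e2 : st d V X (fun k => if k < n then F k else A k) p g S n c f N =
    st d V X F p g S n c f N := st_congr (fun _ _ => rfl) (fun j hj => by
      by_cases h : j < n
      · simp [h]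
      · simp [h, hF j (by omega) hj])
  rw [e1, e2] at h
  refine h.mono ?_
  have : n * (e.cost + 20 + 40) ≤ (d + 1) * (e.cost + 60) := by gcongr
  omega

/-- Put a sum over the coordinates into the first working cell. -/
def sumP (e : RExp) : Prog := .seq (setP (rN 0)) (forN nD (setP (.add rP e)))

theorem within_sumP {e : RExp} (F : ℕ → ℝ) (he : ∀ j < d, ∀ p' : ℝ,
      e.eval (st d V X A p' g S j c f N) = F j) :
    Within s (sumP e) (st d V X A p g S i c f N)
      (st d V X A (∑ j ∈ Finset.range d, F j) g S d c f N) ((d + 1) * (e.cost + 80) + 70) := by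
  have h0 : Within s (setP (rN 0)) (st d V X A p g S i c f N) (st d V X A 0 g S i c f N) _ :=
    within_setP (by simp)
  have h := within_forN (d := d) (s := s) (X := X) (g := g) (S := S) (i := i) (c := c) (f := f)
    (N := N) (b := nD) (n := d) (by decide) (fun _ _ _ _ => rfl) (body := setP (.add rP e))
    (fun _ => V) (fun _ => A) (fun j => ∑ k ∈ Finset.range j, F k) (fun j hj => by
      refine within_setP ?_
      simp only [RExp.eval, eval_rP, he j hj]
      rw [Finset.sum_range_succ])
  simp only [Finset.range_zero, Finset.sum_empty] at h
  refine (h0.seq h).mono ?_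
  have e1 : (rN 0).cost = 2 := rfl
  have e2 : (RExp.add rP e).cost = 8 + e.cost := by
    simp [RExp.cost, rP, aP, nE, nD, NExp.cost]; omega
  rw [e1, e2]
  have : d * (8 + e.cost + 20 + 40) ≤ (d + 1) * (e.cost + 80) :=
    Nat.mul_le_mul (by omega) (by omega)
  omega

/-- The vector part of the hypothesis. -/
def vec (d : ℕ) (V : ℕ → ℝ) : EuclideanSpace ℝ (Fin d) := WithLp.toLp 2 fun j => V j

theorem inner_vec (V : ℕ → ℝ) (z : EuclideanSpace ℝ (Fin d) × ℤˣ) :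
    ⟪vec d V, z.1⟫ = ∑ j ∈ Finset.range d, V j * coords z j := by
  rw [Finset.sum_range, PiLp.inner_apply]
  refine Finset.sum_congr rfl fun j _ => ?_
  simp [vec, coords, mul_comm]

theorem norm_vec (V : ℕ → ℝ) :
    ‖vec d V‖ = Real.sqrt (∑ j ∈ Finset.range d, V j * V j) := by
  rw [EuclideanSpace.norm_eq, Finset.sum_range]
  congr 1
  refine Finset.sum_congr rfl fun j _ => ?_
  simp [vec, sq]

/-- The sums accumulated in a pass over `n` examples. -/
def sums (W : ℝ → ℝ) (v : EuclideanSpace ℝ (Fin d)) (o n : ℕ)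
    (s : ℕ → EuclideanSpace ℝ (Fin d) × ℤˣ) (j : ℕ) : ℝ :=
  ∑ k ∈ Finset.range n, label (s (o + k)) * W ⟪v, (s (o + k)).1⟫ *
    (if h : j < d then perp v (s (o + k)).1 ⟨j, h⟩ else 1)

theorem sums_div_last (W : ℝ → ℝ) (v : EuclideanSpace ℝ (Fin d)) (o n : ℕ) :
    sums W v o n s d / n = scAvg W v o n s := by
  unfold sums scAvg
  simp [div_eq_inv_mul]

theorem sums_div_coord (W : ℝ → ℝ) (v : EuclideanSpace ℝ (Fin d)) (o n : ℕ) (j : Fin d) :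
    sums W v o n s j / n = vecAvg W v o n s j := by
  unfold sums vecAvg
  simp [div_eq_inv_mul]

/-- The part of a pass that treats one example, with the weight computed by `w`. -/
def passBody (w : Prog) : Prog :=
  .seq (.draw nE) (.seq (sumP (.mul (rV nI) (rX nI))) (.seq w (.seq (setG (.mul (rX nD) rG))
    (.seq (mapA nD (.add (rA nI) (.mul rG (.sub (rX nI) (.mul (rV nI) rP)))))
      (.seq (setA nD (.add (rA nD) rG)) (.setN (.lit 2) (.add nC (.lit 1))))))))

/-- The program `w` computes the weight `W` of the first working cell. -/
def Computes (s : ℕ → EuclideanSpace ℝ (Fin d) × ℤˣ) (w : Prog) (V S : ℕ → ℝ) (W : ℝ → ℝ) : Prop :=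
  ∀ X A p g i c f N, Within s w (st d V X A p g S i c f N) (st d V X A p (W p) S i c f N) 200

theorem within_passBody {w : Prog} {W : ℝ → ℝ} (hw : Computes s w V S W) :
    ∃ p' g', Within s (passBody w) (st d V X A p g S i c f N)
      (st d V (coords (s N)) (fun j => A j + label (s N) * W ⟪vec d V, (s N).1⟫ *
        (if h : j < d then perp (vec d V) (s N).1 ⟨j, h⟩ else 1)) p' g' S d (c + 1) f (N + 1))
      ((d + 1) * 1000) := by
  set q := ⟪vec d V, (s N).1⟫ with hq
  set y := label (s N) * W q with hy
  set F : ℕ → ℝ := fun j => if h : j < d then A j + y * perp (vec d V) (s N).1 ⟨j, h⟩ else A j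
    with hF
  refine ⟨q, y, ?_⟩
  have h1 : Within s (.draw nE) (st d V X A p g S i c f N)
    (st d V (coords (s N)) A p g S i c f (N + 1)) _ := within_draw
  have h2 := within_sumP (s := s) (V := V) (X := coords (s N)) (A := A) (p := p) (g := g) (S := S)
    (i := i) (c := c) (f := f) (N := N + 1) (e := .mul (rV nI) (rX nI))
    (fun j => V j * coords (s N) j) (fun j hj p' => by
      simp only [RExp.eval]
      rw [eval_rV_idx (by omega), eval_rX_idx (by omega)])
  rw [← inner_vec, ← hq] at h2
  have h3 := hw (coords (s N)) A q g d c f (N + 1)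
  have h4 : Within s (setG (.mul (rX nD) rG)) (st d V (coords (s N)) A q (W q) S d c f (N + 1))
      (st d V (coords (s N)) A q y S d c f (N + 1)) _ :=
    within_setG (by
      simp only [RExp.eval, eval_rX_last, eval_rG]
      simp [coords, hy, _root_.label])
  have h5 : Within s (mapA nD (.add (rA nI) (.mul rG (.sub (rX nI) (.mul (rV nI) rP)))))
      (st d V (coords (s N)) A q y S d c f (N + 1))
      (st d V (coords (s N)) F q y S d c f (N + 1)) _ :=
    within_mapA (by decide) (fun _ _ _ _ => rfl) (by omega) F (fun j hj A' hA' => by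
      simp only [RExp.eval]
      rw [eval_rV_idx (by omega), eval_rX_idx (by omega), eval_rA_idx (by omega), eval_rG, eval_rP,
        hA']
      simp [hF, hj, perp, coords, vec, hq, mul_comm])
      (fun j hj hj' => by simp [hF, show ¬ j < d by omega])
  have h6 : Within s (setA nD (.add (rA nD) rG)) (st d V (coords (s N)) F q y S d c f (N + 1))
      (st d V (coords (s N)) (Function.update F d (A d + y)) q y S d c f (N + 1)) _ :=
    within_setA_last (by simp [RExp.eval, hF])
  have h7 : Within s (.setN (.lit 2) (.add nC (.lit 1)))
      (st d V (coords (s N)) (Function.update F d (A d + y)) q y S d c f (N + 1))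
      (st d V (coords (s N)) (Function.update F d (A d + y)) q y S d (c + 1) f (N + 1)) _ :=
    within_setCnt (by simp [NExp.eval])
  have e : st d V (coords (s N)) (Function.update F d (A d + y)) q y S d (c + 1) f (N + 1) =
      st d V (coords (s N)) (fun j => A j + y *
        (if h : j < d then perp (vec d V) (s N).1 ⟨j, h⟩ else 1)) q y S d (c + 1) f (N + 1) := by
    refine st_congr (fun _ _ => rfl) fun j hj => ?_
    by_cases h : j = d
    · subst h; simp
    · rw [Function.update_of_ne h]; simp [hF, show j < d by omega]
  rw [← e]
  refine (h1.seq (h2.seq (h3.seq (h4.seq (h5.seq (h6.seq h7)))))).mono ?_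
  have c1 : (RExp.mul (rV nI) (rX nI)).cost = 12 := rfl
  have c2 : (RExp.mul (rX nD) rG).cost = 18 := rfl
  have c3 : (RExp.add (rA nI) (.mul rG (.sub (rX nI) (.mul (rV nI) rP)))).cost = 41 := rfl
  have c4 : (RExp.add (rA nD) rG).cost = 20 := rfl
  have c5 : (NExp.add nC (.lit 1)).cost = 4 := rfl
  rw [c1, c2, c3, c4, c5]
  omega

/-- A pass over the examples. -/
def pass (w : Prog) : Prog :=
  .seq (mapA nE (rN 0)) (.seq (.setN (.lit 2) (.lit 0)) (.while (.ltR (.cast nC) (rS 4)) (passBody w)))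

/-- The loop compares the counter, cast to a real, with the real nominal length, so it makes exactly
`⌈S 4⌉₊` iterations without any rounding operation. -/
theorem within_pass {w : Prog} {W : ℝ → ℝ} (hw : Computes s w V S W) (hS : 0 < S 4) :
    ∃ X' p' g' i', Within s (pass w) (st d V X A p g S i c f N)
      (st d V X' (sums W (vec d V) N ⌈S 4⌉₊ s) p' g' S i' ⌈S 4⌉₊ f (N + ⌈S 4⌉₊))
      ((d + 1) * 2000 * ⌈S 4⌉₊) := by
  have h1 : Within s (mapA nE (rN 0)) (st d V X A p g S i c f N)
      (st d V X (fun _ => 0) p g S (d + 1) c f N) _ :=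
    within_mapA (by decide) (fun _ _ _ _ => rfl) le_rfl (fun _ => 0) (fun j hj A' hA' => by simp)
      (fun j h h' => by omega)
  have h2 : Within s (.setN (.lit 2) (.lit 0)) (st d V X (fun _ => 0) p g S (d + 1) c f N)
      (st d V X (fun _ => 0) p g S (d + 1) 0 f N) _ := within_setCnt rfl
  -- Induction on the number of examples still to be read, since the values of the working cells are
  -- only known to exist.
  have hstep : ∀ k : ℕ, k ≤ ⌈S 4⌉₊ → ∀ X p g i, ∃ X' p' g' i',
      Within s (.while (.ltR (.cast nC) (rS 4)) (passBody w))
        (st d V X (sums W (vec d V) N (⌈S 4⌉₊ - k) s) p g S i (⌈S 4⌉₊ - k) f (N + (⌈S 4⌉₊ - k)))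
        (st d V X' (sums W (vec d V) N ⌈S 4⌉₊ s) p' g' S i' ⌈S 4⌉₊ f (N + ⌈S 4⌉₊))
        (k * ((d + 1) * 1000 + 20) + 20) := by
    intro k
    have hcost : (BExp.ltR (.cast nC) (rS 4)).cost ≤ 20 := by decide
    induction k with
    | zero =>
      intro _ X p g i
      refine ⟨X, p, g, i, ?_⟩
      have := Within.whileFalse (s := s) (b := .ltR (.cast nC) (rS 4)) (c := passBody w)
        (σ := st d V X (sums W (vec d V) N ⌈S 4⌉₊ s) p g S i ⌈S 4⌉₊ f (N + ⌈S 4⌉₊)) (by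
          simp only [BExp.holds, RExp.eval, eval_nC, eval_rS, not_lt]
          exact Nat.le_ceil _)
      exact this.mono (by omega)
    | succ k ih =>
      intro hk X p g i
      obtain ⟨p₁, g₁, hb⟩ := within_passBody (X := X)
        (A := sums W (vec d V) N (⌈S 4⌉₊ - (k + 1)) s) (p := p) (g := g) (i := i)
        (c := ⌈S 4⌉₊ - (k + 1)) (f := f) (N := N + (⌈S 4⌉₊ - (k + 1))) hw
      have e : ⌈S 4⌉₊ - (k + 1) + 1 = ⌈S 4⌉₊ - k := by omega
      have es : (fun j => sums W (vec d V) N (⌈S 4⌉₊ - (k + 1)) s j +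
          label (s (N + (⌈S 4⌉₊ - (k + 1)))) *
          W ⟪vec d V, (s (N + (⌈S 4⌉₊ - (k + 1)))).1⟫ *
          (if h : j < d then perp (vec d V) (s (N + (⌈S 4⌉₊ - (k + 1)))).1 ⟨j, h⟩ else 1)) =
          sums W (vec d V) N (⌈S 4⌉₊ - k) s := by
        funext j
        rw [← e]; unfold sums; rw [Finset.sum_range_succ]
      rw [es, e, add_assoc, e] at hb
      obtain ⟨X', p', g', i', hr⟩ := ih (by omega) (coords (s (N + (⌈S 4⌉₊ - (k + 1))))) p₁ g₁ d
      refine ⟨X', p', g', i', (Within.whileTrue ?_ hb hr).mono ?_⟩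
      · simp only [BExp.holds, RExp.eval, eval_nC, eval_rS]
        exact Nat.lt_ceil.1 (by omega)
      · have : (k + 1) * ((d + 1) * 1000 + 20) =
          k * ((d + 1) * 1000 + 20) + ((d + 1) * 1000 + 20) := by ring
        omega
  obtain ⟨X', p', g', i', hr⟩ := hstep ⌈S 4⌉₊ le_rfl X p g (d + 1)
  have e0 : sums W (vec d V) N 0 s = fun _ => 0 := by funext j; simp [sums]
  rw [Nat.sub_self, e0, add_zero] at hr
  refine ⟨X', p', g', i', (h1.seq (h2.seq hr)).mono ?_⟩
  have c1 : (rN 0).cost = 2 := rfl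
  have c2 : (NExp.lit 0).cost = 1 := rfl
  have hpos : 0 < ⌈S 4⌉₊ := Nat.ceil_pos.2 hS
  rw [c1, c2]
  obtain ⟨m, hm⟩ := Nat.exists_eq_succ_of_ne_zero hpos.ne'
  rw [hm]
  have e1 : (d + 1) * 2000 * m.succ = m.succ * ((d + 1) * 1000 + 20) + m.succ * (d * 1000 + 980) := by
    ring
  have e2 : d * 1000 + 980 ≤ m.succ * (d * 1000 + 980) := Nat.le_mul_of_pos_left _ (by omega)
  omega

end Loops

end RealRAM

/-! ### Program blocks, up to the contents of working cells. -/

namespace RealRAM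

/-- The part of a state that matters between program blocks. -/
structure Core where
  V : ℕ → ℝ
  A : ℕ → ℝ
  S : ℕ → ℝ
  c : ℕ
  f : ℕ
  N : ℕ

section Blocks

variable {d : ℕ} {s : ℕ → EuclideanSpace ℝ (Fin d) × ℤˣ}
variable {C C₁ C₂ C₃ : Core} {k : ℕ} {r : ℝ}

/-- The state with a given core and given values of the working cells. -/
def Core.st (d : ℕ) (C : Core) (X : ℕ → ℝ) (p g : ℝ) (i : ℕ) : State :=
  RealRAM.st d C.V X C.A p g C.S i C.c C.f C.N

/-- Execution from one core to another, for arbitrary values of the working cells. -/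
def Reach (s : ℕ → EuclideanSpace ℝ (Fin d) × ℤˣ) (P : Prog) (C C' : Core) (B : ℕ) : Prop :=
  ∀ X p g i, ∃ X' p' g' i', Within s P (C.st d X p g i) (C'.st d X' p' g' i') B

theorem Reach.mono {P : Prog} {B B' : ℕ} (h : Reach s P C₁ C₂ B) (hB : B ≤ B') :
    Reach s P C₁ C₂ B' := by
  intro X p g i
  obtain ⟨X', p', g', i', h⟩ := h X p g i
  exact ⟨X', p', g', i', h.mono hB⟩

theorem Reach.seq {P Q : Prog} {B₁ B₂ : ℕ} (h₁ : Reach s P C₁ C₂ B₁) (h₂ : Reach s Q C₂ C₃ B₂) :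
    Reach s (.seq P Q) C₁ C₃ (B₁ + B₂) := by
  intro X p g i
  obtain ⟨X', p', g', i', h₁⟩ := h₁ X p g i
  obtain ⟨X'', p'', g'', i'', h₂⟩ := h₂ X' p' g' i'
  exact ⟨X'', p'', g'', i'', h₁.seq h₂⟩

theorem Reach.iteTrue {b : BExp} {P Q : Prog} {B : ℕ}
    (hb : ∀ X p g i, b.holds (C₁.st d X p g i)) (h : Reach s P C₁ C₂ B) :
    Reach s (.ite b P Q) C₁ C₂ (b.cost + B) := by
  intro X p g i
  obtain ⟨X', p', g', i', h⟩ := h X p g i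
  exact ⟨X', p', g', i', h.iteTrue (hb X p g i)⟩

theorem Reach.iteFalse {b : BExp} {P Q : Prog} {B : ℕ}
    (hb : ∀ X p g i, ¬ b.holds (C₁.st d X p g i)) (h : Reach s Q C₁ C₂ B) :
    Reach s (.ite b P Q) C₁ C₂ (b.cost + B) := by
  intro X p g i
  obtain ⟨X', p', g', i', h⟩ := h X p g i
  exact ⟨X', p', g', i', h.iteFalse (hb X p g i)⟩

theorem Reach.whileFalse {b : BExp} {P : Prog} (hb : ∀ X p g i, ¬ b.holds (C.st d X p g i)) :
    Reach s (.while b P) C C b.cost := fun X p g i =>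
  ⟨X, p, g, i, Within.whileFalse (hb X p g i)⟩

theorem Reach.whileTrue {b : BExp} {P : Prog} {B₁ B₂ : ℕ}
    (hb : ∀ X p g i, b.holds (C₁.st d X p g i)) (h₁ : Reach s P C₁ C₂ B₁)
    (h₂ : Reach s (.while b P) C₂ C₃ B₂) : Reach s (.while b P) C₁ C₃ (b.cost + B₁ + B₂) := by
  intro X p g i
  obtain ⟨X', p', g', i', h₁⟩ := h₁ X p g i
  obtain ⟨X'', p'', g'', i'', h₂⟩ := h₂ X' p' g' i'
  exact ⟨X'', p'', g'', i'', Within.whileTrue (hb X p g i) h₁ h₂⟩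

theorem reach_setS {e : RExp} (he : ∀ X p g i, e.eval (C.st d X p g i) = r) :
    Reach s (setS k e) C { C with S := Function.update C.S k r } (e.cost + 20) :=
  fun X p g i => ⟨X, p, g, i, within_setS (he X p g i)⟩

theorem reach_setV_last {e : RExp} (he : ∀ X p g i, e.eval (C.st d X p g i) = r) :
    Reach s (setV nD e) C { C with V := Function.update C.V d r } (e.cost + 20) :=
  fun X p g i => ⟨X, p, g, i, within_setV_last (he X p g i)⟩

theorem reach_setFlag {e : NExp} (he : ∀ X p g i, e.eval (C.st d X p g i) = k) :
    Reach s (.setN (.lit 3) e) C { C with f := k } (e.cost + 20) :=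
  fun X p g i => ⟨X, p, g, i, within_setFlag (he X p g i)⟩

theorem reach_mapV {e : RExp} (F : ℕ → ℝ) (he : ∀ X p g, ∀ j < d + 1, ∀ V' : ℕ → ℝ,
      V' j = C.V j → e.eval (RealRAM.st d V' X C.A p g C.S j C.c C.f C.N) = F j) :
    Reach s (mapV e) C { C with V := F } ((d + 1) * (e.cost + 60) + 40) :=
  fun X p g _ => ⟨X, p, g, d + 1, within_mapV F (he X p g)⟩

theorem reach_pass {w : Prog} {W : ℝ → ℝ} (hw : Computes s w C.V C.S W) (hS : 0 < C.S 4) :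
    Reach s (pass w) C { C with
      A := sums W (vec d C.V) C.N ⌈C.S 4⌉₊ s, c := ⌈C.S 4⌉₊, N := C.N + ⌈C.S 4⌉₊ }
      ((d + 1) * 2000 * ⌈C.S 4⌉₊) := by
  intro X p g i
  obtain ⟨X', p', g', i', h⟩ := within_pass (X := X) (A := C.A) (p := p) (g := g) (i := i)
    (c := C.c) (f := C.f) (N := C.N) hw hS
  exact ⟨X', p', g', i', h⟩

/-- Put the norm of the vector part of the hypothesis into a scalar. -/
def normS (k : ℕ) : Prog := .seq (sumP (.mul (rV nI) (rV nI))) (setS k (.sqrt rP))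

theorem reach_normS : Reach s (normS k) C { C with S := Function.update C.S k ‖vec d C.V‖ }
    ((d + 1) * 200) := by
  intro X p g i
  have h1 := within_sumP (s := s) (V := C.V) (X := X) (A := C.A) (p := p) (g := g) (S := C.S)
    (i := i) (c := C.c) (f := C.f) (N := C.N) (e := .mul (rV nI) (rV nI))
    (fun j => C.V j * C.V j) (fun j hj p' => by
      simp only [RExp.eval]
      rw [eval_rV_idx (by omega)])
  have h2 := within_setS (s := s) (k := k) (e := .sqrt rP) (V := C.V) (X := X) (A := C.A)
    (p := ∑ j ∈ Finset.range d, C.V j * C.V j) (g := g) (S := C.S)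
    (i := d) (c := C.c) (f := C.f) (N := C.N) (r := ‖vec d C.V‖)
    (by simp only [RExp.eval, eval_rP]; rw [norm_vec])
  have c1 : (RExp.mul (rV nI) (rV nI)).cost = 7 := rfl
  have c2 : (RExp.sqrt rP).cost = 8 := rfl
  rw [c1] at h1
  rw [c2] at h2
  exact ⟨X, _, g, d, (h1.seq h2).mono (by omega)⟩

/-- The weight of the first two passes. -/
def hermiteW : Prog := setG (.sub (.mul rP rP) (rN 1))

theorem computes_hermite (V S : ℕ → ℝ) : Computes s hermiteW V S hermite := by
  intro X A p g i c f N
  have h := within_setG (s := s) (V := V) (X := X) (A := A) (p := p) (g := g) (S := S) (i := i)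
    (c := c) (f := f) (N := N) (e := .sub (.mul rP rP) (rN 1)) (r := hermite p) (by
      simp [RExp.eval, hermite, sq])
  exact h.mono (by decide)

/-- The half-width of the band. -/
def widthE : RExp := .mul (.mul (rN 600) (rS 8)) (rS 7)

/-- The weight of the refinement passes. -/
def bandW : Prog :=
  .ite (.and (.not (.ltR widthE (.add rP (rV nD))))
      (.not (.ltR (.add rP (rV nD)) (.sub (rN 0) widthE))))
    (setG (.exp (.div (.sub (.mul rP rP) (.mul (rV nD) (rV nD))) (rN 2)))) (setG (rN 0))

theorem computes_band (V S : ℕ → ℝ) :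
    Computes s bandW V S (band (V d) (600 * S 8 * S 7)) := by
  intro X A p g i c f N
  have hb : (BExp.and (.not (.ltR widthE (.add rP (rV nD))))
      (.not (.ltR (.add rP (rV nD)) (.sub (rN 0) widthE)))).holds
      (RealRAM.st d V X A p g S i c f N) ↔ |p + V d| ≤ 600 * S 8 * S 7 := by
    simp [BExp.holds, RExp.eval, widthE, abs_le, and_comm]
  by_cases h : |p + V d| ≤ 600 * S 8 * S 7
  · have h1 := within_setG (s := s) (V := V) (X := X) (A := A) (p := p) (g := g) (S := S) (i := i)
      (c := c) (f := f) (N := N)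
      (e := .exp (.div (.sub (.mul rP rP) (.mul (rV nD) (rV nD))) (rN 2)))
      (r := band (V d) (600 * S 8 * S 7) p) (by
        simp [RExp.eval, band, h, sq])
    exact (Within.iteTrue (hb.2 h) h1).mono (by decide)
  · have h1 := within_setG (s := s) (V := V) (X := X) (A := A) (p := p) (g := g) (S := S) (i := i)
      (c := c) (f := f) (N := N) (e := rN 0)
      (r := band (V d) (600 * S 8 * S 7) p) (by
        simp [band, h])
    exact (Within.iteFalse (fun h' => h (hb.1 h')) h1).mono (by decide)

end Blocks

/-! ### The learner -/

/-- The cube of the polylogarithmic scale. -/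
def lamCube : RExp := .mul (.mul (rS 8) (rS 8)) (rS 8)

/-- The test that starts the refinement. -/
def acceptB : BExp :=
  .and (.not (.ltR (.mul (rN 20) (rS 6)) (rS 0)))
    (.and (.not (.ltR (.mul (rS 3) (.mul (rS 6) (rS 6)))
        (.mul (rN 40000000000) (.mul lamCube lamCube))))
      (.not (.ltR (.mul (.mul (rS 3) (rS 6)) (rS 0))
        (.mul (.mul (rN 4000000000000) lamCube)
          (.exp (.div (.sub (rN 0) (.mul (rV nD) (rV nD))) (rN 2)))))))

/-- The test that stops the search with a constant hypothesis. -/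
def longB : BExp :=
  .not (.ltR (.mul (rS 3) (.mul (rS 0) (rS 0))) (.mul (rN 100000000000000) (.mul lamCube lamCube)))

/-- The first pass of a round: the empirical Chow parameters. -/
def chowP : Prog :=
  .seq (setS 4 (.mul (rS 2) (rS 3))) (.seq (mapV (rN 0)) (.seq (pass hermiteW)
    (.seq (setS 5 (.cast nC)) (.seq (mapV (.sub (rN 0) (.div (rA nI) (rS 5))))
      (.seq (setS 10 (rV nD)) (.seq (normS 6) (mapV (.div (rV nI) (rS 6)))))))))

/-- The second pass of a round: the initial threshold. -/
def thrP : Prog :=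
  .seq (pass hermiteW) (setV nD (.div (.sub (rN 0) (.div (rA nD) (rS 5))) (rS 6)))

/-- The decision at the end of a round. -/
def decideP : Prog :=
  .ite acceptB (.setN (.lit 3) (.lit 1))
    (.ite longB (.seq (.setN (.lit 3) (.lit 1)) (.seq (mapV (rN 0)) (.seq (setV nD (rS 10))
      (setS 6 (rN 0))))) (setS 3 (.mul (rS 3) (rN 2))))

/-- One round. -/
def roundP : Prog := .seq chowP (.seq thrP decideP)

/-- One refinement stage. -/
def stageP : Prog :=
  .seq (pass bandW) (.seq (mapV (.add (rV nI) (.div (.div (rA nI) (rS 5)) (rS 6))))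
    (.seq (normS 9) (.seq (mapV (.div (rV nI) (rS 9))) (setS 7 (.div (rS 7) (rN 2))))))

/-- The scales that depend on the input only. -/
def initP : Prog :=
  .seq (setS 0 (.read (.lit 0))) (.seq (setS 1 (.read (.lit 1)))
    (.seq (setS 8 (.mul (rN 4) (.add (rN 1) (.log (.div (rN 1) (rS 0))))))
      (.seq (setS 2 (.mul (.cast nD) (.mul (rN 40)
        (.log (.div (.mul (rN 10) (.cast nD)) (.mul (rS 0) (rS 1))))))) (setS 3 (rN 1)))))

/-- The test of the refinement loop. -/
def refineB : BExp := .ltR (rS 0) (.mul (.mul (rN 120) (rS 6)) (rS 7))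

/-- The learner. -/
def learner : Prog :=
  .seq initP (.seq (.while (.ltN nF (.lit 1)) roundP)
    (.seq (setS 7 (.div (rN 1) (.mul (rN 1200) (.mul (rS 8) (rS 8))))) (.while refineB stageP)))

/-! ### Specification of the two opening passes of a round. -/

section Specification

variable {d : ℕ} {s : ℕ → EuclideanSpace ℝ (Fin d) × ℤˣ} {ε δ : ℝ} {C : Core} {i j : ℕ}

/-- The scalars that do not change. -/
structure Fixed (d : ℕ) (ε δ : ℝ) (C : Core) : Prop where
  eps : C.S 0 = ε
  scale : C.S 2 = d * ell d ε δ
  lam : C.S 8 = Lam ε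

/-- The state before round `i`. -/
structure AtRound (d : ℕ) (ε δ : ℝ) (i : ℕ) (C : Core) : Prop extends Fixed d ε δ C where
  pow : C.S 3 = 2 ^ i
  flag : C.f = 0
  drawn : C.N = offset d ε δ i

/-- The state with hypothesis `h` after round `i` has been accepted with Chow norm `m`. -/
structure Holding (ε δ : ℝ) (i : ℕ) (m : ℝ) (h : EuclideanSpace ℝ (Fin d) × ℝ) (C : Core) :
    Prop extends Fixed d ε δ C where
  nom : C.S 4 = nomLen d ε δ i
  len : C.S 5 = len d ε δ i
  norm : C.S 6 = m
  vec : RealRAM.vec d C.V = h.1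
  thr : C.V d = h.2

theorem vec_zero : vec d (fun _ => 0) = 0 := by ext j; simp [vec]

theorem vec_update (V : ℕ → ℝ) (r : ℝ) : vec d (Function.update V d r) = vec d V := by
  ext j
  have : (j : ℕ) ≠ d := j.2.ne
  simp [vec, this]

/-- The pass runs with the zero hypothesis. Its counter then holds the block length, which becomes
available as a real divisor; the last entry, the mean label, is saved before the vector is
normalized. -/
theorem reach_chowP (hn : 0 < nomLen d ε δ i) (hC : AtRound d ε δ i C) :
    ∃ C', Reach s chowP C C' ((d + 1) * 3000 * len d ε δ i) ∧ Fixed d ε δ C' ∧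
      C'.S 3 = 2 ^ i ∧ C'.S 4 = nomLen d ε δ i ∧ C'.S 5 = len d ε δ i ∧
      C'.S 6 = ‖chow ε δ i s‖ ∧ C'.S 10 = chowZero ε δ i s ∧ vec d C'.V = dir ε δ i s ∧
      C'.f = 0 ∧ C'.N = offset d ε δ i + len d ε δ i := by
  have hL : ⌈nomLen d ε δ i⌉₊ = len d ε δ i := rfl
  have hpos : 0 < len d ε δ i := Nat.ceil_pos.2 hn
  obtain ⟨V, A, S, c, f, N⟩ := C
  obtain ⟨⟨h0, h2, h8⟩, h3, hf, hN⟩ := hC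
  simp only at h0 h2 h8 h3 hf hN
  subst hN
  set n := nomLen d ε δ i with hnd
  set L := len d ε δ i with hLd
  set o := offset d ε δ i with ho
  set S₁ := Function.update S 4 n with hS₁
  set S₂ := Function.update S₁ 5 (L : ℝ) with hS₂
  set A₁ := sums hermite 0 o L s with hA₁
  set V₁ : ℕ → ℝ := fun j => -(A₁ j / L) with hV₁
  set S₃ := Function.update S₂ 10 (V₁ d) with hS₃
  set S₄ := Function.update S₃ 6 ‖vec d V₁‖ with hS₄
  have r1 : Reach s (setS 4 (.mul (rS 2) (rS 3))) ⟨V, A, S, c, f, o⟩ ⟨V, A, S₁, c, f, o⟩ _ :=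
    reach_setS (fun X p g i => by
      simp [Core.st, RExp.eval, h2, h3, hnd, nomLen])
  have r2 : Reach s (mapV (rN 0)) ⟨V, A, S₁, c, f, o⟩ ⟨fun _ => 0, A, S₁, c, f, o⟩ _ :=
    reach_mapV (fun _ => 0) (fun X p g j hj V' hV' => by simp)
  have r3 : Reach s (pass hermiteW) ⟨fun _ => 0, A, S₁, c, f, o⟩
      ⟨fun _ => 0, A₁, S₁, L, f, o + L⟩ ((d + 1) * 2000 * L) := by
    have := reach_pass (s := s) (C := ⟨fun _ => 0, A, S₁, c, f, o⟩) (computes_hermite _ _)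
      (by simpa [hS₁] using hn)
    simp only [vec_zero, hS₁, Function.update_self, hL] at this
    exact this
  have r4 : Reach s (setS 5 (.cast nC)) ⟨fun _ => 0, A₁, S₁, L, f, o + L⟩
      ⟨fun _ => 0, A₁, S₂, L, f, o + L⟩ _ :=
    reach_setS (fun X p g i => by simp [Core.st, RExp.eval])
  have r5 : Reach s (mapV (.sub (rN 0) (.div (rA nI) (rS 5)))) ⟨fun _ => 0, A₁, S₂, L, f, o + L⟩
      ⟨V₁, A₁, S₂, L, f, o + L⟩ _ :=
    reach_mapV V₁ (fun X p g j hj V' hV' => by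
      simp only [RExp.eval]
      rw [eval_rA_idx hj]
      simp [hS₂, hV₁])
  have r6 : Reach s (setS 10 (rV nD)) ⟨V₁, A₁, S₂, L, f, o + L⟩ ⟨V₁, A₁, S₃, L, f, o + L⟩ _ :=
    reach_setS (fun X p g i => by simp [Core.st])
  have r7 : Reach s (normS 6) ⟨V₁, A₁, S₃, L, f, o + L⟩ ⟨V₁, A₁, S₄, L, f, o + L⟩ _ := reach_normS
  have r8 : Reach s (mapV (.div (rV nI) (rS 6))) ⟨V₁, A₁, S₄, L, f, o + L⟩
      ⟨fun j => V₁ j / ‖vec d V₁‖, A₁, S₄, L, f, o + L⟩ _ :=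
    reach_mapV _ (fun X p g j hj V' hV' => by
      simp only [RExp.eval]
      rw [eval_rV_idx hj, hV']
      simp [hS₄])
  have hchow : vec d V₁ = chow ε δ i s := by
    ext j
    simp only [vec, hV₁, chow, PiLp.neg_apply]
    rw [hA₁, sums_div_coord]
  refine ⟨_, (r1.seq (r2.seq (r3.seq (r4.seq (r5.seq (r6.seq (r7.seq r8))))))).mono ?_,
    ⟨?_, ?_, ?_⟩, ?_, ?_, ?_, ?_, ?_, ?_, hf, rfl⟩
  · have c1 : (RExp.mul (rS 2) (rS 3)).cost = 19 := rfl
    have c2 : (rN 0).cost = 2 := rfl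
    have c3 : (RExp.cast nC).cost = 3 := rfl
    have c4 : (RExp.sub (rN 0) (.div (rA nI) (rS 5))).cost = 23 := rfl
    have c5 : (rV nD).cost = 3 := rfl
    have c6 : (RExp.div (rV nI) (rS 6)).cost = 13 := rfl
    rw [c1, c2, c3, c4, c5, c6]
    have : (d + 1) * 1 ≤ (d + 1) * L := Nat.mul_le_mul_left _ hpos
    have e1 : (d + 1) * 2000 * L = 2000 * ((d + 1) * L) := by ring
    have e2 : (d + 1) * 3000 * L = 3000 * ((d + 1) * L) := by ring
    omega
  · simpa [hS₄, hS₃, hS₂, hS₁] using h0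
  · simpa [hS₄, hS₃, hS₂, hS₁] using h2
  · simpa [hS₄, hS₃, hS₂, hS₁] using h8
  · simpa [hS₄, hS₃, hS₂, hS₁] using h3
  · simp [hS₄, hS₃, hS₂, hS₁]
  · simp [hS₄, hS₃, hS₂]
  · simp [hS₄, hchow]
  · simp only [hS₄, hS₃, hV₁, chowZero]
    rw [← sums_div_last]
    simp [hA₁, hLd, ho]
  · simp only [dir, ← hchow]
    ext j
    simp [vec, div_eq_inv_mul]

theorem reach_thrP (hn : 0 < nomLen d ε δ i) (hC : Fixed d ε δ C)
    (h3 : C.S 3 = 2 ^ i) (h4 : C.S 4 = nomLen d ε δ i) (h5 : C.S 5 = len d ε δ i)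
    (h6 : C.S 6 = ‖chow ε δ i s‖) (h10 : C.S 10 = chowZero ε δ i s) (hv : vec d C.V = dir ε δ i s)
    (hN : C.N = offset d ε δ i + len d ε δ i) :
    ∃ C', Reach s thrP C C' ((d + 1) * 2000 * len d ε δ i + 60) ∧
      Holding ε δ i ‖chow ε δ i s‖ (hyp ε δ i s 0) C' ∧
      C'.S 3 = 2 ^ i ∧ C'.S 10 = chowZero ε δ i s ∧ C'.f = C.f ∧ C'.N = offset d ε δ (i + 1) := by
  obtain ⟨V, A, S, c, f, N⟩ := C
  simp only at h3 h4 h5 h6 h10 hv hN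
  have r1 := reach_pass (s := s) (C := ⟨V, A, S, c, f, N⟩) (computes_hermite _ _)
    (by simpa [h4] using hn)
  simp only [h4, hv] at r1
  have r2 := reach_setV_last (s := s) (C := ⟨V, sums hermite (dir ε δ i s) N ⌈nomLen d ε δ i⌉₊ s, S,
      ⌈nomLen d ε δ i⌉₊, f, N + ⌈nomLen d ε δ i⌉₊⟩) (r := thr ε δ i s)
    (e := .div (.sub (rN 0) (.div (rA nD) (rS 5))) (rS 6)) (fun X p g k => by
      simp only [Core.st, RExp.eval, eval_rA_last, eval_rS, eval_rN, h5, h6]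
      rw [show ⌈nomLen d ε δ i⌉₊ = len d ε δ i from rfl, sums_div_last, hN]
      simp [thr, hermiteAvg])
  refine ⟨_, (r1.seq r2).mono ?_, ⟨⟨hC.eps, hC.scale, hC.lam⟩, h4, h5, h6, ?_, ?_⟩, h3, h10, rfl, ?_⟩
  · exact Nat.add_le_add_left (by decide) _
  · rw [vec_update]; exact hv
  · simp [hyp]
  · simp only
    rw [hN, offset_succ, show ⌈nomLen d ε δ i⌉₊ = len d ε δ i from rfl]; ring

end Specification

end RealRAM

/-! ### Correctness, halting and running time of the program. -/

namespace RealRAM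

section Run

variable {d : ℕ} {s : ℕ → EuclideanSpace ℝ (Fin d) × ℤˣ} {ε δ : ℝ} {C : Core} {i j I K : ℕ}

theorem acceptB_holds_iff (hC : Holding ε δ i ‖chow ε δ i s‖ (hyp ε δ i s 0) C)
    (h3 : C.S 3 = 2 ^ i) (X : ℕ → ℝ) (p g : ℝ) (k : ℕ) :
    acceptB.holds (C.st d X p g k) ↔ Accept ε δ i s := by
  have hthr : C.V d = thr ε δ i s := hC.thr
  have e3 : Lam ε ^ 2 * Lam ε = Lam ε ^ 3 := by ring
  have e6 : (Lam ε ^ 3) ^ 2 = Lam ε ^ 6 := by ring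
  simp only [acceptB, BExp.holds, RExp.eval, lamCube, Core.st, eval_rS, eval_rN, eval_rV_last,
    hC.norm, hC.eps, hC.lam, h3, hthr, not_lt, e3, e6, zero_sub, Nat.cast_zero, Nat.cast_ofNat,
    ← sq]
  exact ⟨fun ⟨a, b, c⟩ => ⟨a, b, c⟩, fun ⟨a, b, c⟩ => ⟨a, b, c⟩⟩

theorem longB_holds_iff (hC : Fixed d ε δ C) (h3 : C.S 3 = 2 ^ i) (X : ℕ → ℝ) (p g : ℝ) (k : ℕ) :
    longB.holds (C.st d X p g k) ↔ Long ε i := by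
  have e3 : Lam ε ^ 2 * Lam ε = Lam ε ^ 3 := by ring
  have e6 : (Lam ε ^ 3) ^ 2 = Lam ε ^ 6 := by ring
  simp only [longB, BExp.holds, RExp.eval, lamCube, Core.st, eval_rS, eval_rN,
    hC.eps, hC.lam, h3, not_lt, e3, e6, Nat.cast_ofNat, ← sq, Long]

/-- The result of the search for the round in which to stop. -/
def Found (ε δ : ℝ) (s : ℕ → EuclideanSpace ℝ (Fin d) × ℤˣ) (i : ℕ) (m : ℝ)
    (h : EuclideanSpace ℝ (Fin d) × ℝ) : Prop :=
  (Accept ε δ i s ∧ m = ‖chow ε δ i s‖ ∧ h = hyp ε δ i s 0) ∨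
    -- The stored norm 0 makes the refinement test fail at once, so a constant hypothesis passes
    -- through the final loop unchanged.
    (¬ Accept ε δ i s ∧ Long ε i ∧ m = 0 ∧ h = (0, chowZero ε δ i s))

theorem reach_decideP (hC : Holding ε δ i ‖chow ε δ i s‖ (hyp ε δ i s 0) C)
    (h3 : C.S 3 = 2 ^ i) (h10 : C.S 10 = chowZero ε δ i s) (hf : C.f = 0)
    (hN : C.N = offset d ε δ (i + 1)) :
    ∃ C', Reach s decideP C C' ((d + 1) * 500) ∧
      ((∃ m h, Found ε δ s i m h ∧ Holding ε δ i m h C' ∧ C'.f = 1 ∧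
        C'.N = offset d ε δ (i + 1)) ∨
      (¬ Accept ε δ i s ∧ ¬ Long ε i ∧ AtRound d ε δ (i + 1) C')) := by
  have ca : acceptB.cost ≤ 200 := by decide
  have cl : longB.cost ≤ 100 := by decide
  have hacc := acceptB_holds_iff (s := s) hC h3
  have hlong := longB_holds_iff hC.toFixed h3
  by_cases ha : Accept ε δ i s
  · have r := reach_setFlag (s := s) (C := C) (e := .lit 1) (k := 1) (fun _ _ _ _ => rfl)
    refine ⟨_, (Reach.iteTrue (fun X p g k => (hacc X p g k).2 ha) r).mono ?_,
      Or.inl ⟨_, _, Or.inl ⟨ha, rfl, rfl⟩, ⟨⟨hC.eps, hC.scale, hC.lam⟩, hC.nom, hC.len, hC.norm,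
        hC.vec, hC.thr⟩, rfl, hN⟩⟩
    have : (NExp.lit 1).cost = 1 := rfl
    omega
  · by_cases hl : Long ε i
    · have r1 := reach_setFlag (s := s) (C := C) (e := .lit 1) (k := 1) (fun _ _ _ _ => rfl)
      have r2 := reach_mapV (s := s) (C := { C with f := 1 }) (e := rN 0) (fun _ => 0)
        (fun X p g j hj V' hV' => by simp)
      have r3 := reach_setV_last (s := s) (C := { C with f := 1, V := fun _ => 0 })
        (e := rS 10) (r := chowZero ε δ i s) (fun X p g k => by simpa [Core.st] using h10)
      have r4 := reach_setS (s := s)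
        (C := { C with f := 1, V := Function.update (fun _ => 0) d (chowZero ε δ i s) })
        (k := 6) (e := rN 0) (r := 0) (fun X p g k => by simp)
      refine ⟨_, (Reach.iteFalse (fun X p g k h => ha ((hacc X p g k).1 h))
        (Reach.iteTrue (fun X p g k => (hlong X p g k).2 hl)
          (r1.seq (r2.seq (r3.seq r4))))).mono ?_,
        Or.inl ⟨0, (0, chowZero ε δ i s), Or.inr ⟨ha, hl, rfl, rfl⟩, ⟨⟨?_, ?_, ?_⟩, ?_, ?_, ?_, ?_, ?_⟩,
          rfl, hN⟩⟩
      · have c1 : (NExp.lit 1).cost = 1 := rfl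
        have c2 : (rN 0).cost = 2 := rfl
        have c3 : (rS 10).cost = 9 := rfl
        rw [c1, c2, c3]
        omega
      · simpa using hC.eps
      · simpa using hC.scale
      · simpa using hC.lam
      · simpa using hC.nom
      · simpa using hC.len
      · simp
      · rw [vec_update, vec_zero]
      · simp
    · have r := reach_setS (s := s) (C := C) (k := 3) (e := .mul (rS 3) (rN 2)) (r := 2 ^ (i + 1))
        (fun X p g k => by simp [Core.st, RExp.eval, h3, pow_succ])
      refine ⟨_, (Reach.iteFalse (fun X p g k h => ha ((hacc X p g k).1 h))
        (Reach.iteFalse (fun X p g k h => hl ((hlong X p g k).1 h)) r)).mono ?_,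
        Or.inr ⟨ha, hl, ⟨⟨?_, ?_, ?_⟩, ?_, hf, hN⟩⟩⟩
      · have c1 : (RExp.mul (rS 3) (rN 2)).cost = 12 := rfl
        omega
      · simpa using hC.eps
      · simpa using hC.scale
      · simpa using hC.lam
      · simp

theorem reach_roundP (hn : 0 < nomLen d ε δ i) (hC : AtRound d ε δ i C) :
    ∃ C', Reach s roundP C C' ((d + 1) * 6000 * len d ε δ i) ∧
      ((∃ m h, Found ε δ s i m h ∧ Holding ε δ i m h C' ∧ C'.f = 1 ∧
        C'.N = offset d ε δ (i + 1)) ∨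
      (¬ Accept ε δ i s ∧ ¬ Long ε i ∧ AtRound d ε δ (i + 1) C')) := by
  have hpos : 0 < len d ε δ i := Nat.ceil_pos.2 hn
  obtain ⟨C₁, r1, hF, h3, h4, h5, h6, h10, hv, hf, hN⟩ := reach_chowP (s := s) hn hC
  obtain ⟨C₂, r2, hH, h3', h10', hf', hN'⟩ := reach_thrP (s := s) hn hF h3 h4 h5 h6 h10 hv hN
  obtain ⟨C₃, r3, h⟩ := reach_decideP (s := s) hH h3' h10' (hf'.trans hf) hN'
  refine ⟨C₃, (r1.seq (r2.seq r3)).mono ?_, h⟩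
  have : (d + 1) * 1 ≤ (d + 1) * len d ε δ i := Nat.mul_le_mul_left _ hpos
  have e1 : (d + 1) * 2000 * len d ε δ i = 2000 * ((d + 1) * len d ε δ i) := by ring
  have e2 : (d + 1) * 3000 * len d ε δ i = 3000 * ((d + 1) * len d ε δ i) := by ring
  have e3 : (d + 1) * 6000 * len d ε δ i = 6000 * ((d + 1) * len d ε δ i) := by ring
  omega

/-- Induction on the number of rounds left before the first stopping round. The time telescopes:
each round draws two blocks, and the cost is charged to the samples. -/
theorem reach_rounds (hn : ∀ i, 0 < nomLen d ε δ i) (hI : Accept ε δ I s ∨ Long ε I)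
    (hprev : ∀ k < I, ¬ Accept ε δ k s ∧ ¬ Long ε k) (k : ℕ) (hk : k ≤ I)
    (hC : AtRound d ε δ (I - k) C) :
    ∃ C' m h, Reach s (.while (.ltN nF (.lit 1)) roundP) C C'
        ((d + 1) * 6000 * (offset d ε δ (I + 1) - offset d ε δ (I - k))) ∧
      Found ε δ s I m h ∧ Holding ε δ I m h C' ∧ C'.N = offset d ε δ (I + 1) := by
  have hcost : (BExp.ltN nF (.lit 1)).cost = 4 := rfl
  induction k generalizing C with
  | zero =>
    rw [Nat.sub_zero] at hC ⊢
    obtain ⟨C', r, h⟩ := reach_roundP (s := s) (hn I) hC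
    rcases h with ⟨m, h, hFd, hH, hf, hN⟩ | ⟨ha, hl, -⟩
    · refine ⟨C', m, h, ?_, hFd, hH, hN⟩
      refine (Reach.whileTrue ?_ r (Reach.whileFalse ?_)).mono ?_
      · intro X p g i; simp [BExp.holds, Core.st, hC.flag, NExp.eval]
      · intro X p g i; simp [BExp.holds, Core.st, hf, NExp.eval]
      · rw [hcost, offset_succ]
        have hpos : 0 < len d ε δ I := Nat.ceil_pos.2 (hn I)
        have : (d + 1) * 1 ≤ (d + 1) * len d ε δ I := Nat.mul_le_mul_left _ hpos
        have e : (d + 1) * 6000 * (offset d ε δ I + 2 * len d ε δ I - offset d ε δ I) =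
          (d + 1) * 6000 * len d ε δ I + 6000 * ((d + 1) * len d ε δ I) := by
          rw [Nat.add_sub_cancel_left]; ring
        omega
    · exact absurd hI (by tauto)
  | succ k ih =>
    have e : I - (k + 1) + 1 = I - k := by omega
    obtain ⟨C₁, r, h⟩ := reach_roundP (s := s) (hn (I - (k + 1))) hC
    rcases h with ⟨m, h, hFd, -⟩ | ⟨-, -, hA⟩
    · exfalso
      have := hprev (I - (k + 1)) (by omega)
      rcases hFd with h | h
      · exact this.1 h.1
      · exact this.2 h.2.1
    · rw [e] at hA
      obtain ⟨C', m, h, r', hFd, hH, hN⟩ := ih (by omega) hA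
      refine ⟨C', m, h, (Reach.whileTrue ?_ r r').mono ?_, hFd, hH, hN⟩
      · intro X p g i; simp [BExp.holds, Core.st, hC.flag, NExp.eval]
      · have hoff : offset d ε δ (I - k) = offset d ε δ (I - (k + 1)) +
            2 * len d ε δ (I - (k + 1)) := by rw [← e, offset_succ]
        have hmono : offset d ε δ (I - k) ≤ offset d ε δ (I + 1) :=
          Finset.sum_le_sum_of_subset (Finset.range_mono (by omega))
        have hpos : 0 < len d ε δ (I - (k + 1)) := Nat.ceil_pos.2 (hn _)
        have h1 : (d + 1) * 1 ≤ (d + 1) * len d ε δ (I - (k + 1)) := Nat.mul_le_mul_left _ hpos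
        have e2 : offset d ε δ (I + 1) - offset d ε δ (I - (k + 1)) =
          (offset d ε δ (I + 1) - offset d ε δ (I - k)) + 2 * len d ε δ (I - (k + 1)) := by omega
        rw [hcost, e2]
        have e3 : (d + 1) * 6000 * (offset d ε δ (I + 1) - offset d ε δ (I - k) +
            2 * len d ε δ (I - (k + 1))) =
          (d + 1) * 6000 * (offset d ε δ (I + 1) - offset d ε δ (I - k)) +
          (d + 1) * 6000 * len d ε δ (I - (k + 1)) +
            6000 * ((d + 1) * len d ε δ (I - (k + 1))) := by ring
        omega

theorem reach_stageP (hn : 0 < nomLen d ε δ i)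
    (hC : Holding ε δ i ‖chow ε δ i s‖ (hyp ε δ i s j) C) (h7 : C.S 7 = rad ε j)
    (hN : C.N = stageOffset d ε δ i j) :
    ∃ C', Reach s stageP C C' ((d + 1) * 3000 * len d ε δ i) ∧
      Holding ε δ i ‖chow ε δ i s‖ (hyp ε δ i s (j + 1)) C' ∧ C'.S 7 = rad ε (j + 1) ∧
      C'.N = stageOffset d ε δ i (j + 1) := by
  have hL : ⌈nomLen d ε δ i⌉₊ = len d ε δ i := rfl
  have hpos : 0 < len d ε δ i := Nat.ceil_pos.2 hn
  obtain ⟨V, A, S, c, f, N⟩ := C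
  obtain ⟨⟨h0, h2, h8⟩, h4, h5, h6, hv, ht⟩ := hC
  simp only at h0 h2 h8 h4 h5 h6 hv ht h7 hN
  subst hN
  set m := ‖chow ε δ i s‖ with hm
  set L := len d ε δ i with hLd
  set o := stageOffset d ε δ i j with ho
  set h := hyp ε δ i s j with hh
  set W := band h.2 (600 * Lam ε * rad ε j) with hW
  set A₁ := sums W h.1 o L s with hA₁
  set V₁ : ℕ → ℝ := fun k => V k + A₁ k / L / m with hV₁
  set S₁ := Function.update S 9 ‖vec d V₁‖ with hS₁
  set V₂ : ℕ → ℝ := fun k => V₁ k / ‖vec d V₁‖ with hV₂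
  have r1 : Reach s (pass bandW) ⟨V, A, S, c, f, o⟩ ⟨V, A₁, S, L, f, o + L⟩ ((d + 1) * 2000 * L) := by
    have := reach_pass (s := s) (C := ⟨V, A, S, c, f, o⟩) (computes_band _ _)
      (by simpa [h4] using hn)
    simp only [h4, hL, hv, ht, h7, h8] at this
    exact this
  have r2 : Reach s (mapV (.add (rV nI) (.div (.div (rA nI) (rS 5)) (rS 6))))
      ⟨V, A₁, S, L, f, o + L⟩ ⟨V₁, A₁, S, L, f, o + L⟩ _ :=
    reach_mapV V₁ (fun X p g k hk V' hV' => by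
      simp only [RExp.eval]
      rw [eval_rA_idx hk, eval_rV_idx hk, hV']
      simp [hV₁, h5, h6])
  have r3 : Reach s (normS 9) ⟨V₁, A₁, S, L, f, o + L⟩ ⟨V₁, A₁, S₁, L, f, o + L⟩ _ := reach_normS
  have r4 : Reach s (mapV (.div (rV nI) (rS 9))) ⟨V₁, A₁, S₁, L, f, o + L⟩
      ⟨V₂, A₁, S₁, L, f, o + L⟩ _ :=
    reach_mapV V₂ (fun X p g k hk V' hV' => by
      simp only [RExp.eval]
      rw [eval_rV_idx hk, hV']
      simp [hV₂, hS₁])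
  have r5 : Reach s (setS 7 (.div (rS 7) (rN 2))) ⟨V₂, A₁, S₁, L, f, o + L⟩
      ⟨V₂, A₁, Function.update S₁ 7 (rad ε (j + 1)), L, f, o + L⟩ _ :=
    reach_setS (fun X p g k => by
      simp [Core.st, RExp.eval, hS₁, h7, rad_succ])
  have hvec : vec d V₁ = h.1 + m⁻¹ • vecAvg W h.1 o L s := by
    ext k
    simp only [vec, hV₁, PiLp.add_apply, PiLp.smul_apply, smul_eq_mul]
    rw [hA₁, sums_div_coord, ← hv]
    simp [vec, div_eq_inv_mul]
  have hlast : V₁ d = h.2 + m⁻¹ * scAvg W h.1 o L s := by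
    simp only [hV₁]
    rw [hA₁, sums_div_last, ht, div_eq_inv_mul]
  refine ⟨_, (r1.seq (r2.seq (r3.seq (r4.seq r5)))).mono ?_,
    ⟨⟨?_, ?_, ?_⟩, ?_, ?_, ?_, ?_, ?_⟩, ?_, ?_⟩
  · have c1 : (RExp.add (rV nI) (.div (.div (rA nI) (rS 5)) (rS 6))).cost = 34 := rfl
    have c2 : (RExp.div (rV nI) (rS 9)).cost = 13 := rfl
    have c3 : (RExp.div (rS 7) (rN 2)).cost = 12 := rfl
    rw [c1, c2, c3]
    have : (d + 1) * 1 ≤ (d + 1) * L := Nat.mul_le_mul_left _ hpos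
    have e1 : (d + 1) * 2000 * L = 2000 * ((d + 1) * L) := by ring
    have e2 : (d + 1) * 3000 * L = 3000 * ((d + 1) * L) := by ring
    omega
  · simpa [hS₁] using h0
  · simpa [hS₁] using h2
  · simpa [hS₁] using h8
  · simpa [hS₁] using h4
  · simpa [hS₁] using h5
  · simpa [hS₁] using h6
  · simp only [hyp, refine]
    rw [← hvec]
    ext k
    simp [vec, hV₂, div_eq_inv_mul]
  · simp only [hyp, refine]
    rw [← hvec, ← hlast]
  · simp
  · simp only [stageOffset, ho]; ring

theorem reach_stages (hn : 0 < nomLen d ε δ i)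
    (hb : ∀ j < K, ε < 120 * ‖chow ε δ i s‖ * rad ε j)
    (ha : 120 * ‖chow ε δ i s‖ * rad ε K ≤ ε) (k : ℕ) (hk : k ≤ K)
    (hC : Holding ε δ i ‖chow ε δ i s‖ (hyp ε δ i s (K - k)) C) (h7 : C.S 7 = rad ε (K - k))
    (hN : C.N = stageOffset d ε δ i (K - k)) :
    ∃ C', Reach s (.while refineB stageP) C C' ((d + 1) * 4000 * (k * len d ε δ i) + 100) ∧
      Holding ε δ i ‖chow ε δ i s‖ (hyp ε δ i s K) C' ∧ C'.N = stageOffset d ε δ i K := by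
  have hcost : refineB.cost ≤ 100 := by decide
  induction k generalizing C with
  | zero =>
    rw [Nat.sub_zero] at hC h7 hN
    refine ⟨C, (Reach.whileFalse ?_).mono (by omega), hC, hN⟩
    intro X p g k
    simpa [refineB, BExp.holds, Core.st, RExp.eval, hC.eps, hC.norm, h7] using ha
  | succ k ih =>
    have e : K - (k + 1) + 1 = K - k := by omega
    obtain ⟨C₁, r, hH, h7', hN'⟩ := reach_stageP (s := s) hn hC h7 hN
    rw [e] at hH h7' hN'
    obtain ⟨C', r', hH', hN''⟩ := ih (by omega) hH h7' hN'
    refine ⟨C', (Reach.whileTrue ?_ r r').mono ?_, hH', hN''⟩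
    · intro X p g k'
      simpa [refineB, BExp.holds, Core.st, RExp.eval, hC.eps, hC.norm, h7] using
        hb (K - (k + 1)) (by omega)
    · have hpos : 0 < len d ε δ i := Nat.ceil_pos.2 hn
      have : (d + 1) * 1 ≤ (d + 1) * len d ε δ i := Nat.mul_le_mul_left _ hpos
      have e1 : (d + 1) * 4000 * ((k + 1) * len d ε δ i) =
        (d + 1) * 4000 * (k * len d ε δ i) + (d + 1) * 3000 * len d ε δ i +
          1000 * ((d + 1) * len d ε δ i) := by ring
      omega

theorem eval_read_lit {V X A S : ℕ → ℝ} {p g : ℝ} {c f N k : ℕ} (hk : k < d + 1) :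
    (RExp.read (.lit k)).eval (RealRAM.st d V X A p g S i c f N) = V k := mem_V hk

theorem reach_initP (hd : 1 ≤ d) :
    ∃ C', Reach s initP ⟨fun j => if j = 0 then ε else if j = 1 then δ else 0, fun _ => 0,
      fun _ => 0, 0, 0, 0⟩ C' 400 ∧ AtRound d ε δ 0 C' := by
  set V : ℕ → ℝ := fun j => if j = 0 then ε else if j = 1 then δ else 0 with hV
  have r1 := reach_setS (d := d) (s := s) (C := ⟨V, fun _ => 0, fun _ => 0, 0, 0, 0⟩) (k := 0)
    (e := .read (.lit 0)) (r := ε) (fun X p g i => by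
      rw [Core.st, eval_read_lit (by omega)]; simp [hV])
  have r2 := reach_setS (d := d) (s := s)
    (C := ⟨V, fun _ => 0, Function.update (fun _ => 0) 0 ε, 0, 0, 0⟩) (k := 1)
    (e := .read (.lit 1)) (r := δ) (fun X p g i => by
      rw [Core.st, eval_read_lit (by omega)]; simp [hV])
  have r3 := reach_setS (d := d) (s := s)
    (C := ⟨V, fun _ => 0, Function.update (Function.update (fun _ => 0) 0 ε) 1 δ, 0, 0, 0⟩) (k := 8)
    (e := .mul (rN 4) (.add (rN 1) (.log (.div (rN 1) (rS 0))))) (r := Lam ε)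
    (fun X p g i => by simp [Core.st, RExp.eval, Lam])
  have r4 := reach_setS (d := d) (s := s)
    (C := ⟨V, fun _ => 0, Function.update (Function.update (Function.update (fun _ => 0) 0 ε) 1 δ)
      8 (Lam ε), 0, 0, 0⟩) (k := 2)
    (e := .mul (.cast nD) (.mul (rN 40)
        (.log (.div (.mul (rN 10) (.cast nD)) (.mul (rS 0) (rS 1)))))) (r := d * ell d ε δ)
    (fun X p g i => by simp [Core.st, RExp.eval, ell])
  have r5 := reach_setS (d := d) (s := s)
    (C := ⟨V, fun _ => 0, Function.update (Function.update (Function.update (Function.update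
      (fun _ => 0) 0 ε) 1 δ) 8 (Lam ε)) 2 (d * ell d ε δ), 0, 0, 0⟩) (k := 3)
    (e := rN 1) (r := 1) (fun X p g i => by simp)
  exact ⟨_, (r1.seq (r2.seq (r3.seq (r4.seq r5)))).mono (by decide),
    ⟨⟨by simp, by simp, by simp⟩, by simp, rfl, by simp [offset]⟩⟩

/-- The powers of two are unbounded and the other side is fixed, so the search for a round ends on
every sample sequence, good or not. -/
theorem exists_long (hε : 0 < ε) : ∃ i, Long ε i := by
  obtain ⟨i, hi⟩ := pow_unbounded_of_one_lt (100000000000000 * Lam ε ^ 6 / ε ^ 2)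
    (one_lt_two : (1 : ℝ) < 2)
  refine ⟨i, ?_⟩
  rw [div_lt_iff₀ (by positivity)] at hi
  exact hi.le

theorem exists_rad_le (hε : 0 < ε) (m : ℝ) : ∃ j, 120 * m * rad ε j ≤ ε := by
  obtain ⟨j, hj⟩ := pow_unbounded_of_one_lt (120 * m * (1 / (1200 * Lam ε ^ 2)) / ε)
    (one_lt_two : (1 : ℝ) < 2)
  refine ⟨j, ?_⟩
  rw [div_lt_iff₀ hε] at hj
  unfold rad
  rw [← mul_div_assoc, div_le_iff₀ (by positivity)]
  linarith

theorem output_st (X : ℕ → ℝ) (p g : ℝ) (k : ℕ) :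
    (C.st d X p g k).output d = halfspace (vec d C.V) (C.V d) := by
  have h1 : (C.st d X p g k).rmem d = C.V d := mem_V (by omega)
  have h2 : (WithLp.toLp 2 fun i : Fin d => (C.st d X p g k).rmem i) = vec d C.V := by
    ext i
    exact mem_V (by omega)
  unfold State.output
  rw [h1, h2]

/-- The learner halts on every sequence of samples, in time linear in the number of values read,
and it computes the hypothesis of the model. -/
theorem exists_exec_learner (hd : 1 ≤ d) (hε : 0 < ε) (hε' : ε < 1 / 2) (hδ : 0 < δ)
    (hδ' : δ < 1 / 2) (s : ℕ → EuclideanSpace ℝ (Fin d) × ℤˣ) :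
    ∃ (σ : State) (T I K : ℕ) (h : EuclideanSpace ℝ (Fin d) × ℝ),
      Exec s learner (init d ε δ) σ T ∧ T ≤ 20000 * (d * σ.drawn) ∧ Outcome ε δ s I K h ∧
      σ.drawn = stageOffset d ε δ I K ∧ σ.output d = halfspace h.1 h.2 := by
  classical
  have hl := one_le_ell hd hε hε' hδ hδ'
  have hn : ∀ i, 0 < nomLen d ε δ i := fun i => by linarith [one_le_nomLen hd hl i]
  have hex : ∃ i, Accept ε δ i s ∨ Long ε i := by
    obtain ⟨i, hi⟩ := exists_long hε
    exact ⟨i, Or.inr hi⟩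
  -- The program stops in the first round that is accepted or long; minimality supplies the
  -- conditions on earlier rounds.
  set I := Nat.find hex with hI
  have hIs : Accept ε δ I s ∨ Long ε I := Nat.find_spec hex
  have hprev : ∀ k < I, ¬ Accept ε δ k s ∧ ¬ Long ε k := fun k hk => by
    have := Nat.find_min hex hk
    tauto
  obtain ⟨C₀, r0, h0⟩ := reach_initP (s := s) (ε := ε) (δ := δ) hd
  obtain ⟨C₁, m, h, r1, hFd, hH, hN⟩ := reach_rounds (s := s) hn hIs hprev I le_rfl
    (by rw [Nat.sub_self]; exact h0)
  rw [Nat.sub_self] at r1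
  have r2 := reach_setS (s := s) (C := C₁) (k := 7) (r := rad ε 0)
    (e := .div (rN 1) (.mul (rN 1200) (.mul (rS 8) (rS 8)))) (fun X p g i => by
      simp [Core.st, RExp.eval, hH.lam, rad, sq])
  have hH' : Holding ε δ I m h { C₁ with S := Function.update C₁.S 7 (rad ε 0) } :=
    ⟨⟨by simpa using hH.eps, by simpa using hH.scale, by simpa using hH.lam⟩,
      by simpa using hH.nom, by simpa using hH.len, by simpa using hH.norm, hH.vec, hH.thr⟩
  have key : ∃ K h' C', Reach s (.while refineB stageP)
      { C₁ with S := Function.update C₁.S 7 (rad ε 0) } C'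
      ((d + 1) * 4000 * (K * len d ε δ I) + 100) ∧ Outcome ε δ s I K h' ∧
      vec d C'.V = h'.1 ∧ C'.V d = h'.2 ∧ C'.N = stageOffset d ε δ I K := by
    rcases hFd with ⟨hacc, rfl, rfl⟩ | ⟨hrej, hlong, rfl, rfl⟩
    · have hexK := exists_rad_le (ε := ε) hε ‖chow ε δ I s‖
      set K := Nat.find hexK with hK
      have hKs : 120 * ‖chow ε δ I s‖ * rad ε K ≤ ε := Nat.find_spec hexK
      have hKm : ∀ j < K, ε < 120 * ‖chow ε δ I s‖ * rad ε j := fun j hj =>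
        not_le.1 (Nat.find_min hexK hj)
      obtain ⟨C', r, hC', hN'⟩ := reach_stages (s := s) (hn I) hKm hKs K le_rfl
        (C := { C₁ with S := Function.update C₁.S 7 (rad ε 0) })
        (by rw [Nat.sub_self]; exact hH') (by simp) (by simp [hN, stageOffset])
      exact ⟨K, _, C', r, .accepted I K hprev hacc hKm hKs, hC'.vec, hC'.thr, hN'⟩
    · refine ⟨0, _, _, (Reach.whileFalse ?_).mono ?_, .constant I hprev hrej hlong, hH'.vec, hH'.thr,
        by simp [hN, stageOffset]⟩
      · intro X p g k
        simp [refineB, BExp.holds, Core.st, RExp.eval, hH.eps, hH.norm, hε.le]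
      · have hcost : refineB.cost ≤ 100 := by decide
        omega
  obtain ⟨K, h', C', r3, hO, hv, ht, hN'⟩ := key
  obtain ⟨X', p', g', i', T, hT, hex⟩ := (r0.seq (r1.seq (r2.seq r3))) (fun _ => 0) 0 0 0
  -- The inputs in real cells 0 and 1 both lie in the hypothesis area because `d ≥ 1`; `initP`
  -- copies them away before that area is overwritten.
  have hinit : init d ε δ = Core.st d ⟨fun j => if j = 0 then ε else if j = 1 then δ else 0,
      fun _ => 0, fun _ => 0, 0, 0, 0⟩ (fun _ => 0) 0 0 0 := by
    unfold init Core.st RealRAM.st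
    congr 1
    · funext j; unfold nats; split_ifs <;> rfl
    · funext j
      by_cases h : j < d + 1
      · rw [mem_V h]
      · unfold mem
        rw [if_neg (by omega : ¬ j = 0), if_neg (by omega : ¬ j = 1), if_neg h]
        split_ifs <;> rfl
  rw [← hinit] at hex
  refine ⟨_, T, I, K, h', hex, ?_, hO, hN', ?_⟩
  · have c1 : (RExp.div (rN 1) (.mul (rN 1200) (.mul (rS 8) (rS 8)))).cost = 25 := rfl
    have e0 : offset d ε δ 0 = 0 := by simp [offset]
    rw [c1, e0, Nat.sub_zero] at hT
    have hdr : (C'.st d X' p' g' i').drawn = stageOffset d ε δ I K := hN'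
    rw [hdr]
    have hpos : 0 < len d ε δ I := Nat.ceil_pos.2 (hn I)
    have hst : stageOffset d ε δ I K = offset d ε δ (I + 1) + K * len d ε δ I := rfl
    have hoff := offset_succ d ε δ I
    have h1 : 1 ≤ stageOffset d ε δ I K := by omega
    have h2 : (d + 1) * 4000 * (K * len d ε δ I) ≤ (d + 1) * 6000 * (K * len d ε δ I) := by
      gcongr; omega
    have e3 : (d + 1) * 6000 * offset d ε δ (I + 1) + (d + 1) * 6000 * (K * len d ε δ I) =
      (d + 1) * 6000 * stageOffset d ε δ I K := by rw [hst]; ring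
    have h4 : (d + 1) * 6000 * stageOffset d ε δ I K ≤ (2 * d) * 6000 * stageOffset d ε δ I K := by
      gcongr; omega
    have e5 : (2 * d) * 6000 * stageOffset d ε δ I K = 12000 * (d * stageOffset d ε δ I K) := by ring
    have h6 : 1 * 1 ≤ d * stageOffset d ε δ I K := Nat.mul_le_mul hd h1
    omega
  · rw [output_st, hv, ht]

end Run

end RealRAM

/-! ### Assembly. -/

open RealRAM in
-- On the good event the argument is deterministic: the stopping round and the number of stages stay
-- below the caps in `Good`, so the accuracy and sample bounds of the model apply to the actual run.
theorem exists_accurate_exec {d : ℕ} {ε δ : ℝ} (hd : 1 ≤ d) (hε : 0 < ε) (hε' : ε < 1 / 2)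
    (hδ : 0 < δ) (hδ' : δ < 1 / 2) {η : ℝ} {w : EuclideanSpace ℝ (Fin d)} {t : ℝ}
    {D : Measure (EuclideanSpace ℝ (Fin d) × ℤˣ)} [IsProbabilityMeasure D] (h0 : 0 < η)
    (h1 : η < 1 / 2) (hD : IsRCN D (halfspace w t) η)
    {s : ℕ → EuclideanSpace ℝ (Fin d) × ℤˣ} (hg : Good D ε δ (maxRounds ε) ⌈1 / ε⌉₊ s) :
    ∃ (σ : State) (T : ℕ), Exec s learner (init d ε δ) σ T ∧
      (σ.drawn : ℝ) ≤ 500000000000000000000000 * (sampleScale d ε η (bias (halfspace w t)) *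
        Real.log (sampleScale d ε η (bias (halfspace w t))) ^ 8 * Real.log (1 / δ)) ∧
      zeroOneError D (σ.output d) ≤ η + ε := by
  obtain ⟨σ, T, I, K, h, hex, -, ho, hdr, hout⟩ := exists_exec_learner hd hε hε' hδ hδ' s
  obtain ⟨w', t', hwt, hw'⟩ := exists_normalized w t
  rw [← hwt] at hD ⊢
  have hI := ho.lt_maxRounds hε
  have hK := stages_le_ceil hε (hg.two_pow_stage_lt hd hε hε' hδ hδ' hI hw' hD h0 h1 ho)
  refine ⟨σ, T, hex, ?_, ?_⟩
  · rw [hdr]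
    refine (hg.drawn_le hd hε hε' hδ hδ' hI hw' hD h0 h1 ho).trans
      (scales_le hd hε hε' hδ hδ' ?_)
    rw [sampleScale_eq]
    gcongr
    exact one_le_unitScale hε hε' h0 h1 (bias_nonneg _) (bias_le_one _)
  · rw [hout, hD.zeroOneError_eq (measurable_halfspace w' t') (measurable_halfspace h.1 h.2) h0
      (by linarith)]
    have := hg.excess_le hd hε hε' hδ hδ' hI hw' hD h0 h1 hK ho
    linarith

end

/-- One program, which is given `d`, `ε`, `δ` and sample access, and knows neither the target, nor
its bias, nor the noise rate, learns halfspaces with random classification noise. -/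
theorem theorem1 :
    ∃ (P : RealRAM.Prog) (C : ℝ) (k : ℕ),
      ∀ (d : ℕ) (ε δ : ℝ), 1 ≤ d → 0 < ε → ε < 1 / 2 → 0 < δ → δ < 1 / 2 →
        -- on every sequence of samples: running time at most `C d N / ε ^ 2`,
        -- where `N` is the number of samples drawn
        (∀ s : ℕ → EuclideanSpace ℝ (Fin d) × ℤˣ, ∃ (σ : RealRAM.State) (T : ℕ),
          RealRAM.Exec s P (RealRAM.init d ε δ) σ T ∧
          (T : ℝ) ≤ C * (d * σ.drawn / ε ^ 2)) ∧
        -- except with probability at most `δ`: few samples are drawn and the output is accurate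
        (∀ (η : ℝ) (w : EuclideanSpace ℝ (Fin d)) (t : ℝ)
            (D : Measure (EuclideanSpace ℝ (Fin d) × ℤˣ)) [IsProbabilityMeasure D],
          0 < η → η < 1 / 2 → IsRCN D (halfspace w t) η →
          Measure.infinitePi (fun _ : ℕ => D)
            {s | ¬ ∃ (σ : RealRAM.State) (T : ℕ),
              RealRAM.Exec s P (RealRAM.init d ε δ) σ T ∧
              (σ.drawn : ℝ) ≤ C * (sampleScale d ε η (bias (halfspace w t)) *
                Real.log (sampleScale d ε η (bias (halfspace w t))) ^ k * Real.log (1 / δ)) ∧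
              zeroOneError D (σ.output d) ≤ η + ε} ≤ ENNReal.ofReal δ) := by
  refine ⟨RealRAM.learner, 500000000000000000000000, 8,
    fun d ε δ hd hε hε' hδ hδ' => ⟨fun s => ?_, ?_⟩⟩
  · obtain ⟨σ, T, I, K, h, hex, hT, -, -, -⟩ :=
      RealRAM.exists_exec_learner hd hε hε' hδ hδ' s
    refine ⟨σ, T, hex, ?_⟩
    have h1 : (T : ℝ) ≤ 20000 * (d * σ.drawn) := by exact_mod_cast hT
    -- The program is already linear in the data read; `ε < 1` makes the allowance `1/ε²` free.
    have h2 : (d * σ.drawn : ℝ) ≤ d * σ.drawn / ε ^ 2 :=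
      le_div_self (by positivity) (by positivity) (pow_le_one₀ hε.le (by linarith))
    have h3 : (0 : ℝ) ≤ d * σ.drawn / ε ^ 2 := by positivity
    linarith
  · intro η w t D _ h0 h1 hD
    refine le_trans (measure_mono ?_) (measure_not_good_le_delta hd hD hε hε' hδ hδ')
    intro s hs hg
    exact hs (exists_accurate_exec hd hε hε' hδ hδ' h0 h1 hD hg)
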